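/- Definitions. Let $n,m,r\in\mathbb N$. The special class $\mathcal S(n,m,r)$ consists of the linear systems $\dot X=A(t)X$ with $$A(t)=\sum_{j=1}^m\frac{A_j}{t-t_j}+\sum_{k=0}^r A_k'\,t^k ,$$ where $t_1,\dots,t_m\in[-1,1]$ are distinct real points, $A_j,A'_k$ are real $n\times n$ matrices (zero residues allowed) with $\sum_j\|A_j\|+\sum_k\|A'_k\|\le r$ in the operator norm, the singular point $t=\infty$ is regular, and every fundamental matrix solution satisfies $\|X(t)\|+\|X^{-1}(t)\|\le c\,|t|^r$ as $t\to\infty$ along any ray. The singular locus $\Sigma$ of the system is the set of finite poles of $A(t)$. The monodromy factor $M_\gamma$ of a loop $\gamma$ in $\mathbb C\setminus\Sigma$ is defined by: analytic continuation of a fundamental solution $X$ along $\gamma$ yields $XM_\gamma$. The system satisfies the spectral condition if for every simple loop $\gamma$ in $\mathbb C\setminus\Sigma$ all eigenvalues of $M_\gamma$ lie on the unit circle. Two systems of the same size $n$ are isomonodromic in a domain $U$ if they have the same singular points in $U$ and none on $\partial U$, and if their monodromy factors along all loops (with a common base point) contained in $U\setminus\Sigma$ are simultaneously conjugate. Lemma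 (isomonodromic surgery). There is a primitive recursive function $\mathfrak B(n,m,r,q)$ with the following property. Let a system in $\mathcal S(n,m,r)$ with singular locus $\Sigma$, real numbers $0\le a<b$ and $q\in\mathbb N$ satisfy $$\tfrac1q<b<q,\qquad b>\bigl(1+\tfrac1q\bigr)a,$$ and suppose that $\Sigma$ is disjoint from the annulus $\{a<|t|<b\}$ and from its outer boundary circle $\{|t|=b\}$. Then there is a system in some special class $\mathcal S(n,m',r')$ which is isomonodromic to the given one in the disk $\{|t|<b\}$ and has no finite singularities outside this disk, with $$m'\le\mathfrak B(n,m,r,q),\qquad r'\le\mathfrak B(n,m,r,q).$$ If the given system satisfies the spectral condition, then so does the new one. -/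

import Mathlib

open scoped Matrix.Norms.Operator

noncomputable section

/-- Complex `n × n` matrices; `‖·‖` is the operator norm (induced by the sup norm). -/
abbrev CMat (n : ℕ) : Type := Matrix (Fin n) (Fin n) ℂ

/-- Real `n × n` matrices, with the same operator norm. -/
abbrev RMat (n : ℕ) : Type := Matrix (Fin n) (Fin n) ℝ

/-- A real matrix viewed as a complex one. -/
def complexify {n : ℕ} (M : RMat n) : CMat n := M.map (fun x : ℝ => (x : ℂ))

/-- `X` is a (single-valued branch of a) fundamental matrix solution of `dX/dt = A(t) X`
on the set `W`. -/
def IsFundamentalOn {n : ℕ} (A : ℂ → CMat n) (X : ℂ → CMat n) (W : Set ℂ) : Prop :=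
  ∀ t ∈ W, HasDerivAt X (A t * X t) t ∧ IsUnit (X t)

/-- The exterior `|t| > 1` of the unit disk, slit along the ray of direction `-u`. -/
def slitExterior (u : ℂ) : Set ℂ := {t | 1 < ‖t‖ ∧ t / u ∈ Complex.slitPlane}

/-- The singular point `t = ∞` is regular (for a system without poles in `|t| > 1`): the branches
of the fundamental solutions grow at most polynomially in the (full, slit) sectors at infinity. -/
def RegularAtInfinity {n : ℕ} (A : ℂ → CMat n) : Prop :=
  ∀ u : ℂ, ‖u‖ = 1 → ∀ X : ℂ → CMat n, IsFundamentalOn A X (slitExterior u) →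
    ∃ (N : ℕ) (c : ℝ), ∀ t ∈ slitExterior u, 2 ≤ ‖t‖ → ‖X t‖ ≤ c * ‖t‖ ^ N

/-- Every branch of every fundamental solution satisfies `‖X(t)‖ + ‖X⁻¹(t)‖ ≤ c |t|^r`
as `t → ∞` along any ray `t = s v`, `s → +∞`. -/
def GrowthAtInfinityLE {n : ℕ} (A : ℂ → CMat n) (r : ℕ) : Prop :=
  ∀ u : ℂ, ‖u‖ = 1 → ∀ X : ℂ → CMat n, IsFundamentalOn A X (slitExterior u) →
    ∀ v : ℂ, ‖v‖ = 1 → v / u ∈ Complex.slitPlane →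
      ∃ c : ℝ, 0 < c ∧ ∀ᶠ s : ℝ in Filter.atTop,
        ‖X ((s : ℂ) * v)‖ + ‖(X ((s : ℂ) * v))⁻¹‖ ≤ c * s ^ r

/-- The coefficient matrix `∑ A_j / (t - t_j) + ∑_{k ≤ r} A'_k t^k`. -/
def coeffMatrix {n m r : ℕ} (pole : Fin m → ℝ) (res : Fin m → RMat n)
    (poly : Fin (r + 1) → RMat n) (t : ℂ) : CMat n :=
  (∑ j : Fin m, (t - (pole j : ℂ))⁻¹ • complexify (res j)) +
    ∑ k : Fin (r + 1), t ^ (k : ℕ) • complexify (poly k)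

/-- The special class `S(n, m, r)`. A zero residue is allowed, so that `m` bounds
the number of finite singular points. -/
structure SpecialSystem (n m r : ℕ) where
  /-- the points `t_1, …, t_m` -/
  pole : Fin m → ℝ
  /-- the residues `A_1, …, A_m` -/
  res : Fin m → RMat n
  /-- the coefficients `A'_0, …, A'_r` -/
  poly : Fin (r + 1) → RMat n
  pole_injective : Function.Injective pole
  abs_pole_le : ∀ j, |pole j| ≤ 1
  norm_le : (∑ j, ‖res j‖) + (∑ k, ‖poly k‖) ≤ (r : ℝ)
  regular : RegularAtInfinity (coeffMatrix pole res poly)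
  growth : GrowthAtInfinityLE (coeffMatrix pole res poly) r

namespace SpecialSystem

variable {n m r : ℕ}

/-- The coefficient matrix `A(t)` of the system `dX/dt = A(t) X`. -/
def coeff (S : SpecialSystem n m r) : ℂ → CMat n := coeffMatrix S.pole S.res S.poly

/-- The singular (polar) locus: all finite poles of `A(t)`. -/
def locus (S : SpecialSystem n m r) : Set ℂ := {z | ∃ j, S.res j ≠ 0 ∧ z = (S.pole j : ℂ)}

end SpecialSystem

/-- `Y` gives the values along the path `γ` of the analytic continuation along `γ` of a germ
of a matrix solution of `dX/dt = A(t) X`. -/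
def IsContinuationAlong {n : ℕ} (A : ℂ → CMat n) {x y : ℂ} (γ : Path x y)
    (Y : unitInterval → CMat n) : Prop :=
  ∀ τ : unitInterval, ∃ X : ℂ → CMat n,
    (∀ᶠ z in nhds (γ τ), HasDerivAt X (A z * X z) z) ∧ ∀ᶠ σ in nhds τ, Y σ = X (γ σ)

/-- `M` is the monodromy factor along the loop `γ` based at `x` of the fundamental solution
normalized by `X(x) = 1`: continuation along `γ` transforms `X` into `X M`. -/
def IsMonodromyFactor {n : ℕ} (A : ℂ → CMat n) {x : ℂ} (γ : Path x x) (M : CMat n) : Prop :=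
  ∃ Y : unitInterval → CMat n, IsContinuationAlong A γ Y ∧ Y 0 = 1 ∧ Y 1 = M

/-- A simple loop: a closed Jordan curve without self-intersections. -/
def IsSimpleLoop {x : ℂ} (γ : Path x x) : Prop := Set.InjOn γ (Set.Iio (1 : unitInterval))

/-- The simple-loop spectral condition for the system `dX/dt = A(t) X` with singular locus `Sig`:
the eigenvalues of all monodromy factors along simple loops in `ℂ ∖ Sig` lie on the unit circle. -/
def SpectralCondition {n : ℕ} (A : ℂ → CMat n) (Sig : Set ℂ) : Prop :=
  ∀ (x : ℂ) (γ : Path x x), IsSimpleLoop γ → (∀ τ, γ τ ∉ Sig) →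
    ∀ M : CMat n, IsMonodromyFactor A γ M → ∀ μ ∈ spectrum ℂ M, ‖μ‖ = 1

/-- The systems with coefficient matrices `A`, `B` and singular loci `SigA`, `SigB` are
isomonodromic in the domain `U`. -/
structure IsomonodromicIn {n : ℕ} (A : ℂ → CMat n) (SigA : Set ℂ) (B : ℂ → CMat n)
    (SigB : Set ℂ) (U : Set ℂ) : Prop where
  same_locus : SigA ∩ U = SigB ∩ U
  left_boundary : Disjoint SigA (frontier U)
  right_boundary : Disjoint SigB (frontier U)
  /-- For each nonsingular base point, one matrix conjugates the monodromy factors of the two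
  systems along all the loops contained in `U`. -/
  conj : ∀ x ∈ U \ SigA, ∃ C : (CMat n)ˣ, ∀ γ : Path x x, (∀ τ, γ τ ∈ U \ SigA) →
    ∀ M : CMat n, IsMonodromyFactor A γ M ↔
      IsMonodromyFactor B γ ((C : CMat n) * M * ((C⁻¹ : (CMat n)ˣ) : CMat n))

end

/-! If every pole lies in |t| < b, the given system itself will do. Otherwise some pole has modulus
in [b, 1], so b ≤ 1, and the annulus free of singular points has width at least `gapWidth q`. On
such an annulus a fundamental solution has the form F(t) t^L with F single-valued. Since A is real
on the real axis, the monodromy M of the circle, normalized at a real point, satisfies conj M = M⁻¹,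
and therefore L can be chosen real, with a bound (`exists_real_log`, `exists_floquet`).

Suppose F = G⁻¹ E, with G holomorphic and invertible in the disk, and E holomorphic and invertible
outside with at most polynomial growth of E and E⁻¹ at infinity. On the annulus the gauge transform
of A by G and the equation solved by E(t) t^L have the same coefficient, so they glue to one
coefficient matrix B on the whole plane. B has simple poles in the disk, with residues G(t_j) A_j
G(t_j)⁻¹, and grows polynomially; subtracting the principal part leaves a polynomial by Liouville's
theorem. The monodromy in the disk is only conjugated by the value of G at the base point.

The factorization need not be Birkhoff's normal form, since a pole of any bounded order at infinity
is admissible. Approximating F⁻¹ by a Laurent polynomial z^(-N) P(z) reduces the problem to a matrix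
function close to 1, which is factored by a convergent iteration (`exists_factorization_near_one`).
The zeros of det P in the disk are then removed by rational left factors with poles in the inner
disk (`exists_reduction_step`). All factors are symmetric under complex conjugation, so the new
system is real, and all are bounded by elementary functions of n, r and q
(`SpecialSystem.exists_surgery`), which primitive recursive functions dominate.

For the spectral condition, a simple loop may leave the disk. Outside, solutions of the new system
are E(t) t^L times a constant, so compressing the plane radially into the disk, by an injective map
equal to the identity near the poles, changes the monodromy by a conjugation and keeps the loop
simple. In the disk the gauge transformation leads back to A (`SpectralCondition.of_gauge`). -/

noncomputable section

/-! ### Linear holomorphic differential equations on convex domains. -/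

section LinearODE

variable {E : Type*} [NormedAddCommGroup E] [NormedSpace ℂ E]

lemma segment_param_mem {W : Set ℂ} (hW : Convex ℝ W) {s₀ s : ℂ} (h₀ : s₀ ∈ W) (hs : s ∈ W)
    {x : ℝ} (hx : x ∈ Set.Icc (0 : ℝ) 1) : s₀ + x * (s - s₀) ∈ W := by
  have := hW.add_smul_sub_mem h₀ hs hx
  simpa using this

lemma hasDerivAt_comp_segment {f : ℂ → E} {f' : E} {s₀ s : ℂ} {x : ℝ}
    (hf : HasDerivAt f f' (s₀ + x * (s - s₀))) :
    HasDerivAt (fun x : ℝ => f (s₀ + x * (s - s₀))) ((s - s₀) • f') x := by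
  have h1 : HasDerivAt (fun z : ℂ => s₀ + z * (s - s₀)) (s - s₀) (x : ℂ) := by
    simpa using ((hasDerivAt_id (x : ℂ)).mul_const (s - s₀)).const_add s₀
  exact HasDerivAt.scomp x hf h1.comp_ofReal

/-- A norm bound for a function at a point of a convex set from a bound on its derivative along
the segment. -/
lemma norm_le_of_norm_deriv_le_segment {W : Set ℂ} (hW : Convex ℝ W) {f f' : ℂ → E}
    (hf : ∀ s ∈ W, HasDerivAt f (f' s) s) {s₀ s : ℂ} (h₀ : s₀ ∈ W) (hs : s ∈ W) {B B' : ℝ → ℝ}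
    (hB0 : ‖f s₀‖ ≤ B 0) (hB : ∀ x, HasDerivAt B (B' x) x)
    (bound : ∀ x ∈ Set.Ico (0 : ℝ) 1, ‖s - s₀‖ * ‖f' (s₀ + x * (s - s₀))‖ ≤ B' x) :
    ‖f s‖ ≤ B 1 := by
  have hd : ∀ x ∈ Set.Icc (0 : ℝ) 1, HasDerivAt (fun x : ℝ => f (s₀ + x * (s - s₀)))
      ((s - s₀) • f' (s₀ + x * (s - s₀))) x := fun x hx =>
    hasDerivAt_comp_segment (hf _ (segment_param_mem hW h₀ hs hx))
  have := image_norm_le_of_norm_deriv_right_le_deriv_boundary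
    (f := fun x : ℝ => f (s₀ + x * (s - s₀))) (a := 0) (b := 1)
    (fun x hx => (hd x hx).continuousAt.continuousWithinAt)
    (fun x hx => (hd x ⟨hx.1, hx.2.le⟩).hasDerivWithinAt) (by simpa using hB0) hB
    (fun x hx => by rw [norm_smul]; exact bound x hx) (Set.right_mem_Icc.2 zero_le_one)
  simpa using this

/-- Grönwall's inequality on a convex set. -/
lemma norm_le_exp_of_linear_ode {W : Set ℂ} (hW : Convex ℝ W) {y y' : ℂ → E}
    (hy : ∀ s ∈ W, HasDerivAt y (y' s) s) {K : ℝ} (hK : ∀ s ∈ W, ‖y' s‖ ≤ K * ‖y s‖)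
    {s₀ s : ℂ} (h₀ : s₀ ∈ W) (hs : s ∈ W) : ‖y s‖ ≤ ‖y s₀‖ * Real.exp (K * ‖s - s₀‖) := by
  have hd : ∀ x ∈ Set.Icc (0 : ℝ) 1, HasDerivAt (fun x : ℝ => y (s₀ + x * (s - s₀)))
      ((s - s₀) • y' (s₀ + x * (s - s₀))) x := fun x hx =>
    hasDerivAt_comp_segment (hy _ (segment_param_mem hW h₀ hs hx))
  have := norm_le_gronwallBound_of_norm_deriv_right_le
    (f := fun x : ℝ => y (s₀ + x * (s - s₀))) (a := 0) (b := 1) (δ := ‖y s₀‖)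
    (K := K * ‖s - s₀‖) (ε := 0)
    (fun x hx => (hd x hx).continuousAt.continuousWithinAt)
    (fun x hx => (hd x ⟨hx.1, hx.2.le⟩).hasDerivWithinAt) (by simp)
    (fun x hx => by
      rw [norm_smul, add_zero, mul_right_comm, mul_comm]
      exact mul_le_mul_of_nonneg_right
        (hK _ (segment_param_mem hW h₀ hs ⟨hx.1, hx.2.le⟩)) (norm_nonneg _))
    1 (Set.right_mem_Icc.2 zero_le_one)
  simpa [gronwallBound_ε0] using this

lemma eq_of_hasDerivAt_zero {W : Set ℂ} (hW : Convex ℝ W) {y : ℂ → E}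
    (hy : ∀ s ∈ W, HasDerivAt y 0 s) {s₀ s : ℂ} (h₀ : s₀ ∈ W) (hs : s ∈ W) : y s = y s₀ := by
  have := norm_le_exp_of_linear_ode hW (y := fun s => y s - y s₀) (y' := fun _ => 0) (K := 0)
    (fun s hs => (hy s hs).sub_const _) (by simp) h₀ hs
  simpa [sub_eq_zero] using this

variable [CompleteSpace E]

lemma exists_primitive_vanishing {W : Set ℂ} (hW : Convex ℝ W) (hWo : IsOpen W) {f : ℂ → E}
    (hf : DifferentiableOn ℂ f W) (s₀ : ℂ) :
    ∃ g : ℂ → E, g s₀ = 0 ∧ ∀ s ∈ W, HasDerivAt g (f s) s := by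
  obtain ⟨g, hg⟩ := hW.exists_forall_hasDerivWithinAt hf
  exact ⟨fun s => g s - g s₀, sub_self _, fun s hs =>
    ((hg s hs).hasDerivAt (hWo.mem_nhds hs)).sub_const _⟩

/-- Existence for linear holomorphic differential equations on convex domains. -/
theorem exists_linear_ode_solution {W : Set ℂ} (hW : Convex ℝ W) (hWo : IsOpen W)
    {T : ℂ → E →L[ℂ] E} (hT : DifferentiableOn ℂ T W) {K : ℝ} (hK : ∀ s ∈ W, ‖T s‖ ≤ K)
    {s₀ : ℂ} (h₀ : s₀ ∈ W) (y₀ : E) :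
    ∃ y : ℂ → E, y s₀ = y₀ ∧ ∀ s ∈ W, HasDerivAt y (T s (y s)) s := by
  have hK0 : 0 ≤ K := (norm_nonneg _).trans (hK s₀ h₀)
  -- Picard iteration, run on the increments: each one is the primitive of T applied to the previous
  -- one, normalized to vanish at s₀.
  have step : ∀ D : {D : ℂ → E // DifferentiableOn ℂ D W}, ∃ D' : {D : ℂ → E //
      DifferentiableOn ℂ D W}, D'.1 s₀ = 0 ∧ ∀ s ∈ W, HasDerivAt D'.1 (T s (D.1 s)) s := by
    rintro ⟨D, hD⟩
    obtain ⟨g, hg0, hg⟩ := exists_primitive_vanishing hW hWo (hT.clm_apply hD) s₀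
    exact ⟨⟨g, fun s hs => (hg s hs).differentiableAt.differentiableWithinAt⟩, hg0, hg⟩
  choose nxt hn0 hn using step
  let D : ℕ → {D : ℂ → E // DifferentiableOn ℂ D W} := fun k =>
    nxt^[k] ⟨fun _ => y₀, differentiableOn_const _⟩
  have hDs : ∀ k, D (k + 1) = nxt (D k) := fun k => Function.iterate_succ_apply' _ _ _
  have hDd : ∀ k, ∀ s ∈ W, HasDerivAt (D (k + 1)).1 (T s ((D k).1 s)) s := by
    intro k s hs; rw [hDs]; exact hn _ s hs
  have hD0 : ∀ k, (D (k + 1)).1 s₀ = 0 := by intro k; rw [hDs]; exact hn0 _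
  -- Integrating along the segment from s₀ turns |s - s₀|^k into |s - s₀|^(k + 1) / (k + 1), whence
  -- the factorial.
  have hDb : ∀ k, ∀ s ∈ W, ‖(D k).1 s‖ ≤ ‖y₀‖ * ((K * ‖s - s₀‖) ^ k / k.factorial) := by
    intro k
    induction k with
    | zero => intro s _; simp [D]
    | succ k ih =>
      intro s hs
      have := norm_le_of_norm_deriv_le_segment hW (hDd k) h₀ hs
        (B := fun x => ‖y₀‖ * ((K * ‖s - s₀‖) ^ (k + 1) / (k + 1).factorial) * x ^ (k + 1))
        (B' := fun x => ‖y₀‖ * ((K * ‖s - s₀‖) ^ (k + 1) / (k + 1).factorial) *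
          (((k + 1 : ℕ) : ℝ) * x ^ k))
        (by simp [hD0]) (fun x => by simpa using (hasDerivAt_pow (k + 1) x).const_mul _)
        (fun x hx => by
          have hm := segment_param_mem hW h₀ hs (x := x) ⟨hx.1, hx.2.le⟩
          have h1 : ‖T (s₀ + x * (s - s₀)) ((D k).1 (s₀ + x * (s - s₀)))‖ ≤
              K * (‖y₀‖ * ((K * (x * ‖s - s₀‖)) ^ k / k.factorial)) := by
            refine (ContinuousLinearMap.le_opNorm _ _).trans ?_
            refine mul_le_mul (hK _ hm) ?_ (norm_nonneg _) hK0
            refine (ih _ hm).trans_eq ?_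
            rw [add_sub_cancel_left, norm_mul, Complex.norm_real, Real.norm_of_nonneg hx.1]
          refine (mul_le_mul_of_nonneg_left h1 (norm_nonneg _)).trans_eq ?_
          rw [Nat.factorial_succ]
          push_cast
          field_simp
          ring)
      simpa using this
  -- W may be unbounded (a strip, below), so the series is differentiated termwise on bounded convex
  -- pieces; its sum does not depend on R.
  have key : ∀ R : ℝ, 0 < R → ∀ s ∈ W ∩ Metric.ball s₀ R,
      HasDerivAt (fun s => y₀ + ∑' k, (D (k + 1)).1 s) (T s (y₀ + ∑' k, (D (k + 1)).1 s)) s := by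
    intro R hR s hs
    have hsum : Summable fun k : ℕ => ‖y₀‖ * ((K * R) ^ k / k.factorial) :=
      (Real.summable_pow_div_factorial _).mul_left _
    have hb : ∀ k, ∀ s ∈ W ∩ Metric.ball s₀ R, ‖(D k).1 s‖ ≤ ‖y₀‖ * ((K * R) ^ k / k.factorial) := by
      intro k s hs
      refine (hDb k s hs.1).trans ?_
      have : ‖s - s₀‖ ≤ R := (mem_ball_iff_norm.1 hs.2).le
      gcongr
    have hsm : ∀ s ∈ W ∩ Metric.ball s₀ R, Summable fun k => (D k).1 s := fun s hs =>
      Summable.of_norm_bounded hsum fun k => hb k s hs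
    have hconv : Convex ℝ (W ∩ Metric.ball s₀ R) := hW.inter (convex_ball _ _)
    have h := hasDerivAt_tsum_of_isPreconnected (g := fun k => (D (k + 1)).1)
      (g' := fun k s => T s ((D k).1 s)) (u := fun k => K * (‖y₀‖ * ((K * R) ^ k / k.factorial)))
      (hsum.mul_left K) (hWo.inter Metric.isOpen_ball) hconv.isPreconnected
      (fun k s hs => hDd k s hs.1)
      (fun k s hs => (ContinuousLinearMap.le_opNorm _ _).trans
        (mul_le_mul (hK s hs.1) (hb k s hs) (norm_nonneg _) hK0))
      (y₀ := s₀) ⟨h₀, Metric.mem_ball_self hR⟩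
      ((summable_nat_add_iff 1).2 (hsm s₀ ⟨h₀, Metric.mem_ball_self hR⟩)) hs
    have h2 : y₀ + ∑' k, (D (k + 1)).1 s = ∑' k, (D k).1 s := by
      rw [(hsm s hs).tsum_eq_zero_add]; simp [D]
    rw [h2, ContinuousLinearMap.map_tsum _ (hsm s hs)]
    exact h.const_add y₀
  refine ⟨fun s => y₀ + ∑' k, (D (k + 1)).1 s, by simp [hD0], fun s hs => ?_⟩
  exact key (‖s - s₀‖ + 1) (by positivity) s ⟨hs, by rw [mem_ball_iff_norm]; exact lt_add_one _⟩

end LinearODE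

end

noncomputable section

/-! ### Norms, inverses and complex conjugation of matrices. -/

section MatrixBasics

variable {n : ℕ}

lemma CMat.norm_entry_le (M : CMat n) (i j : Fin n) : ‖M i j‖ ≤ ‖M‖ := by
  have h : ∑ j, ‖M i j‖₊ ≤ ‖M‖₊ := by
    rw [Matrix.linfty_opNNNorm_def]
    exact Finset.le_sup (f := fun i => ∑ j, ‖M i j‖₊) (Finset.mem_univ i)
  exact_mod_cast (Finset.single_le_sum (f := fun j => ‖M i j‖₊) (fun _ _ => zero_le)
    (Finset.mem_univ j)).trans h

lemma CMat.norm_le_of_entry_le (M : CMat n) {c : ℝ} (hc : 0 ≤ c) (h : ∀ i j, ‖M i j‖ ≤ c) :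
    ‖M‖ ≤ n * c := by
  lift c to NNReal using hc
  have : ‖M‖₊ ≤ n * c := by
    rw [Matrix.linfty_opNNNorm_def]
    refine Finset.sup_le fun i _ => ?_
    calc ∑ j, ‖M i j‖₊ ≤ ∑ _j : Fin n, c := Finset.sum_le_sum fun j _ => by exact_mod_cast h i j
      _ = n * c := by simp
  exact_mod_cast this

/-- Evaluation of an entry as a continuous linear map. -/
def CMat.entry (i j : Fin n) : CMat n →L[ℂ] ℂ :=
  LinearMap.toContinuousLinearMap
    { toFun := fun M => M i j, map_add' := fun _ _ => rfl, map_smul' := fun _ _ => rfl }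

lemma CMat.hasDerivAt_iff {X : ℂ → CMat n} {X' : CMat n} {t : ℂ} :
    HasDerivAt X X' t ↔ ∀ i j, HasDerivAt (fun t => X t i j) (X' i j) t := by
  constructor
  · intro h i j
    exact (CMat.entry i j).hasFDerivAt.comp_hasDerivAt t h
  · intro h
    have h1 : HasDerivAt (fun t => ∑ i, ∑ j, X t i j • Matrix.single i j (1 : ℂ))
        (∑ i, ∑ j, X' i j • Matrix.single i j (1 : ℂ)) t :=
      HasDerivAt.fun_sum fun i _ => HasDerivAt.fun_sum fun j _ => (h i j).smul_const _
    have h2 : ∀ M : CMat n, ∑ i, ∑ j, M i j • Matrix.single i j (1 : ℂ) = M := by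
      intro M
      conv_rhs => rw [Matrix.matrix_eq_sum_single M]
      simp
    simpa only [h2] using h1

lemma CMat.differentiableAt_iff {X : ℂ → CMat n} {t : ℂ} :
    DifferentiableAt ℂ X t ↔ ∀ i j, DifferentiableAt ℂ (fun t => X t i j) t := by
  constructor
  · intro h i j
    exact (CMat.hasDerivAt_iff.1 h.hasDerivAt i j).differentiableAt
  · intro h
    exact (CMat.hasDerivAt_iff (X' := fun i j => deriv (fun t => X t i j) t).2
      fun i j => (h i j).hasDerivAt).differentiableAt

lemma CMat.norm_det_le (M : CMat n) {c : ℝ} (h : ∀ i j, ‖M i j‖ ≤ c) :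
    ‖M.det‖ ≤ n.factorial * c ^ n := by
  have := Matrix.det_le (A := M) (abv := NormedField.toAbsoluteValue ℂ) (x := c) h
  rw [nsmul_eq_mul, Fintype.card_fin] at this
  exact this

/-- Cramer's rule: an adjugate entry is a determinant with entries at most 1 + ‖M‖. A lower bound
for the determinant is thus enough to control an inverse. For singular M both sides are 0. -/
lemma CMat.norm_inv_le (M : CMat n) :
    ‖M⁻¹‖ ≤ n * (n.factorial * (1 + ‖M‖) ^ n) / ‖M.det‖ := by
  have h1 : ‖M.adjugate‖ ≤ n * (n.factorial * (1 + ‖M‖) ^ n) := by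
    refine CMat.norm_le_of_entry_le _ (by positivity) fun i j => ?_
    rw [Matrix.adjugate_apply]
    refine CMat.norm_det_le _ fun k l => ?_
    rw [Matrix.updateRow_apply]
    split_ifs
    · have : ‖(Pi.single i 1 : Fin n → ℂ) l‖ ≤ 1 := by
        rw [Pi.single_apply]; split_ifs <;> simp
      linarith [norm_nonneg M]
    · linarith [CMat.norm_entry_le M k l]
  rw [Matrix.inv_def, norm_smul, Ring.inverse_eq_inv', norm_inv, mul_comm, ← div_eq_mul_inv]
  gcongr

lemma CMat.hasDerivAt_inv {X : ℂ → CMat n} {X' : CMat n} {t : ℂ} (h : HasDerivAt X X' t)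
    (hu : IsUnit (X t)) :
    HasDerivAt (fun t => (X t)⁻¹) (-((X t)⁻¹ * X' * (X t)⁻¹)) t := by
  obtain ⟨u, hu⟩ := hu
  have h1 := hasFDerivAt_ringInverse (𝕜 := ℂ) u
  rw [hu] at h1
  have h2 := h1.comp_hasDerivAt t h
  have h3 : ((u⁻¹ : (CMat n)ˣ) : CMat n) = (X t)⁻¹ := by
    rw [← hu, Matrix.coe_units_inv]
  have h4 : (fun t => (X t)⁻¹) = Ring.inverse ∘ X := by
    funext t; simp [Matrix.nonsing_inv_eq_ringInverse]
  rw [h4]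
  convert! h2 using 1
  simp [h3]

lemma CMat.mul_inv {M : CMat n} (h : IsUnit M) : M * M⁻¹ = 1 :=
  Matrix.mul_nonsing_inv M ((Matrix.isUnit_iff_isUnit_det M).1 h)

lemma CMat.inv_mul {M : CMat n} (h : IsUnit M) : M⁻¹ * M = 1 :=
  Matrix.nonsing_inv_mul M ((Matrix.isUnit_iff_isUnit_det M).1 h)

lemma CMat.isUnit_inv {M : CMat n} (h : IsUnit M) : IsUnit M⁻¹ :=
  IsUnit.of_mul_eq_one M (CMat.inv_mul h)

lemma CMat.isUnit_iff_det_ne {M : CMat n} : IsUnit M ↔ M.det ≠ 0 := by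
  rw [Matrix.isUnit_iff_isUnit_det, isUnit_iff_ne_zero]

lemma CMat.eq_inv_of_mul_eq_one {M N : CMat n} (h : M * N = 1) : N = M⁻¹ :=
  (Matrix.inv_eq_right_inv h).symm

/-- Entrywise complex conjugation. -/
def cj (M : CMat n) : CMat n := M.map (starRingEnd ℂ)

@[simp] lemma cj_apply (M : CMat n) (i j : Fin n) : cj M i j = (starRingEnd ℂ) (M i j) := rfl
@[simp] lemma cj_cj (M : CMat n) : cj (cj M) = M := by ext; simp
@[simp] lemma cj_one : cj (1 : CMat n) = 1 := (starRingEnd ℂ).mapMatrix.map_one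
@[simp] lemma cj_zero : cj (0 : CMat n) = 0 := (starRingEnd ℂ).mapMatrix.map_zero
lemma cj_mul (M N : CMat n) : cj (M * N) = cj M * cj N := (starRingEnd ℂ).mapMatrix.map_mul M N
lemma cj_add (M N : CMat n) : cj (M + N) = cj M + cj N := (starRingEnd ℂ).mapMatrix.map_add M N
lemma cj_sub (M N : CMat n) : cj (M - N) = cj M - cj N := (starRingEnd ℂ).mapMatrix.map_sub M N
lemma cj_sum {ι : Type*} (s : Finset ι) (f : ι → CMat n) :
    cj (∑ i ∈ s, f i) = ∑ i ∈ s, cj (f i) := map_sum (starRingEnd ℂ).mapMatrix f s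
lemma cj_smul (c : ℂ) (M : CMat n) : cj (c • M) = (starRingEnd ℂ) c • cj M := by ext; simp
lemma cj_det (M : CMat n) : (cj M).det = (starRingEnd ℂ) M.det :=
  (RingHom.map_det (starRingEnd ℂ) M).symm
lemma cj_inv (M : CMat n) : cj M⁻¹ = (cj M)⁻¹ := by
  by_cases h : IsUnit M
  · apply CMat.eq_inv_of_mul_eq_one
    rw [← cj_mul, CMat.mul_inv h, cj_one]
  · have h' : ¬ IsUnit (cj M) := by
      rw [CMat.isUnit_iff_det_ne, cj_det] at *
      simpa using h
    rw [Matrix.isUnit_iff_isUnit_det] at h h'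
    rw [Matrix.nonsing_inv_apply_not_isUnit _ h, Matrix.nonsing_inv_apply_not_isUnit _ h', cj_zero]

@[simp] lemma norm_cj (M : CMat n) : ‖cj M‖ = ‖M‖ := by
  simp [Matrix.linfty_opNorm_def]

/-- Schwarz reflection. Reality of the final coefficients is carried through the proof as invariance
under this operation. -/
lemma HasDerivAt.cj_conj {X : ℂ → CMat n} {X' : CMat n} {t : ℂ} (h : HasDerivAt X X' t) :
    HasDerivAt (fun z => cj (X ((starRingEnd ℂ) z))) (cj X') ((starRingEnd ℂ) t) := by
  rw [CMat.hasDerivAt_iff] at *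
  exact fun i j => (h i j).conj_conj

lemma continuous_cj : Continuous (cj : CMat n → CMat n) := by
  have : Isometry (cj : CMat n → CMat n) :=
    Isometry.of_dist_eq fun M N => by rw [dist_eq_norm, ← cj_sub, norm_cj, dist_eq_norm]
  exact this.continuous

lemma cj_complexify (M : RMat n) : cj (complexify M) = complexify M := by
  ext i j; simp [complexify]

lemma norm_complexify (M : RMat n) : ‖complexify M‖ = ‖M‖ := by
  simp [Matrix.linfty_opNorm_def, complexify]

lemma complexify_eq_zero {M : RMat n} : complexify M = 0 ↔ M = 0 := by
  rw [← norm_eq_zero, norm_complexify, norm_eq_zero]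

/-- The real part of a matrix. -/
def reMat (M : CMat n) : RMat n := M.map Complex.re

lemma complexify_reMat {M : CMat n} (h : cj M = M) : complexify (reMat M) = M := by
  ext i j
  have := congrFun (congrFun h i) j
  simpa [complexify, reMat] using Complex.conj_eq_iff_re.1 this

end MatrixBasics

/-! ### Majorization by primitive recursive functions. -/

section PrimrecBounds

/-- A real sequence dominated by a primitive recursive function. -/
def PrimrecBounded (φ : ℕ → ℝ) : Prop := ∃ f : ℕ → ℕ, Primrec f ∧ ∀ k, φ k ≤ f k

lemma PrimrecBounded.of_primrec {f : ℕ → ℕ} (hf : Primrec f) :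
    PrimrecBounded fun k => (f k : ℝ) := ⟨f, hf, fun _ => le_rfl⟩

lemma PrimrecBounded.mono {φ ψ : ℕ → ℝ} (h : PrimrecBounded ψ) (hle : ∀ k, φ k ≤ ψ k) :
    PrimrecBounded φ :=
  let ⟨f, hf, hb⟩ := h
  ⟨f, hf, fun k => (hle k).trans (hb k)⟩

lemma PrimrecBounded.const (c : ℝ) : PrimrecBounded fun _ => c :=
  ⟨fun _ => ⌈c⌉₊, Primrec.const _, fun _ => Nat.le_ceil c⟩

lemma PrimrecBounded.add {φ ψ : ℕ → ℝ} (h : PrimrecBounded φ) (h' : PrimrecBounded ψ) :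
    PrimrecBounded fun k => φ k + ψ k :=
  let ⟨f, hf, hb⟩ := h
  let ⟨g, hg, hb'⟩ := h'
  ⟨fun k => f k + g k, Primrec.nat_add.comp hf hg, fun k => by
    push_cast; exact add_le_add (hb k) (hb' k)⟩

lemma PrimrecBounded.mul {φ ψ : ℕ → ℝ} (h : PrimrecBounded φ) (h' : PrimrecBounded ψ)
    (h0 : ∀ k, 0 ≤ ψ k) : PrimrecBounded fun k => φ k * ψ k :=
  let ⟨f, hf, hb⟩ := h
  let ⟨g, hg, hb'⟩ := h'
  ⟨fun k => f k * g k, Primrec.nat_mul.comp hf hg, fun k => by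
    push_cast; exact mul_le_mul (hb k) (hb' k) (h0 k) (Nat.cast_nonneg _)⟩

lemma Primrec.nat_pow_comp {f g : ℕ → ℕ} (hf : Primrec f) (hg : Primrec g) :
    Primrec fun k => f k ^ g k := by
  have h : Primrec₂ fun a b : ℕ => a ^ b := Primrec₂.unpaired'.1 Nat.Primrec.pow
  exact h.comp hf hg

lemma PrimrecBounded.pow {φ : ℕ → ℝ} {e : ℕ → ℕ} (h : PrimrecBounded φ)
    (h' : PrimrecBounded fun k => (e k : ℝ)) (h0 : ∀ k, 0 ≤ φ k) :
    PrimrecBounded fun k => φ k ^ e k :=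
  let ⟨f, hf, hb⟩ := h
  let ⟨g, hg, hb'⟩ := h'
  -- The shift by 1 makes the base at least 1, so that the power is monotone in the exponent.
  ⟨fun k => (f k + 1) ^ g k, Primrec.nat_pow_comp (Primrec.succ.comp hf) hg, fun k => by
    push_cast
    have h1 : φ k ≤ f k + 1 := (hb k).trans (by linarith)
    have h2 : e k ≤ g k := Nat.cast_le.1 (hb' k)
    calc φ k ^ e k ≤ ((f k : ℝ) + 1) ^ e k := by gcongr; exact h0 k
      _ ≤ ((f k : ℝ) + 1) ^ g k := pow_le_pow_right₀ (by simp) h2⟩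

lemma PrimrecBounded.exp {φ : ℕ → ℝ} (h : PrimrecBounded φ) :
    PrimrecBounded fun k => Real.exp (φ k) :=
  let ⟨f, hf, hb⟩ := h
  ⟨fun k => 3 ^ f k, Primrec.nat_pow_comp (Primrec.const 3) hf, fun k => by
    push_cast
    calc Real.exp (φ k) ≤ Real.exp (f k) := Real.exp_le_exp.2 (hb k)
      _ = Real.exp 1 ^ f k := by rw [← Real.exp_nat_mul, mul_one]
      _ ≤ 3 ^ f k := by gcongr; linarith [Real.exp_one_lt_d9]⟩

lemma PrimrecBounded.natCeil {φ : ℕ → ℝ} (h : PrimrecBounded φ) :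
    PrimrecBounded fun k => (⌈φ k⌉₊ : ℝ) :=
  let ⟨f, hf, hb⟩ := h
  ⟨f, hf, fun k => Nat.cast_le.2 (Nat.ceil_le.2 (hb k))⟩

lemma PrimrecBounded.factorial {e : ℕ → ℕ} (h : PrimrecBounded fun k => (e k : ℝ)) :
    PrimrecBounded fun k => ((e k).factorial : ℝ) :=
  (h.pow h fun _ => Nat.cast_nonneg _).mono fun k => by
    exact_mod_cast Nat.factorial_le_pow (e k)

end PrimrecBounds

end

/-! ### Cauchy integrals and Laurent expansions in an annulus. -/

noncomputable section

open Complex Metric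

/-- The open annulus `α < |z| < β`. -/
def annulus (α β : ℝ) : Set ℂ := {z | α < ‖z‖ ∧ ‖z‖ < β}

/-- The exterior domain `α < |z|`. -/
def exterior (α : ℝ) : Set ℂ := {z | α < ‖z‖}

lemma isOpen_exterior (α : ℝ) : IsOpen (exterior α) := isOpen_lt continuous_const continuous_norm

lemma isOpen_annulus (α β : ℝ) : IsOpen (annulus α β) :=
  (isOpen_exterior α).inter (isOpen_lt continuous_norm continuous_const)

section CauchyAnnulus

variable {E : Type*} [NormedAddCommGroup E] [NormedSpace ℂ E]

/-- The Cauchy integral of `f` over the circle `|w| = R`. -/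
def cauchyInt (f : ℂ → E) (R : ℝ) (z : ℂ) : E :=
  (2 * Real.pi * I : ℂ)⁻¹ • ∮ w in C(0, R), (w - z)⁻¹ • f w

lemma sphere_subset_annulus {α β R : ℝ} (h1 : α < R) (h2 : R < β) :
    sphere (0 : ℂ) R ⊆ annulus α β := by
  intro w hw
  rw [mem_sphere_zero_iff_norm] at hw
  exact ⟨hw ▸ h1, hw ▸ h2⟩

lemma norm_cauchyInt_le {f : ℂ → E} {R μ d : ℝ} (hR : 0 ≤ R) {z : ℂ} (hd : 0 < d)
    (hf : ∀ w ∈ sphere (0 : ℂ) R, ‖f w‖ ≤ μ) (hz : ∀ w ∈ sphere (0 : ℂ) R, d ≤ ‖w - z‖) :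
    ‖cauchyInt f R z‖ ≤ R * (μ / d) := by
  refine circleIntegral.norm_two_pi_i_inv_smul_integral_le_of_norm_le_const hR fun w hw => ?_
  rw [norm_smul, norm_inv, div_eq_mul_inv, mul_comm]
  have h1 := hf w hw
  have h2 := hz w hw
  gcongr
  exact (norm_nonneg _).trans h1

lemma sub_norm_le_of_mem_sphere {R : ℝ} {w z : ℂ} (hw : w ∈ sphere (0 : ℂ) R) :
    R - ‖z‖ ≤ ‖w - z‖ ∧ ‖z‖ - R ≤ ‖w - z‖ := by
  rw [mem_sphere_zero_iff_norm] at hw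
  subst hw
  exact ⟨norm_sub_norm_le _ _, norm_sub_rev w z ▸ norm_sub_norm_le _ _⟩

lemma continuousOn_cauchy_kernel {f : ℂ → E} {R : ℝ} (hf : ContinuousOn f (sphere (0 : ℂ) R))
    {z : ℂ} (hz : ‖z‖ ≠ R) : ContinuousOn (fun w => (w - z)⁻¹ • f w) (sphere (0 : ℂ) R) := by
  refine ContinuousOn.smul (ContinuousOn.inv₀ (by fun_prop) fun w hw h => hz ?_) hf
  rw [sub_eq_zero] at h
  rw [← h]; exact mem_sphere_zero_iff_norm.1 hw

/-- Truncated expansion of the interior Cauchy integral. -/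
lemma cauchyInt_interior_expansion {f : ℂ → E} {R : ℝ} (hR : 0 < R)
    (hf : ContinuousOn f (sphere (0 : ℂ) R)) (N : ℕ) {z : ℂ} (hz : ‖z‖ < R) :
    cauchyInt f R z = (∑ k ∈ Finset.range N, z ^ k •
      ((2 * Real.pi * I : ℂ)⁻¹ • ∮ w in C(0, R), (w ^ (k + 1))⁻¹ • f w)) +
      cauchyInt (fun w => (z / w) ^ N • f w) R z := by
  have hw0 : ∀ w ∈ sphere (0 : ℂ) R, w ≠ 0 := fun w hw h => by
    rw [mem_sphere_zero_iff_norm, h, norm_zero] at hw; exact hR.ne hw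
  have hwz : ∀ w ∈ sphere (0 : ℂ) R, w - z ≠ 0 := fun w hw h => by
    rw [mem_sphere_zero_iff_norm, sub_eq_zero.1 h] at hw; exact hz.ne hw
  have hc : ContinuousOn (fun w : ℂ => (z / w) ^ N • f w) (sphere (0 : ℂ) R) :=
    (ContinuousOn.pow (continuousOn_const.div continuousOn_id hw0) N).smul hf
  have hck : ∀ k : ℕ, ContinuousOn (fun w : ℂ => (w ^ (k + 1))⁻¹ • f w) (sphere (0 : ℂ) R) :=
    fun k => (ContinuousOn.inv₀ (by fun_prop) fun w hw => pow_ne_zero _ (hw0 w hw)).smul hf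
  unfold cauchyInt
  have h1 : (∮ w in C(0, R), (w - z)⁻¹ • f w) = ∮ w in C(0, R),
      ((∑ k ∈ Finset.range N, z ^ k • ((w ^ (k + 1))⁻¹ • f w)) +
        (w - z)⁻¹ • (z / w) ^ N • f w) := by
    refine circleIntegral.integral_congr hR.le fun w hw => ?_
    have hw' := hw0 w hw
    have hz' := hwz w hw
    simp only [smul_smul, ← Finset.sum_smul, ← add_smul]
    congr 1
    -- Finite geometric sum for 1 / (w - z); its remainder (z / w)^N / (w - z) is kept inside a
    -- Cauchy integral.
    have hg : (∑ k ∈ Finset.range N, z ^ k * (w ^ (k + 1))⁻¹) * (w - z) = 1 - (z / w) ^ N := by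
      have : ∀ k, z ^ k * (w ^ (k + 1))⁻¹ = (z / w) ^ k * w⁻¹ := fun k => by
        rw [div_pow, pow_succ, mul_inv]; ring
      simp only [this]
      rw [← Finset.sum_mul, mul_assoc, mul_sub, inv_mul_cancel₀ hw', ← geom_sum_mul_neg]
      congr 2; ring
    have hg' := eq_div_of_mul_eq hz' hg
    rw [hg', div_eq_mul_inv]; ring
  rw [h1, circleIntegral.integral_add, circleIntegral.integral_fun_sum, smul_add, Finset.smul_sum]
  · congr 1
    refine Finset.sum_congr rfl fun k _ => ?_
    rw [circleIntegral.integral_smul, smul_comm]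
  · intro k _
    exact ((hck k).const_smul _).circleIntegrable hR.le
  · refine ContinuousOn.circleIntegrable hR.le (continuousOn_finsetSum _ fun k _ =>
      (hck k).const_smul _)
  · exact (continuousOn_cauchy_kernel hc hz.ne).circleIntegrable hR.le

/-- Truncated expansion of the exterior Cauchy integral. -/
lemma cauchyInt_exterior_expansion {f : ℂ → E} {R : ℝ} (hR : 0 ≤ R)
    (hf : ContinuousOn f (sphere (0 : ℂ) R)) (N : ℕ) {z : ℂ} (hz : R < ‖z‖) :
    -cauchyInt f R z = (∑ k ∈ Finset.range N, (z ^ (k + 1))⁻¹ •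
      ((2 * Real.pi * I : ℂ)⁻¹ • ∮ w in C(0, R), w ^ k • f w)) -
      cauchyInt (fun w => (w / z) ^ N • f w) R z := by
  have hz0 : z ≠ 0 := norm_pos_iff.1 (hR.trans_lt hz)
  have hwz : ∀ w ∈ sphere (0 : ℂ) R, w - z ≠ 0 := fun w hw h => by
    rw [mem_sphere_zero_iff_norm, sub_eq_zero.1 h] at hw; exact hz.ne' hw
  have hc : ContinuousOn (fun w : ℂ => (w / z) ^ N • f w) (sphere (0 : ℂ) R) :=
    (by fun_prop : ContinuousOn (fun w : ℂ => (w / z) ^ N) (sphere (0 : ℂ) R)).smul hf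
  have hck : ∀ k : ℕ, ContinuousOn (fun w : ℂ => w ^ k • f w) (sphere (0 : ℂ) R) :=
    fun k => (by fun_prop : ContinuousOn (fun w : ℂ => w ^ k) (sphere (0 : ℂ) R)).smul hf
  unfold cauchyInt
  have h1 : (∮ w in C(0, R), (w - z)⁻¹ • f w) = ∮ w in C(0, R),
      ((w - z)⁻¹ • (w / z) ^ N • f w -
        (∑ k ∈ Finset.range N, (z ^ (k + 1))⁻¹ • (w ^ k • f w))) := by
    refine circleIntegral.integral_congr hR fun w hw => ?_
    have hz' := hwz w hw
    simp only [smul_smul, ← Finset.sum_smul, ← sub_smul]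
    congr 1
    have hg : (∑ k ∈ Finset.range N, (z ^ (k + 1))⁻¹ * w ^ k) * (w - z) = (w / z) ^ N - 1 := by
      have : ∀ k, (z ^ (k + 1))⁻¹ * w ^ k = (w / z) ^ k * z⁻¹ := fun k => by
        rw [div_pow, pow_succ, mul_inv]; ring
      simp only [this]
      rw [← Finset.sum_mul, mul_assoc, mul_sub, inv_mul_cancel₀ hz0, ← geom_sum_mul]
      congr 2; ring
    have hg' := eq_div_of_mul_eq hz' hg
    rw [hg', div_eq_mul_inv]; ring
  rw [h1, circleIntegral.integral_sub, circleIntegral.integral_fun_sum, smul_sub, neg_sub,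
    Finset.smul_sum]
  · congr 1
    refine Finset.sum_congr rfl fun k _ => ?_
    rw [circleIntegral.integral_smul, smul_comm]
  · intro k _
    exact ((hck k).const_smul _).circleIntegrable hR
  · exact (continuousOn_cauchy_kernel hc hz.ne').circleIntegrable hR
  · refine ContinuousOn.circleIntegrable hR (continuousOn_finsetSum _ fun k _ =>
      (hck k).const_smul _)

variable [CompleteSpace E]

/-- Cauchy's integral formula in an annulus. -/
lemma cauchy_formula_annulus {f : ℂ → E} {α β r R : ℝ} (hf : DifferentiableOn ℂ f (annulus α β))
    (hr0 : 0 < r) (hαr : α < r) (hRβ : R < β) {z : ℂ} (hrz : r < ‖z‖) (hzR : ‖z‖ < R) :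
    f z = cauchyInt f R z - cauchyInt f r z := by
  have hrR : r < R := hrz.trans hzR
  have hR0 : 0 < R := hr0.trans hrR
  have hzm : z ∈ annulus α β := ⟨hαr.trans hrz, hzR.trans hRβ⟩
  have hd : DifferentiableOn ℂ (dslope f z) (annulus α β) :=
    (differentiableOn_dslope ((isOpen_annulus α β).mem_nhds hzm)).2 hf
  have hsub : closedBall (0 : ℂ) R \ ball 0 r ⊆ annulus α β := by
    intro w hw
    rw [Set.mem_sdiff, mem_closedBall_zero_iff, mem_ball_zero_iff, not_lt] at hw
    exact ⟨hαr.trans_le hw.2, hw.1.trans_lt hRβ⟩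
  -- The difference quotient of f at z has a removable singularity, so its integrals over the two
  -- circles agree; z lies inside the outer circle only.
  have h1 := circleIntegral_eq_of_differentiable_on_annulus_off_countable (c := 0) hr0 hrR.le
    (f := dslope f z) (s := ∅) Set.countable_empty (hd.continuousOn.mono hsub)
    (fun w hw => hd.differentiableAt ((isOpen_annulus α β).mem_nhds (hsub
      ⟨ball_subset_closedBall hw.1.1, fun h => hw.1.2 (ball_subset_closedBall h)⟩)))
  have key : ∀ ρ : ℝ, 0 < ρ → α < ρ → ρ < β → ‖z‖ ≠ ρ → (∮ w in C(0, ρ), dslope f z w) =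
      (∮ w in C(0, ρ), (w - z)⁻¹ • f w) - (∮ w in C(0, ρ), (w - z)⁻¹) • f z := by
    intro ρ hρ h1 h2 hz
    have hfc : ContinuousOn f (sphere (0 : ℂ) ρ) :=
      hf.continuousOn.mono (sphere_subset_annulus h1 h2)
    rw [← circleIntegral.integral_smul_const, ← circleIntegral.integral_sub]
    · refine circleIntegral.integral_congr hρ.le fun w hw => ?_
      have : w ≠ z := fun h => hz (by rw [← h]; exact mem_sphere_zero_iff_norm.1 hw)
      rw [dslope_of_ne _ this, slope_def_module, smul_sub]
    · exact (continuousOn_cauchy_kernel hfc hz).circleIntegrable hρ.le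
    · exact (continuousOn_cauchy_kernel continuousOn_const hz).circleIntegrable hρ.le
  rw [key R hR0 (hαr.trans hrR) hRβ hzR.ne, key r hr0 hαr (hrR.trans hRβ) hrz.ne',
    circleIntegral.integral_sub_inv_of_mem_ball (mem_ball_zero_iff.2 hzR)] at h1
  have h0 : (∮ w in C(0, r), (w - z)⁻¹) = 0 := by
    refine DiffContOnCl.circleIntegral_eq_zero hr0.le (DifferentiableOn.diffContOnCl ?_)
    rw [closure_ball _ hr0.ne']
    intro w hw
    have : w - z ≠ 0 := fun h => by
      rw [sub_eq_zero] at h; subst h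
      exact hrz.not_ge (mem_closedBall_zero_iff.1 hw)
    exact (((differentiableAt_id.sub_const z).inv this)).differentiableWithinAt
  rw [h0, zero_smul, sub_zero] at h1
  unfold cauchyInt
  rw [← smul_sub, ← h1, sub_sub_cancel, smul_smul, inv_mul_cancel₀ two_pi_I_ne_zero, one_smul]

lemma differentiableOn_cauchyInt_interior {f : ℂ → E} {R : ℝ} (hR : 0 < R)
    (hf : ContinuousOn f (sphere (0 : ℂ) R)) : DifferentiableOn ℂ (cauchyInt f R) (ball 0 R) := by
  lift R to NNReal using hR.le
  have := hasFPowerSeriesOn_cauchy_integral (hf.circleIntegrable R.2) (by exact_mod_cast hR)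
  have h := this.differentiableOn
  rwa [Metric.eball_coe] at h

lemma differentiableOn_cauchyInt_exterior {f : ℂ → E} {R : ℝ} (hR : 0 ≤ R)
    (hf : ContinuousOn f (sphere (0 : ℂ) R)) :
    DifferentiableOn ℂ (cauchyInt f R) (exterior R) := by
  obtain ⟨μ, hμ⟩ := (isCompact_sphere (0 : ℂ) R).exists_bound_of_continuousOn hf
  suffices h : ∀ ρ, R < ρ → DifferentiableOn ℂ (fun z => -cauchyInt f R z) (exterior ρ) by
    intro z hz
    obtain ⟨ρ, h1, h2⟩ := exists_between (show R < ‖z‖ from hz)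
    have := (h ρ h1).differentiableAt ((isOpen_exterior ρ).mem_nhds h2)
    simpa using this.neg.differentiableWithinAt
  intro ρ hρ
  have hρ0 : 0 < ρ := hR.trans_lt hρ
  have hlim : TendstoLocallyUniformlyOn (fun (N : ℕ) z => ∑ k ∈ Finset.range N, (z ^ (k + 1))⁻¹ •
      ((2 * Real.pi * I : ℂ)⁻¹ • ∮ w in C(0, R), w ^ k • f w)) (fun z => -cauchyInt f R z)
      Filter.atTop (exterior ρ) := by
    apply TendstoUniformlyOn.tendstoLocallyUniformlyOn
    rw [Metric.tendstoUniformlyOn_iff]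
    intro ε hε
    have ht : Filter.Tendsto (fun N : ℕ => R * ((R / ρ) ^ N * |μ| / (ρ - R))) Filter.atTop
        (nhds 0) := by
      have h := tendsto_pow_atTop_nhds_zero_of_lt_one (div_nonneg hR hρ0.le)
        ((div_lt_one hρ0).2 hρ)
      simpa using ((h.mul_const |μ|).div_const (ρ - R)).const_mul R
    filter_upwards [ht.eventually_lt_const hε] with N hN z hz
    have hz' : ρ < ‖z‖ := hz
    rw [cauchyInt_exterior_expansion hR hf N (hρ.trans hz'), dist_eq_norm, sub_right_comm, sub_self,
      zero_sub, norm_neg]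
    refine lt_of_le_of_lt (norm_cauchyInt_le hR (sub_pos.2 hρ) (μ := (R / ρ) ^ N * |μ|) ?_ ?_) hN
    · intro w hw
      rw [norm_smul, norm_pow, norm_div, mem_sphere_zero_iff_norm.1 hw]
      have := (hμ w hw).trans (le_abs_self μ)
      gcongr
    · intro w hw
      have := (sub_norm_le_of_mem_sphere (z := z) hw).2
      linarith
  refine hlim.differentiableOn (Filter.Eventually.of_forall fun N => ?_) (isOpen_exterior ρ)
  refine DifferentiableOn.fun_sum fun k _ => DifferentiableOn.smul_const ?_ _
  intro z hz
  have : z ≠ 0 := norm_pos_iff.1 (hρ0.trans hz)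
  exact ((differentiableAt_id.pow (k + 1)).inv (pow_ne_zero _ this)).differentiableWithinAt

/-- Laurent splitting with sup norm bounds that lose no domain. -/
theorem exists_laurent_split {α β d : ℝ} (hα : 0 ≤ α) (hd : 0 < d) (hβ : β = α + 4 * d)
    (hβ1 : β ≤ 1) {f : ℂ → E} (hf : DifferentiableOn ℂ f (annulus α β)) {μ : ℝ}
    (hμ : ∀ z ∈ annulus α β, ‖f z‖ ≤ μ) :
    ∃ p e : ℂ → E, DifferentiableOn ℂ p (ball 0 β) ∧ DifferentiableOn ℂ e (exterior α) ∧
      (∀ z ∈ annulus α β, f z = p z + e z) ∧ (∀ z ∈ ball (0 : ℂ) β, ‖p z‖ ≤ (1 + 1 / d) * μ) ∧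
      (∀ z ∈ exterior α, ‖e z‖ ≤ (1 + 1 / d) * μ) := by
  obtain ⟨r, hr⟩ : ∃ r, r = α + d := ⟨_, rfl⟩
  obtain ⟨c, hc⟩ : ∃ c, c = α + 2 * d := ⟨_, rfl⟩
  obtain ⟨R, hR⟩ : ∃ R, R = α + 3 * d := ⟨_, rfl⟩
  have hr0 : 0 < r := by linarith
  have hR0 : 0 < R := by linarith
  have hμ0 : 0 ≤ μ := (norm_nonneg _).trans (hμ (c : ℂ) (by
    simp only [annulus, Set.mem_ofPred_eq, norm_real, Real.norm_of_nonneg (by linarith : 0 ≤ c)]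
    constructor <;> linarith))
  have hfR : ContinuousOn f (sphere (0 : ℂ) R) :=
    hf.continuousOn.mono (sphere_subset_annulus (by linarith) (by linarith))
  have hfr : ContinuousOn f (sphere (0 : ℂ) r) :=
    hf.continuousOn.mono (sphere_subset_annulus (by linarith) (by linarith))
  have hform : ∀ z : ℂ, r < ‖z‖ → ‖z‖ < R → f z = cauchyInt f R z - cauchyInt f r z :=
    fun z h1 h2 => cauchy_formula_annulus hf hr0 (by linarith) (by linarith) h1 h2
  have hRle : ∀ z : ℂ, ‖z‖ ≤ c → ‖cauchyInt f R z‖ ≤ 1 / d * μ := by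
    intro z hz
    have := norm_cauchyInt_le (f := f) (z := z) (μ := μ) hR0.le hd
      (fun w hw => hμ w (sphere_subset_annulus (by linarith) (by linarith) hw))
      (fun w hw => by linarith [(sub_norm_le_of_mem_sphere (z := z) hw).1])
    refine this.trans ?_
    rw [one_div_mul_eq_div]
    exact mul_le_of_le_one_left (by positivity) (by linarith)
  have hrle : ∀ z : ℂ, c ≤ ‖z‖ → ‖cauchyInt f r z‖ ≤ 1 / d * μ := by
    intro z hz
    have := norm_cauchyInt_le (f := f) (z := z) (μ := μ) hr0.le hd
      (fun w hw => hμ w (sphere_subset_annulus (by linarith) (by linarith) hw))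
      (fun w hw => by linarith [(sub_norm_le_of_mem_sphere (z := z) hw).2])
    refine this.trans ?_
    rw [one_div_mul_eq_div]
    exact mul_le_of_le_one_left (by positivity) (by linarith)
  have hIR := differentiableOn_cauchyInt_interior hR0 hfR
  have hIr := differentiableOn_cauchyInt_exterior hr0.le hfr
  -- On either side of |z| = c each part is expressed through the circle at distance at least d from
  -- z, with f itself making up the difference where needed. The bounds then hold on the full
  -- domains, and this absence of shrinking is what permits iteration.
  refine ⟨fun z => if ‖z‖ < c then cauchyInt f R z else f z + cauchyInt f r z,
    fun z => if ‖z‖ < c then f z - cauchyInt f R z else -cauchyInt f r z, ?_, ?_, ?_, ?_, ?_⟩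
  · intro z hz
    rw [mem_ball_zero_iff] at hz
    rcases lt_or_ge ‖z‖ R with h | h
    · have h1 : DifferentiableAt ℂ (cauchyInt f R) z :=
        hIR.differentiableAt (isOpen_ball.mem_nhds (mem_ball_zero_iff.2 h))
      refine (h1.congr_of_eventuallyEq ?_).differentiableWithinAt
      filter_upwards [isOpen_ball.mem_nhds (mem_ball_zero_iff.2 h)] with w hw
      rw [mem_ball_zero_iff] at hw
      split_ifs with hwc
      · rfl
      · rw [hform w (by linarith) hw]; abel
    · have hm : z ∈ annulus r β := ⟨by linarith, hz⟩
      have h1 : DifferentiableAt ℂ (fun z => f z + cauchyInt f r z) z :=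
        (hf.differentiableAt ((isOpen_annulus α β).mem_nhds ⟨by linarith, hz⟩)).add
          (hIr.differentiableAt ((isOpen_exterior r).mem_nhds hm.1))
      refine (h1.congr_of_eventuallyEq ?_).differentiableWithinAt
      filter_upwards [(isOpen_annulus r β).mem_nhds hm] with w hw
      split_ifs with hwc
      · rw [hform w hw.1 (by linarith)]; abel
      · rfl
  · intro z hz
    have hz' : α < ‖z‖ := hz
    rcases lt_or_ge r ‖z‖ with h | h
    · have h1 : DifferentiableAt ℂ (fun z => -cauchyInt f r z) z :=
        (hIr.differentiableAt ((isOpen_exterior r).mem_nhds h)).neg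
      refine (h1.congr_of_eventuallyEq ?_).differentiableWithinAt
      filter_upwards [(isOpen_exterior r).mem_nhds h] with w hw
      split_ifs with hwc
      · rw [hform w hw (by linarith)]; abel
      · rfl
    · have hm : z ∈ annulus α R := ⟨hz', by linarith⟩
      have h1 : DifferentiableAt ℂ (fun z => f z - cauchyInt f R z) z :=
        (hf.differentiableAt ((isOpen_annulus α β).mem_nhds ⟨hz', by linarith⟩)).sub
          (hIR.differentiableAt (isOpen_ball.mem_nhds (mem_ball_zero_iff.2 hm.2)))
      refine (h1.congr_of_eventuallyEq ?_).differentiableWithinAt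
      filter_upwards [(isOpen_annulus α R).mem_nhds hm] with w hw
      split_ifs with hwc
      · rfl
      · rw [hform w (by linarith) hw.2]; abel
  · intro z hz
    simp only
    split_ifs <;> abel
  · intro z hz
    rw [mem_ball_zero_iff] at hz
    simp only
    split_ifs with h
    · linarith [hRle z h.le]
    · rw [not_lt] at h
      refine (norm_add_le _ _).trans ?_
      linarith [hrle z h, hμ z ⟨by linarith, hz⟩]
  · intro z hz
    have hz' : α < ‖z‖ := hz
    simp only
    split_ifs with h
    · refine (norm_sub_le _ _).trans ?_
      linarith [hRle z h.le, hμ z ⟨hz', by linarith⟩]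
    · rw [not_lt] at h
      rw [norm_neg]
      linarith [hrle z h]

/-- Uniform approximation by Laurent polynomials in a narrower annulus. -/
theorem exists_laurent_approx {α β d : ℝ} (hα : 0 ≤ α) (hd : 0 < d) (hβ : β = α + 4 * d)
    (hβ1 : β ≤ 1) {f : ℂ → E} (hf : DifferentiableOn ℂ f (annulus α β)) {μ : ℝ}
    (hμ : ∀ z ∈ annulus α β, ‖f z‖ ≤ μ) (N : ℕ) :
    ∃ c : ℕ → E, ∀ z ∈ annulus (α + 3 / 2 * d) (α + 5 / 2 * d),
      ‖f z - (z ^ N)⁻¹ • ∑ k ∈ Finset.range (2 * N), z ^ k • c k‖ ≤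
        4 * μ / d * (1 - d / 2) ^ N := by
  obtain ⟨r, hr⟩ : ∃ r, r = α + d := ⟨_, rfl⟩
  obtain ⟨R, hR⟩ : ∃ R, R = α + 3 * d := ⟨_, rfl⟩
  have hr0 : 0 < r := by linarith
  have hR0 : 0 < R := by linarith
  have hsR : sphere (0 : ℂ) R ⊆ annulus α β := sphere_subset_annulus (by linarith) (by linarith)
  have hsr : sphere (0 : ℂ) r ⊆ annulus α β := sphere_subset_annulus (by linarith) (by linarith)
  have hfR : ContinuousOn f (sphere (0 : ℂ) R) := hf.continuousOn.mono hsR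
  have hfr : ContinuousOn f (sphere (0 : ℂ) r) := hf.continuousOn.mono hsr
  let a : ℕ → E := fun k => (2 * Real.pi * I : ℂ)⁻¹ • ∮ w in C(0, R), (w ^ (k + 1))⁻¹ • f w
  let b : ℕ → E := fun k => (2 * Real.pi * I : ℂ)⁻¹ • ∮ w in C(0, r), w ^ k • f w
  -- The exponents -N, …, N - 1 are shifted by N; the indices below N hold the coefficients of the
  -- negative powers, read backwards.
  refine ⟨fun k => if k < N then b (N - 1 - k) else a (k - N), fun z hz => ?_⟩
  have hz1 : α + 3 / 2 * d < ‖z‖ := hz.1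
  have hz2 : ‖z‖ < α + 5 / 2 * d := hz.2
  have hz0 : z ≠ 0 := norm_pos_iff.1 (by linarith)
  have hsum : (z ^ N)⁻¹ • ∑ k ∈ Finset.range (2 * N),
      z ^ k • (if k < N then b (N - 1 - k) else a (k - N)) =
      (∑ k ∈ Finset.range N, z ^ k • a k) + ∑ k ∈ Finset.range N, (z ^ (k + 1))⁻¹ • b k := by
    rw [two_mul, Finset.sum_range_add, smul_add, add_comm, Finset.smul_sum, Finset.smul_sum]
    congr 1
    · refine Finset.sum_congr rfl fun k _ => ?_
      simp only [Nat.not_lt.2 (Nat.le_add_right N k), if_false, Nat.add_sub_cancel_left]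
      rw [smul_smul, pow_add, inv_mul_cancel_left₀ (pow_ne_zero _ hz0)]
    · rw [← Finset.sum_range_reflect]
      refine Finset.sum_congr rfl fun k hk => ?_
      rw [Finset.mem_range] at hk
      have h1 : N - 1 - k < N := by omega
      have h2 : N - 1 - (N - 1 - k) = k := by omega
      simp only [h1, if_true, h2]
      rw [smul_smul]
      congr 1
      have h3 : z ^ N = z ^ (N - 1 - k) * z ^ (k + 1) := by rw [← pow_add]; congr 1; omega
      rw [h3, mul_inv, mul_right_comm, inv_mul_cancel₀ (pow_ne_zero _ hz0), one_mul]
  rw [hsum, cauchy_formula_annulus hf hr0 (by linarith) (by linarith) (by linarith : r < ‖z‖)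
    (by linarith : ‖z‖ < R), sub_eq_add_neg (cauchyInt f R z), cauchyInt_interior_expansion hR0 hfR N (by linarith),
    cauchyInt_exterior_expansion hr0.le hfr N (by linarith)]
  have hμ0 : 0 ≤ μ := (norm_nonneg _).trans (hμ z ⟨by linarith, by linarith⟩)
  have hq0 : 0 ≤ 1 - d / 2 := by linarith
  have e1 : ‖cauchyInt (fun w => (z / w) ^ N • f w) R z‖ ≤ 2 * μ / d * (1 - d / 2) ^ N := by
    have := norm_cauchyInt_le (f := fun w => (z / w) ^ N • f w) (z := z)
      (μ := (1 - d / 2) ^ N * μ) hR0.le (half_pos hd)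
      (fun w hw => by
        rw [norm_smul, norm_pow, norm_div, mem_sphere_zero_iff_norm.1 hw]
        have h1 := hμ w (hsR hw)
        -- z stays d / 2 away from the circle and R ≤ 1, so the ratio is at most 1 - d / 2.
        have h2 : ‖z‖ / R ≤ 1 - d / 2 := by
          rw [div_le_iff₀ hR0]; nlinarith
        gcongr)
      (fun w hw => by linarith [(sub_norm_le_of_mem_sphere (z := z) hw).1])
    refine this.trans ?_
    refine (mul_le_of_le_one_left (by positivity) (by linarith)).trans_eq ?_
    field_simp
  have e2 : ‖cauchyInt (fun w => (w / z) ^ N • f w) r z‖ ≤ 2 * μ / d * (1 - d / 2) ^ N := by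
    have := norm_cauchyInt_le (f := fun w => (w / z) ^ N • f w) (z := z)
      (μ := (1 - d / 2) ^ N * μ) hr0.le (half_pos hd)
      (fun w hw => by
        rw [norm_smul, norm_pow, norm_div, mem_sphere_zero_iff_norm.1 hw]
        have h1 := hμ w (hsr hw)
        have h2 : r / ‖z‖ ≤ 1 - d / 2 := by
          rw [div_le_iff₀ (by linarith)]; nlinarith
        gcongr)
      (fun w hw => by linarith [(sub_norm_le_of_mem_sphere (z := z) hw).2])
    refine this.trans ?_
    refine (mul_le_of_le_one_left (by positivity) (by linarith)).trans_eq ?_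
    field_simp
  have hfin : ∀ A A' B B' : E, A + A' + (B - B') - (A + B) = A' - B' := fun _ _ _ _ => by abel
  rw [hfin]
  refine (norm_sub_le _ _).trans ?_
  calc _ ≤ 2 * μ / d * (1 - d / 2) ^ N + 2 * μ / d * (1 - d / 2) ^ N := add_le_add e1 e2
    _ = _ := by ring

end CauchyAnnulus

end

noncomputable section

open Complex Metric

/-! ### Left factorization of a matrix function on an annulus. -/

section Factorization

variable {n : ℕ}

/-- Symmetry of a matrix function under complex conjugation. -/
def ConjSymm (f : ℂ → CMat n) (W : Set ℂ) : Prop :=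
  ∀ z ∈ W, f ((starRingEnd ℂ) z) = cj (f z)

lemma conj_mem_ball {β : ℝ} {z : ℂ} (h : z ∈ ball (0 : ℂ) β) : (starRingEnd ℂ) z ∈ ball (0 : ℂ) β := by
  simpa using h

lemma conj_mem_annulus {α β : ℝ} {z : ℂ} (h : z ∈ annulus α β) :
    (starRingEnd ℂ) z ∈ annulus α β := by
  simpa [annulus] using h

lemma conj_mem_exterior {α : ℝ} {z : ℂ} (h : z ∈ exterior α) :
    (starRingEnd ℂ) z ∈ exterior α := by
  simpa [exterior] using h

/-- The conjugation-symmetric part of a matrix function. -/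
def symmPart (f : ℂ → CMat n) (z : ℂ) : CMat n := (1 / 2 : ℂ) • (f z + cj (f ((starRingEnd ℂ) z)))

lemma symmPart_conj (f : ℂ → CMat n) (z : ℂ) :
    symmPart f ((starRingEnd ℂ) z) = cj (symmPart f z) := by
  simp [symmPart, cj_smul, cj_add, add_comm, Complex.conj_ofNat]

lemma differentiableOn_cj_conj {f : ℂ → CMat n} {W : Set ℂ} (hW : IsOpen W)
    (hc : ∀ z ∈ W, (starRingEnd ℂ) z ∈ W) (hf : DifferentiableOn ℂ f W) :
    DifferentiableOn ℂ (fun z => cj (f ((starRingEnd ℂ) z))) W := by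
  intro z hz
  have h1 := (hf.differentiableAt (hW.mem_nhds (hc z hz))).hasDerivAt.cj_conj
  rw [starRingEnd_self_apply] at h1
  exact h1.differentiableAt.differentiableWithinAt

lemma differentiableOn_symmPart {f : ℂ → CMat n} {W : Set ℂ} (hW : IsOpen W)
    (hc : ∀ z ∈ W, (starRingEnd ℂ) z ∈ W) (hf : DifferentiableOn ℂ f W) :
    DifferentiableOn ℂ (symmPart f) W :=
  (hf.add (differentiableOn_cj_conj hW hc hf)).const_smul (1 / 2 : ℂ)

/-- Averaging with the reflected function costs nothing when the target is itself symmetric, so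
approximants may be taken real. -/
lemma norm_symmPart_sub_le {f g : ℂ → CMat n} {z : ℂ} {ε : ℝ}
    (hg : g ((starRingEnd ℂ) z) = cj (g z)) (h1 : ‖f z - g z‖ ≤ ε)
    (h2 : ‖f ((starRingEnd ℂ) z) - g ((starRingEnd ℂ) z)‖ ≤ ε) : ‖symmPart f z - g z‖ ≤ ε := by
  have h3 : symmPart f z - g z = (1 / 2 : ℂ) • ((f z - g z) +
      cj (f ((starRingEnd ℂ) z) - g ((starRingEnd ℂ) z))) := by
    have h4 : g z = (1 / 2 : ℂ) • (g z + g z) := by rw [← two_smul ℂ (g z), smul_smul]; norm_num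
    rw [cj_sub, hg, cj_cj, symmPart]
    conv_lhs => rw [h4]
    rw [← smul_sub]; congr 1; abel
  rw [h3, norm_smul]
  have h5 := norm_add_le (f z - g z) (cj (f ((starRingEnd ℂ) z) - g ((starRingEnd ℂ) z)))
  rw [norm_cj] at h5
  norm_num
  linarith

lemma isUnit_of_norm_sub_one_le {M : CMat n} (h : ‖M - 1‖ ≤ 1 / 2) : IsUnit M := by
  have := isUnit_one_sub_of_norm_lt_one (x := 1 - M) (by rw [norm_sub_rev]; linarith)
  simpa using this

/-- Factorization of a matrix function close to the identity. -/
theorem exists_factorization_near_one [NeZero n] {α β d : ℝ} (hα : 0 ≤ α) (hd : 0 < d)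
    (hβ : β = α + 4 * d) (hβ1 : β ≤ 1) {s : ℂ → CMat n}
    (hs : DifferentiableOn ℂ s (annulus α β)) {ε : ℝ} (hε : ∀ z ∈ annulus α β, ‖s z‖ ≤ ε)
    (hεd : (1 + 1 / d) * ε ≤ 1 / 4) (hsym : ConjSymm s (annulus α β)) :
    ∃ G E : ℂ → CMat n, DifferentiableOn ℂ G (ball 0 β) ∧ DifferentiableOn ℂ E (exterior α) ∧
      (∀ z ∈ annulus α β, G z * (1 + s z) = E z) ∧ (∀ z ∈ ball (0 : ℂ) β, ‖G z - 1‖ ≤ 1 / 2) ∧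
      (∀ z ∈ exterior α, ‖E z - 1‖ ≤ 1 / 2) ∧ (∀ z, G ((starRingEnd ℂ) z) = cj (G z)) ∧
      ∀ z, E ((starRingEnd ℂ) z) = cj (E z) := by
  have hann : annulus α β ⊆ ball 0 β := fun z hz => mem_ball_zero_iff.2 hz.2
  -- One step sends δ to the δ' with δ s = -δ' + e, where -δ' is the interior and e the exterior
  -- part of δ s. Starting from δ₀ = 1 and summing, the series telescopes to G (1 + s) = E with G =
  -- ∑ δ_k and E = 1 + ∑ e_k. By `hεd` each step gains a factor 4.
  have step : ∀ D : {p : (ℂ → CMat n) × ℝ // DifferentiableOn ℂ p.1 (ball 0 β) ∧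
      ∀ z ∈ ball (0 : ℂ) β, ‖p.1 z‖ ≤ p.2}, ∃ (D' : {p : (ℂ → CMat n) × ℝ //
        DifferentiableOn ℂ p.1 (ball 0 β) ∧ ∀ z ∈ ball (0 : ℂ) β, ‖p.1 z‖ ≤ p.2})
      (e : ℂ → CMat n), D'.1.2 = D.1.2 / 4 ∧ DifferentiableOn ℂ e (exterior α) ∧
        (∀ z ∈ exterior α, ‖e z‖ ≤ D.1.2 / 4) ∧
        ∀ z ∈ annulus α β, D.1.1 z * s z = -D'.1.1 z + e z := by
    rintro ⟨⟨δ, m⟩, hδ, hm⟩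
    have hm0 : 0 ≤ m := (norm_nonneg _).trans (hm 0 (mem_ball_self (by linarith)))
    obtain ⟨p, e, hp, he, hpe, hpb, heb⟩ := exists_laurent_split hα hd hβ hβ1
      ((hδ.mono hann).mul hs) (μ := m * ε) (fun z hz => (norm_mul_le _ _).trans
        (mul_le_mul (hm z (hann hz)) (hε z hz) (norm_nonneg _) hm0))
    have hb : (1 + 1 / d) * (m * ε) ≤ m / 4 := by nlinarith
    refine ⟨⟨⟨fun z => -p z, m / 4⟩, hp.neg, fun z hz => ?_⟩, e, rfl, he, fun z hz =>
      (heb z hz).trans hb, fun z hz => ?_⟩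
    · simp only [norm_neg]; exact (hpb z hz).trans hb
    · simpa using hpe z hz
  choose nxt err hn2 hnd hnb hne using step
  let D : ℕ → {p : (ℂ → CMat n) × ℝ // DifferentiableOn ℂ p.1 (ball 0 β) ∧
      ∀ z ∈ ball (0 : ℂ) β, ‖p.1 z‖ ≤ p.2} := fun k =>
    nxt^[k] ⟨⟨fun _ => 1, 1⟩, differentiableOn_const _, fun _ _ => norm_one.le⟩
  have hDs : ∀ k, D (k + 1) = nxt (D k) := fun k => Function.iterate_succ_apply' _ _ _
  have hD2 : ∀ k, (D k).1.2 = (1 / 4) ^ k := by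
    intro k
    induction k with
    | zero => rfl
    | succ k ih => rw [hDs, hn2, ih, pow_succ]; ring
  have hgeo : HasSum (fun k : ℕ => (1 / 4 : ℝ) ^ (k + 1)) (1 / 3) := by
    have := (hasSum_geometric_of_lt_one (r := (1 / 4 : ℝ)) (by norm_num) (by norm_num)).mul_left
      (1 / 4)
    convert! this using 1
    · ext k; rw [pow_succ]; ring
    · norm_num
  let G : ℂ → CMat n := fun z => 1 + ∑' k, (D (k + 1)).1.1 z
  let E : ℂ → CMat n := fun z => 1 + ∑' k, err (D k) z
  have hDb : ∀ k, ∀ z ∈ ball (0 : ℂ) β, ‖(D k).1.1 z‖ ≤ (1 / 4) ^ k := fun k z hz =>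
    hD2 k ▸ (D k).2.2 z hz
  have heb : ∀ k, ∀ z ∈ exterior α, ‖err (D k) z‖ ≤ (1 / 4) ^ (k + 1) := fun k z hz => by
    have := hnb (D k) z hz
    rw [hD2] at this
    rw [pow_succ]; linarith
  have hG : DifferentiableOn ℂ G (ball 0 β) :=
    (differentiableOn_tsum_of_summable_norm hgeo.summable (fun k => (D (k + 1)).2.1) isOpen_ball
      (fun k z hz => hDb (k + 1) z hz)).const_add 1
  have hE : DifferentiableOn ℂ E (exterior α) :=
    (differentiableOn_tsum_of_summable_norm hgeo.summable (fun k => hnd (D k))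
      (isOpen_exterior α) heb).const_add 1
  have hGb : ∀ z ∈ ball (0 : ℂ) β, ‖G z - 1‖ ≤ 1 / 2 := fun z hz => by
    simp only [G, add_sub_cancel_left]
    exact (tsum_of_norm_bounded hgeo fun k => hDb (k + 1) z hz).trans (by norm_num)
  have hEb : ∀ z ∈ exterior α, ‖E z - 1‖ ≤ 1 / 2 := fun z hz => by
    simp only [E, add_sub_cancel_left]
    exact (tsum_of_norm_bounded hgeo fun k => heb k z hz).trans (by norm_num)
  have hGE : ∀ z ∈ annulus α β, G z * (1 + s z) = E z := by
    intro z hz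
    have hs1 : Summable fun k => (D (k + 1)).1.1 z :=
      Summable.of_norm_bounded hgeo.summable fun k => hDb (k + 1) z (hann hz)
    have hs0 : Summable fun k => (D k).1.1 z := (summable_nat_add_iff 1).1 hs1
    have hse : Summable fun k => err (D k) z :=
      Summable.of_norm_bounded hgeo.summable fun k => heb k z hz.1
    have hG0 : G z = ∑' k, (D k).1.1 z := by
      rw [hs0.tsum_eq_zero_add]; rfl
    have h1 : G z * s z = ∑' k, (-(D (k + 1)).1.1 z + err (D k) z) := by
      rw [hG0, ← hs0.tsum_mul_right]
      refine tsum_congr fun k => ?_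
      rw [hDs]; exact hne (D k) z hz
    rw [hs1.neg.tsum_add hse, tsum_neg] at h1
    rw [mul_add, mul_one, h1]
    simp only [G, E]; abel
  -- The relation G (1 + s) = E is linear in the pair (G, E) and s is symmetric, so it survives
  -- symmetrization.
  refine ⟨symmPart G, symmPart E, differentiableOn_symmPart isOpen_ball (fun _ => conj_mem_ball) hG,
    differentiableOn_symmPart (isOpen_exterior α) (fun _ => conj_mem_exterior) hE, ?_, ?_, ?_,
    symmPart_conj G, symmPart_conj E⟩
  · intro z hz
    have h1 := hGE z hz
    have h2 := hGE _ (conj_mem_annulus hz)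
    rw [hsym z hz] at h2
    have h3 : cj (G ((starRingEnd ℂ) z)) * (1 + s z) = cj (E ((starRingEnd ℂ) z)) := by
      rw [← h2, cj_mul (G _), cj_add 1 (cj (s z)), cj_one, cj_cj]
    simp only [symmPart]
    rw [smul_mul_assoc, add_mul, h1, h3]
  · intro z hz
    exact norm_symmPart_sub_le (g := fun _ => 1) cj_one.symm (hGb z hz) (hGb _ (conj_mem_ball hz))
  · intro z hz
    exact norm_symmPart_sub_le (g := fun _ => 1) cj_one.symm (hEb z hz)
      (hEb _ (conj_mem_exterior hz))

/-- Values of a matrix polynomial. -/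
def matPoly (c : ℕ → CMat n) (N : ℕ) (z : ℂ) : CMat n := ∑ k ∈ Finset.range N, z ^ k • c k

lemma differentiable_matPoly (c : ℕ → CMat n) (N : ℕ) : Differentiable ℂ (matPoly c N) := by
  unfold matPoly
  fun_prop

lemma matPoly_conj {c : ℕ → CMat n} (hc : ∀ k, cj (c k) = c k) (N : ℕ) (z : ℂ) :
    matPoly c N ((starRingEnd ℂ) z) = cj (matPoly c N z) := by
  simp [matPoly, cj_sum, cj_smul, hc]

/-- A conjugation-symmetric invertible matrix function in an annulus is, up to a scalar power,
a left quotient of an interior function (polynomial up to an invertible factor) and of an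
exterior one. -/
theorem exists_left_quotient [NeZero n] {α β d : ℝ} (hα : 0 ≤ α) (hd : 0 < d)
    (hβ : β = α + 4 * d) (hβ1 : β ≤ 1) {F : ℂ → CMat n}
    (hF : DifferentiableOn ℂ F (annulus α β)) (hFu : ∀ z ∈ annulus α β, IsUnit (F z))
    (hsym : ConjSymm F (annulus α β)) {κ : ℝ} (hκ : ∀ z ∈ annulus α β, ‖F z‖ ≤ κ)
    (hκ' : ∀ z ∈ annulus α β, ‖(F z)⁻¹‖ ≤ κ) {N : ℕ}
    (hN : (1 + 4 / d) * (4 * κ / d * (1 - d / 2) ^ N * κ) ≤ 1 / 4) :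
    ∃ (c : ℕ → CMat n) (G E : ℂ → CMat n), (∀ k, cj (c k) = c k) ∧
      DifferentiableOn ℂ G (ball 0 (α + 5 / 2 * d)) ∧
      DifferentiableOn ℂ E (exterior (α + 3 / 2 * d)) ∧
      (∀ z ∈ ball (0 : ℂ) (α + 5 / 2 * d), ‖G z - 1‖ ≤ 1 / 2) ∧
      (∀ z ∈ exterior (α + 3 / 2 * d), ‖E z - 1‖ ≤ 1 / 2) ∧
      (∀ z, G ((starRingEnd ℂ) z) = cj (G z)) ∧ (∀ z, E ((starRingEnd ℂ) z) = cj (E z)) ∧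
      (∀ z ∈ annulus (α + 3 / 2 * d) (α + 5 / 2 * d),
        G z * matPoly c (2 * N) z * F z = z ^ N • E z) := by
  have hinv : DifferentiableOn ℂ (fun z => (F z)⁻¹) (annulus α β) := fun z hz =>
    (CMat.hasDerivAt_inv (hF.differentiableAt ((isOpen_annulus α β).mem_nhds hz)).hasDerivAt
      (hFu z hz)).differentiableAt.differentiableWithinAt
  obtain ⟨c₀, hc₀⟩ := exists_laurent_approx hα hd hβ hβ1 hinv hκ' N
  let c : ℕ → CMat n := fun k => (1 / 2 : ℂ) • (c₀ k + cj (c₀ k))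
  have hc : ∀ k, cj (c k) = c k := fun k => by
    simp [c, cj_smul, cj_add, add_comm, Complex.conj_ofNat]
  have hsub : annulus (α + 3 / 2 * d) (α + 5 / 2 * d) ⊆ annulus α β := fun z hz =>
    ⟨by linarith [hz.1], by linarith [hz.2]⟩
  have hz0 : ∀ z ∈ annulus (α + 3 / 2 * d) (α + 5 / 2 * d), z ≠ 0 := fun z hz =>
    norm_pos_iff.1 (by linarith [hz.1])
  have happ : ∀ z ∈ annulus (α + 3 / 2 * d) (α + 5 / 2 * d),
      ‖(z ^ N)⁻¹ • matPoly c (2 * N) z - (F z)⁻¹‖ ≤ 4 * κ / d * (1 - d / 2) ^ N := by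
    intro z hz
    have h := norm_symmPart_sub_le (f := fun z => (z ^ N)⁻¹ • matPoly c₀ (2 * N) z)
      (g := fun z => (F z)⁻¹) (z := z) (ε := 4 * κ / d * (1 - d / 2) ^ N) (by simp only [hsym z (hsub hz), cj_inv])
      (by rw [norm_sub_rev]; exact hc₀ z hz)
      (by rw [norm_sub_rev]; exact hc₀ _ (conj_mem_annulus hz))
    convert! h using 3
    simp only [symmPart, matPoly, c, cj_smul, cj_sum, map_inv₀, map_pow, conj_conj]
    rw [← smul_add, ← Finset.sum_add_distrib, smul_comm (1 / 2 : ℂ) (z ^ N)⁻¹]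
    congr 1
    rw [Finset.smul_sum]
    refine Finset.sum_congr rfl fun k _ => ?_
    rw [smul_comm, smul_add (z ^ k)]
  -- s measures how far the Laurent polynomial is from being a left inverse of F.
  let s : ℂ → CMat n := fun z => ((z ^ N)⁻¹ • matPoly c (2 * N) z) * F z - 1
  have hs : DifferentiableOn ℂ s (annulus (α + 3 / 2 * d) (α + 5 / 2 * d)) := by
    have h1 : DifferentiableOn ℂ (fun z : ℂ => (z ^ N)⁻¹)
        (annulus (α + 3 / 2 * d) (α + 5 / 2 * d)) := fun z hz =>
      ((differentiableAt_id.pow N).inv (pow_ne_zero _ (hz0 z hz))).differentiableWithinAt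
    exact ((h1.fun_smul (differentiable_matPoly c _).differentiableOn).fun_mul
      (hF.mono hsub)).sub_const 1
  have hsb : ∀ z ∈ annulus (α + 3 / 2 * d) (α + 5 / 2 * d),
      ‖s z‖ ≤ 4 * κ / d * (1 - d / 2) ^ N * κ := by
    intro z hz
    have h1 : s z = ((z ^ N)⁻¹ • matPoly c (2 * N) z - (F z)⁻¹) * F z := by
      rw [sub_mul, CMat.inv_mul (hFu z (hsub hz))]
    rw [h1]
    exact (norm_mul_le _ _).trans (mul_le_mul (happ z hz) (hκ z (hsub hz)) (norm_nonneg _)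
      ((norm_nonneg _).trans (happ z hz)))
  have hssym : ConjSymm s (annulus (α + 3 / 2 * d) (α + 5 / 2 * d)) := by
    intro z hz
    simp only [s, matPoly_conj hc, hsym z (hsub hz), cj_sub, cj_mul, cj_smul, cj_one, map_inv₀,
      map_pow]
  -- The narrower annulus has width d, so the splitting step is d / 4; this is the origin of the
  -- factor 1 + 4 / d in `hN`.
  obtain ⟨G, E, hG, hE, hGE, hGb, hEb, hGs, hEs⟩ := exists_factorization_near_one
    (by linarith : 0 ≤ α + 3 / 2 * d) (by linarith : 0 < d / 4) (by ring)
    (by linarith : α + 5 / 2 * d ≤ 1) hs hsb (by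
      rw [one_div_div]; exact hN) hssym
  refine ⟨c, G, E, hc, hG, hE, hGb, hEb, hGs, hEs, fun z hz => ?_⟩
  rw [← hGE z hz]
  simp only [s, add_sub_cancel]
  rw [smul_mul_assoc, mul_smul_comm, smul_smul, mul_inv_cancel₀ (pow_ne_zero _ (hz0 z hz)),
    one_smul, mul_assoc]

end Factorization

end

noncomputable section

open Complex Metric

/-! ### Removal of the zeros of the determinant. -/

section Elimination

variable {n : ℕ}

lemma det_one_updateRow (i : Fin n) (a : Fin n → ℂ) : ((1 : CMat n).updateRow i a).det = a i := by
  rw [← Matrix.cramer_transpose_apply, Matrix.transpose_one, Matrix.cramer_one]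
  rfl

/-- The matrix is a rank two perturbation of 1, and det (1 + U V) = det (1 + V U) leaves a 2 × 2
determinant. -/
lemma det_one_updateRow_updateRow {i k : Fin n} (hik : i ≠ k) (a b : Fin n → ℂ) :
    (((1 : CMat n).updateRow i a).updateRow k b).det = a i * b k - a k * b i := by
  let U : Matrix (Fin n) (Fin 2) ℂ := fun l s => if s = 0 then (Pi.single i 1 : Fin n → ℂ) l else (Pi.single k 1 : Fin n → ℂ) l
  let V : Matrix (Fin 2) (Fin n) ℂ := fun s j =>
    if s = 0 then a j - (1 : CMat n) i j else b j - (1 : CMat n) k j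
  have h : ((1 : CMat n).updateRow i a).updateRow k b = 1 + U * V := by
    ext l j
    rw [Matrix.add_apply, Matrix.mul_apply, Fin.sum_univ_two, Matrix.updateRow_apply,
      Matrix.updateRow_apply]
    simp only [U, V, if_true, Fin.isValue, one_ne_zero, if_false]
    by_cases h1 : l = k
    · subst h1; simp [hik.symm]
    · by_cases h2 : l = i
      · subst h2; simp [h1]
      · simp [h1, h2]
  rw [h, Matrix.det_one_add_mul_comm, Matrix.det_fin_two]
  have hV : ∀ s, (V * U) s 0 = V s i ∧ (V * U) s 1 = V s k := by
    intro s
    constructor <;> rw [Matrix.mul_apply] <;> simp [U, Pi.single_apply]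
  simp only [Matrix.add_apply, (hV _).1, (hV _).2]
  simp [V, hik, hik.symm]

lemma updateRow_mul_one (G : CMat n) (i : Fin n) (a : Fin n → ℂ) :
    (1 : CMat n).updateRow i a * G = G.updateRow i (Matrix.vecMul a G) := by
  rw [Matrix.updateRow_mul, one_mul]

lemma eqOn_of_eqOn_diff_finite {E : Type*} [TopologicalSpace E] [T2Space E] {U Z : Set ℂ}
    (hU : IsOpen U) (hZ : Z.Finite) {f g : ℂ → E} (hf : ContinuousOn f U) (hg : ContinuousOn g U)
    (h : ∀ z ∈ U, z ∉ Z → f z = g z) : ∀ z ∈ U, f z = g z := by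
  intro z hz
  have hd : Dense Zᶜ := hZ.countable.dense_compl ℂ
  have : (nhdsWithin z Zᶜ).NeBot := mem_closure_iff_nhdsWithin_neBot.1 (hd z)
  have h1 : Filter.Tendsto f (nhdsWithin z Zᶜ) (nhds (f z)) :=
    ((hf.continuousAt (hU.mem_nhds hz)).tendsto).mono_left nhdsWithin_le_nhds
  have h2 : Filter.Tendsto g (nhdsWithin z Zᶜ) (nhds (g z)) :=
    ((hg.continuousAt (hU.mem_nhds hz)).tendsto).mono_left nhdsWithin_le_nhds
  refine tendsto_nhds_unique (h1.congr' ?_) h2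
  filter_upwards [self_mem_nhdsWithin, nhdsWithin_le_nhds (hU.mem_nhds hz)] with w hw hw'
  exact h w hw' hw

lemma CMat.continuousOn_det {G : ℂ → CMat n} {U : Set ℂ} (h : ContinuousOn G U) :
    ContinuousOn (fun z => (G z).det) U :=
  (Continuous.matrix_det continuous_id).comp_continuousOn h

/-- `G₁` is obtained from `G` by left multiplication with a function `R` on the exterior domain,
with quantitative control of `R`. -/
structure IsReduction (α β δ C : ℝ) (D : ℕ) (G G₁ R : ℂ → CMat n) : Prop where
  diff_R : DifferentiableOn ℂ R (exterior α)
  symm_R : ConjSymm R (exterior α)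
  norm_R : ∀ z : ℂ, α + δ ≤ ‖z‖ → ‖R z‖ ≤ C
  det_R : ∀ z ∈ exterior α, 1 ≤ ‖(R z).det‖ * (‖z‖ + 1) ^ D
  mul_eq : ∀ z ∈ annulus α β, R z * G z = G₁ z
  diff : DifferentiableOn ℂ G₁ (ball 0 β)
  symm : ConjSymm G₁ (ball 0 β)

lemma IsReduction.trans {α β δ C C' : ℝ} {D D' : ℕ} {G G₁ G₂ R R' : ℂ → CMat n}
    (h : IsReduction α β δ C D G G₁ R) (h' : IsReduction α β δ C' D' G₁ G₂ R') (hC : 0 ≤ C') :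
    IsReduction α β δ (C' * C) (D' + D) G G₂ (fun z => R' z * R z) where
  diff_R := h'.diff_R.mul h.diff_R
  symm_R := fun z hz => by simp only [h'.symm_R z hz, h.symm_R z hz, cj_mul]
  norm_R := fun z hz => (norm_mul_le _ _).trans
    (mul_le_mul (h'.norm_R z hz) (h.norm_R z hz) (norm_nonneg _) hC)
  det_R := fun z hz => by
    rw [Matrix.det_mul, norm_mul, pow_add, mul_mul_mul_comm]
    exact one_le_mul_of_one_le_of_one_le (h'.det_R z hz) (h.det_R z hz)
  mul_eq := fun z hz => by rw [mul_assoc, h.mul_eq z hz, h'.mul_eq z hz]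
  diff := h'.diff
  symm := h'.symm

/-- Scaling the largest entry to 1 bounds the vector independently of M and singles out a row i to
be replaced, whose coefficient does not degenerate. -/
lemma exists_normalized_left_null {M : CMat n} (h : M.det = 0) :
    ∃ (w : Fin n → ℂ) (i : Fin n), Matrix.vecMul w M = 0 ∧ w i = 1 ∧ ∀ j, ‖w j‖ ≤ 1 := by
  obtain ⟨v, hv0, hv⟩ := Matrix.exists_vecMul_eq_zero_iff.2 h
  obtain ⟨l, hl⟩ : ∃ l, v l ≠ 0 := Function.ne_iff.1 hv0
  obtain ⟨i, -, hi⟩ := Finset.exists_max_image Finset.univ (fun j => ‖v j‖) ⟨l, Finset.mem_univ l⟩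
  have hi0 : 0 < ‖v i‖ := (norm_pos_iff.2 hl).trans_le (hi l (Finset.mem_univ l))
  have hvi : v i ≠ 0 := norm_pos_iff.1 hi0
  refine ⟨(v i)⁻¹ • v, i, by rw [Matrix.smul_vecMul, hv, smul_zero], by simp [hvi], fun j => ?_⟩
  rw [Pi.smul_apply, smul_eq_mul, norm_mul, norm_inv, ← div_eq_inv_mul, div_le_one hi0]
  exact hi j (Finset.mem_univ j)

/-- The row `Re (w / (t - t₀))`. -/
def rowRe (w : Fin n → ℂ) (t₀ t : ℂ) (l : Fin n) : ℂ :=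
  (w l / (t - t₀) + (starRingEnd ℂ) (w l) / (t - (starRingEnd ℂ) t₀)) / 2

/-- The row `Im (w / (t - t₀))`. -/
def rowIm (w : Fin n → ℂ) (t₀ t : ℂ) (l : Fin n) : ℂ :=
  (w l / (t - t₀) - (starRingEnd ℂ) (w l) / (t - (starRingEnd ℂ) t₀)) / (2 * I)

/-- The removable extension of `w G / (t - t₀)`. -/
def rowQuot (w : Fin n → ℂ) (G : ℂ → CMat n) (t₀ t : ℂ) (j : Fin n) : ℂ :=
  dslope (fun t => Matrix.vecMul w (G t) j) t₀ t

/-- The real part is taken with respect to the reflection t ↦ conj t, hence it stays holomorphic. It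
extends the product of `rowRe w t₀ t` with G t through t₀ and its conjugate. -/
def rowQuotRe (w : Fin n → ℂ) (G : ℂ → CMat n) (t₀ t : ℂ) (j : Fin n) : ℂ :=
  (rowQuot w G t₀ t j + (starRingEnd ℂ) (rowQuot w G t₀ ((starRingEnd ℂ) t) j)) / 2

def rowQuotIm (w : Fin n → ℂ) (G : ℂ → CMat n) (t₀ t : ℂ) (j : Fin n) : ℂ :=
  (rowQuot w G t₀ t j - (starRingEnd ℂ) (rowQuot w G t₀ ((starRingEnd ℂ) t) j)) / (2 * I)

lemma rowRe_conj (w : Fin n → ℂ) (t₀ t : ℂ) (l : Fin n) :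
    rowRe w t₀ ((starRingEnd ℂ) t) l = (starRingEnd ℂ) (rowRe w t₀ t l) := by
  simp [rowRe, Complex.conj_ofNat, add_comm]

lemma rowIm_conj (w : Fin n → ℂ) (t₀ t : ℂ) (l : Fin n) :
    rowIm w t₀ ((starRingEnd ℂ) t) l = (starRingEnd ℂ) (rowIm w t₀ t l) := by
  simp only [rowIm, map_div₀, map_sub, map_mul, conj_conj, conj_I, Complex.conj_ofNat]
  rw [mul_neg, div_neg, ← neg_div, neg_sub]

lemma rowQuotRe_conj (w : Fin n → ℂ) (G : ℂ → CMat n) (t₀ t : ℂ) (l : Fin n) :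
    rowQuotRe w G t₀ ((starRingEnd ℂ) t) l = (starRingEnd ℂ) (rowQuotRe w G t₀ t l) := by
  simp [rowQuotRe, Complex.conj_ofNat, add_comm]

lemma rowQuotIm_conj (w : Fin n → ℂ) (G : ℂ → CMat n) (t₀ t : ℂ) (l : Fin n) :
    rowQuotIm w G t₀ ((starRingEnd ℂ) t) l = (starRingEnd ℂ) (rowQuotIm w G t₀ t l) := by
  simp only [rowQuotIm, map_div₀, map_sub, map_mul, conj_conj, conj_I, Complex.conj_ofNat]
  rw [mul_neg, div_neg, ← neg_div, neg_sub]

section RowQuot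

variable {w : Fin n → ℂ} {G : ℂ → CMat n} {t₀ : ℂ} {β : ℝ}

lemma differentiableOn_rowQuot (hG : DifferentiableOn ℂ G (ball 0 β)) (ht₀ : t₀ ∈ ball (0 : ℂ) β)
    (j : Fin n) : DifferentiableOn ℂ (fun t => rowQuot w G t₀ t j) (ball 0 β) := by
  refine (differentiableOn_dslope (isOpen_ball.mem_nhds ht₀)).2 ?_
  intro t ht
  have h := hG.differentiableAt (isOpen_ball.mem_nhds ht)
  rw [CMat.differentiableAt_iff] at h
  refine DifferentiableAt.differentiableWithinAt ?_
  simp only [Matrix.vecMul, dotProduct]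
  exact DifferentiableAt.fun_sum fun l _ => (h l j).const_mul (w l)

lemma differentiableOn_conj_rowQuot (hG : DifferentiableOn ℂ G (ball 0 β))
    (ht₀ : t₀ ∈ ball (0 : ℂ) β) (j : Fin n) : DifferentiableOn ℂ
      (fun t => (starRingEnd ℂ) (rowQuot w G t₀ ((starRingEnd ℂ) t) j)) (ball 0 β) := by
  intro t ht
  have h := ((differentiableOn_rowQuot (w := w) hG ht₀ j).differentiableAt
    (isOpen_ball.mem_nhds (conj_mem_ball ht))).conj_conj
  rw [conj_conj] at h
  exact h.differentiableWithinAt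

lemma rowQuot_eq (hw : Matrix.vecMul w (G t₀) = 0) {t : ℂ} (ht : t ≠ t₀) (j : Fin n) :
    rowQuot w G t₀ t j = Matrix.vecMul w (G t) j / (t - t₀) := by
  rw [rowQuot, dslope_of_ne _ ht, slope_def_field, hw]
  simp

lemma conj_rowQuot_eq (hw : Matrix.vecMul w (G t₀) = 0) (hs : ConjSymm G (ball 0 β)) {t : ℂ}
    (htb : t ∈ ball (0 : ℂ) β) (ht : t ≠ (starRingEnd ℂ) t₀) (j : Fin n) :
    (starRingEnd ℂ) (rowQuot w G t₀ ((starRingEnd ℂ) t) j) =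
      Matrix.vecMul (fun l => (starRingEnd ℂ) (w l)) (G t) j / (t - (starRingEnd ℂ) t₀) := by
  rw [rowQuot_eq hw (fun h => ht (by rw [← h, conj_conj])), hs t htb, map_div₀, map_sub, conj_conj]
  congr 1
  simp [Matrix.vecMul, dotProduct]

lemma rowRe_vecMul (hw : Matrix.vecMul w (G t₀) = 0) (hs : ConjSymm G (ball 0 β)) {t : ℂ}
    (htb : t ∈ ball (0 : ℂ) β) (h1 : t ≠ t₀) (h2 : t ≠ (starRingEnd ℂ) t₀) :
    Matrix.vecMul (rowRe w t₀ t) (G t) = rowQuotRe w G t₀ t := by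
  ext j
  rw [rowQuotRe, rowQuot_eq hw h1, conj_rowQuot_eq hw hs htb h2]
  simp only [Matrix.vecMul, dotProduct, rowRe, Finset.sum_div, ← Finset.sum_add_distrib]
  exact Finset.sum_congr rfl fun l _ => by ring

lemma rowIm_vecMul (hw : Matrix.vecMul w (G t₀) = 0) (hs : ConjSymm G (ball 0 β)) {t : ℂ}
    (htb : t ∈ ball (0 : ℂ) β) (h1 : t ≠ t₀) (h2 : t ≠ (starRingEnd ℂ) t₀) (c : ℂ) :
    Matrix.vecMul (fun l => rowIm w t₀ t l / c) (G t) = fun j => rowQuotIm w G t₀ t j / c := by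
  ext j
  rw [rowQuotIm, rowQuot_eq hw h1, conj_rowQuot_eq hw hs htb h2]
  simp only [Matrix.vecMul, dotProduct, rowIm, Finset.sum_div, ← Finset.sum_sub_distrib]
  exact Finset.sum_congr rfl fun l _ => by ring

end RowQuot

/-- A left factor of determinant ς / g, with g dividing p, cancels g from the determinant of G. The
identity is known off the finite set Z and extends by continuity. The exponent 2 records that g
grows at most quadratically, so that det R does not decay faster than |z|^(-2). -/
lemma isReduction_of_entries {α β δ c : ℝ} (hc : 0 ≤ c)
    {G : ℂ → CMat n} {u : ℂ → ℂ} {p : Polynomial ℂ} (hu : ContinuousOn u (ball 0 β))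
    (hp : p ≠ 0) (hdet : ∀ z ∈ ball (0 : ℂ) β, (G z).det = u z * p.eval z)
    {Z : Set ℂ} (hZ : Z.Finite) (hZα : ∀ z ∈ Z, ‖z‖ ≤ α) {R G₁ : ℂ → CMat n}
    (hRd : ∀ z ∉ Z, ∀ l j, DifferentiableAt ℂ (fun z => R z l j) z)
    (hRs : ∀ z l j, R ((starRingEnd ℂ) z) l j = (starRingEnd ℂ) (R z l j))
    (hRb : ∀ z : ℂ, α + δ ≤ ‖z‖ → ∀ l j, ‖R z l j‖ ≤ c)
    (hGd : ∀ l j, DifferentiableOn ℂ (fun z => G₁ z l j) (ball 0 β))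
    (hGs : ∀ z ∈ ball (0 : ℂ) β, ∀ l j, G₁ ((starRingEnd ℂ) z) l j = (starRingEnd ℂ) (G₁ z l j))
    (hmul : ∀ z ∈ ball (0 : ℂ) β, z ∉ Z → R z * G z = G₁ z) {g : Polynomial ℂ} {ς : ℂ}
    (hς : ‖ς‖ = 1) (hg : ∀ z ∉ Z, (R z).det * g.eval z = ς) (hgd : 1 ≤ g.natDegree) (hgp : g ∣ p)
    (hgb : ∀ z : ℂ, α < ‖z‖ → ‖g.eval z‖ ≤ (‖z‖ + 1) ^ 2) :
    ∃ p₁ : Polynomial ℂ, p₁ ≠ 0 ∧ p₁.natDegree < p.natDegree ∧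
      (∀ z ∈ ball (0 : ℂ) β, (G₁ z).det = u z * p₁.eval z) ∧
      IsReduction α β δ (n * c) 2 G G₁ R := by
  obtain ⟨q, rfl⟩ := hgp
  have hς0 : ς ≠ 0 := norm_pos_iff.1 (by rw [hς]; exact one_pos)
  have hq : q ≠ 0 := right_ne_zero_of_mul hp
  have hg0 : g ≠ 0 := left_ne_zero_of_mul hp
  have hext : ∀ z ∈ exterior α, z ∉ Z := fun z hz h => (hZα z h).not_gt hz
  have hdG : DifferentiableOn ℂ G₁ (ball 0 β) := fun z hz =>
    (CMat.differentiableAt_iff.2 fun l j =>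
      (hGd l j).differentiableAt (isOpen_ball.mem_nhds hz)).differentiableWithinAt
  refine ⟨Polynomial.C ς * q, mul_ne_zero (Polynomial.C_ne_zero.2 hς0) hq, ?_, ?_, ?_⟩
  · rw [Polynomial.natDegree_C_mul hς0, Polynomial.natDegree_mul hg0 hq]
    omega
  · refine eqOn_of_eqOn_diff_finite isOpen_ball hZ (CMat.continuousOn_det hdG.continuousOn)
      (hu.mul (Polynomial.continuous _).continuousOn) fun z hz hzZ => ?_
    have h1 := hg z hzZ
    rw [← hmul z hz hzZ, Matrix.det_mul, hdet z hz, Polynomial.eval_mul, Polynomial.eval_mul,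
      Polynomial.eval_C, ← h1]
    ring
  · refine ⟨fun z hz => ?_, fun z hz => ?_, fun z hz => ?_, fun z hz => ?_, fun z hz => ?_, hdG,
      fun z hz => ?_⟩
    · exact (CMat.differentiableAt_iff.2 fun l j =>
        hRd z (hext z hz) l j).differentiableWithinAt
    · ext l j; exact hRs z l j
    · exact CMat.norm_le_of_entry_le _ hc (hRb z hz)
    · have h1 := congrArg norm (hg z (hext z hz))
      rw [norm_mul, hς] at h1
      exact h1.ge.trans (mul_le_mul_of_nonneg_left (hgb z hz) (norm_nonneg _))
    · exact hmul z (mem_ball_zero_iff.2 hz.2) (hext z hz.1)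
    · ext l j; exact hGs z hz l j

section RowBounds

variable {w : Fin n → ℂ} {t₀ : ℂ}

lemma differentiableAt_rowRe {z : ℂ} (h1 : z ≠ t₀) (h2 : z ≠ (starRingEnd ℂ) t₀) (l : Fin n) :
    DifferentiableAt ℂ (fun z => rowRe w t₀ z l) z := by
  have h1' := sub_ne_zero.2 h1
  have h2' := sub_ne_zero.2 h2
  unfold rowRe
  fun_prop (disch := assumption)

lemma differentiableAt_rowIm {z : ℂ} (h1 : z ≠ t₀) (h2 : z ≠ (starRingEnd ℂ) t₀) (l : Fin n) :
    DifferentiableAt ℂ (fun z => rowIm w t₀ z l) z := by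
  have h1' := sub_ne_zero.2 h1
  have h2' := sub_ne_zero.2 h2
  unfold rowIm
  refine DifferentiableAt.div_const ?_ _
  fun_prop (disch := assumption)

lemma le_norm_sub {α δ : ℝ} {z t : ℂ} (hz : α + δ ≤ ‖z‖) (ht : ‖t‖ ≤ α) : δ ≤ ‖z - t‖ := by
  linarith [norm_sub_norm_le z t]

lemma norm_rowRe_le {α δ : ℝ} (hδ : 0 < δ) {z : ℂ} (hz : α + δ ≤ ‖z‖) (ht : ‖t₀‖ ≤ α)
    (hw : ∀ j, ‖w j‖ ≤ 1) (l : Fin n) : ‖rowRe w t₀ z l‖ ≤ 1 / δ := by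
  have h1 := le_norm_sub hz ht
  have h2 := le_norm_sub (t := (starRingEnd ℂ) t₀) hz (by simpa using ht)
  have e1 : ‖w l / (z - t₀)‖ ≤ 1 / δ := by
    rw [norm_div]; exact div_le_div₀ zero_le_one (hw l) hδ h1
  have e2 : ‖(starRingEnd ℂ) (w l) / (z - (starRingEnd ℂ) t₀)‖ ≤ 1 / δ := by
    rw [norm_div, RCLike.norm_conj]; exact div_le_div₀ zero_le_one (hw l) hδ h2
  rw [rowRe, norm_div]
  have := norm_add_le (w l / (z - t₀)) ((starRingEnd ℂ) (w l) / (z - (starRingEnd ℂ) t₀))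
  norm_num at *
  linarith

/-- The bound is small when t₀ and w are both nearly real: Im (w / (z - t₀)) splits into a term
carrying Im t₀ and a term carrying Im w. The row may therefore be divided by the larger of the two
imaginary parts without losing control. -/
lemma norm_rowIm_le {α δ : ℝ} (hδ : 0 < δ) {z : ℂ} (hz : α + δ ≤ ‖z‖) (ht : ‖t₀‖ ≤ α)
    (hw : ∀ j, ‖w j‖ ≤ 1) (l : Fin n) :
    ‖rowIm w t₀ z l‖ ≤ |t₀.im| / δ ^ 2 + |(w l).im| / δ := by
  have h1 := le_norm_sub hz ht
  have h2 := le_norm_sub (t := (starRingEnd ℂ) t₀) hz (by simpa using ht)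
  have z1 : z - t₀ ≠ 0 := norm_pos_iff.1 (hδ.trans_le h1)
  have z2 : z - (starRingEnd ℂ) t₀ ≠ 0 := norm_pos_iff.1 (hδ.trans_le h2)
  have key : rowIm w t₀ z l = ((w l).re : ℂ) * ((t₀.im : ℂ) / ((z - t₀) * (z - (starRingEnd ℂ) t₀)))
      + ((w l).im : ℂ) * ((1 / (z - t₀) + 1 / (z - (starRingEnd ℂ) t₀)) / 2) := by
    have hw1 : w l = (w l).re + (w l).im * I := (re_add_im _).symm
    have hw2 : (starRingEnd ℂ) (w l) = (w l).re - (w l).im * I := by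
      apply Complex.ext <;> simp
    have ht1 : t₀ - (starRingEnd ℂ) t₀ = 2 * t₀.im * I := by
      apply Complex.ext <;> simp; ring
    rw [rowIm, hw2]
    nth_rewrite 1 [hw1]
    generalize ((w l).re : ℂ) = a
    generalize ((w l).im : ℂ) = b
    generalize (t₀.im : ℂ) = y at ht1 ⊢
    generalize (starRingEnd ℂ) t₀ = t₁ at *
    have hy : y = (t₀ - t₁) / (2 * I) := by
      rw [ht1]; field_simp
    rw [hy]
    have hI : I ≠ 0 := I_ne_zero
    field_simp
    ring_nf
  rw [key]
  have e1 : ‖((w l).re : ℂ) * ((t₀.im : ℂ) / ((z - t₀) * (z - (starRingEnd ℂ) t₀)))‖ ≤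
      |t₀.im| / δ ^ 2 := by
    rw [norm_mul, norm_div, norm_mul, norm_real, norm_real, Real.norm_eq_abs, Real.norm_eq_abs, sq]
    have : |(w l).re| ≤ 1 := (abs_re_le_norm _).trans (hw l)
    calc |(w l).re| * (|t₀.im| / (‖z - t₀‖ * ‖z - (starRingEnd ℂ) t₀‖))
        ≤ 1 * (|t₀.im| / (δ * δ)) := by gcongr
      _ = _ := one_mul _
  have e2 : ‖((w l).im : ℂ) * ((1 / (z - t₀) + 1 / (z - (starRingEnd ℂ) t₀)) / 2)‖ ≤
      |(w l).im| / δ := by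
    have a1 : ‖1 / (z - t₀)‖ ≤ 1 / δ := by
      rw [norm_div, norm_one]; gcongr
    have a2 : ‖1 / (z - (starRingEnd ℂ) t₀)‖ ≤ 1 / δ := by
      rw [norm_div, norm_one]; gcongr
    have a3 : ‖(1 / (z - t₀) + 1 / (z - (starRingEnd ℂ) t₀)) / 2‖ ≤ 1 / δ := by
      rw [norm_div, RCLike.norm_ofNat]
      linarith [norm_add_le (1 / (z - t₀)) (1 / (z - (starRingEnd ℂ) t₀))]
    rw [norm_mul, norm_real, Real.norm_eq_abs]
    exact (mul_le_mul_of_nonneg_left a3 (abs_nonneg _)).trans_eq (mul_one_div _ _)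
  exact (norm_add_le _ _).trans (add_le_add e1 e2)

end RowBounds

/-- Removal of a zero (or of a conjugate pair of zeros) of the determinant by a well-conditioned
rational left factor. -/
theorem exists_reduction_step {α β δ : ℝ} (hαβ : α < β) (hβ1 : β ≤ 1) (hδ : 0 < δ)
    {G : ℂ → CMat n} (hG : DifferentiableOn ℂ G (ball 0 β)) (hs : ConjSymm G (ball 0 β))
    {u : ℂ → ℂ} {p : Polynomial ℂ} (hu : ContinuousOn u (ball 0 β))
    (hu0 : ∀ z ∈ ball (0 : ℂ) β, u z ≠ 0) (hp : p ≠ 0)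
    (hdet : ∀ z ∈ ball (0 : ℂ) β, (G z).det = u z * p.eval z)
    (hann : ∀ z ∈ annulus α β, (G z).det ≠ 0) {t₀ : ℂ} (ht₀ : t₀ ∈ ball (0 : ℂ) β)
    (hroot : p.eval t₀ = 0) :
    ∃ (G₁ R : ℂ → CMat n) (p₁ : Polynomial ℂ), p₁ ≠ 0 ∧ p₁.natDegree < p.natDegree ∧
      (∀ z ∈ ball (0 : ℂ) β, (G₁ z).det = u z * p₁.eval z) ∧
      IsReduction α β δ (n * (1 + 1 / δ + 1 / δ ^ 2)) 2 G G₁ R := by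
  have hd0 : (G t₀).det = 0 := by rw [hdet t₀ ht₀, hroot, mul_zero]
  have htα : ‖t₀‖ ≤ α := by
    by_contra h
    exact hann t₀ ⟨not_le.1 h, mem_ball_zero_iff.1 ht₀⟩ hd0
  have htα' : ‖(starRingEnd ℂ) t₀‖ ≤ α := by simpa using htα
  have hα1 : ‖t₀‖ ≤ 1 := by linarith
  have hα1' : ‖(starRingEnd ℂ) t₀‖ ≤ 1 := by linarith
  have hc0 : 0 ≤ 1 + 1 / δ + 1 / δ ^ 2 := by positivity
  have hδ1 : 0 ≤ 1 / δ := by positivity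
  have hδ2 : 0 ≤ 1 / δ ^ 2 := by positivity
  obtain ⟨Z, hZdef⟩ : ∃ Z : Set ℂ, Z = {t₀, (starRingEnd ℂ) t₀} := ⟨_, rfl⟩
  have hZ : Z.Finite := by rw [hZdef]; exact Set.toFinite _
  have hZα : ∀ z ∈ Z, ‖z‖ ≤ α := by
    rw [hZdef]; rintro z (rfl | rfl) <;> assumption
  have hZ1 : ∀ z ∉ Z, z ≠ t₀ := fun z hz h => hz (by rw [hZdef, h]; simp)
  have hZ2 : ∀ z ∉ Z, z ≠ (starRingEnd ℂ) t₀ := fun z hz h => hz (by rw [hZdef, h]; simp)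
  have hone : ∀ l j : Fin n, ‖(1 : CMat n) l j‖ ≤ 1 := fun l j => by
    rw [Matrix.one_apply]; split_ifs <;> simp
  have hone' : ∀ l j : Fin n, (1 : CMat n) l j = (starRingEnd ℂ) ((1 : CMat n) l j) := fun l j => by
    rw [Matrix.one_apply]; split_ifs <;> simp
  have hGe : ∀ l j, DifferentiableOn ℂ (fun z => G z l j) (ball 0 β) := fun l j z hz =>
    (CMat.differentiableAt_iff.1 (hG.differentiableAt (isOpen_ball.mem_nhds hz)) l
      j).differentiableWithinAt
  have hGs : ∀ z ∈ ball (0 : ℂ) β, ∀ l j, G ((starRingEnd ℂ) z) l j = (starRingEnd ℂ) (G z l j) :=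
    fun z hz l j => by rw [hs z hz]; rfl
  have hdRe : ∀ (w : Fin n → ℂ) j, DifferentiableOn ℂ (fun z => rowQuotRe w G t₀ z j) (ball 0 β) :=
    fun w j => ((differentiableOn_rowQuot hG ht₀ j).add
      (differentiableOn_conj_rowQuot hG ht₀ j)).div_const 2
  have hdIm : ∀ (w : Fin n → ℂ) j (c : ℂ), DifferentiableOn ℂ (fun z => rowQuotIm w G t₀ z j / c)
      (ball 0 β) := fun w j c => (((differentiableOn_rowQuot hG ht₀ j).sub
        (differentiableOn_conj_rowQuot hG ht₀ j)).div_const (2 * I)).div_const c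
  obtain ⟨w, i, hw, hwi, hwb⟩ := exists_normalized_left_null hd0
  -- Zeros in the disk come in conjugate pairs because G is symmetric and u has no zeros; p itself
  -- need not be real.
  have hroot' : p.eval ((starRingEnd ℂ) t₀) = 0 := by
    have h1 := hdet _ (conj_mem_ball ht₀)
    rw [hs t₀ ht₀, cj_det, hd0, map_zero] at h1
    exact (mul_eq_zero.1 h1.symm).resolve_left (hu0 _ (conj_mem_ball ht₀))
  by_cases hreal : (starRingEnd ℂ) t₀ = t₀
  · -- a real zero: the null vector can be taken real
    obtain ⟨v, hvdef⟩ : ∃ v : Fin n → ℂ, v = fun l => (w l + (starRingEnd ℂ) (w l)) / 2 := ⟨_, rfl⟩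
    have hvi : v i = 1 := by simp [hvdef, hwi]
    have hvb : ∀ j, ‖v j‖ ≤ 1 := fun j => by
      rw [hvdef]
      simp only [norm_div, RCLike.norm_ofNat]
      have := norm_add_le (w j) ((starRingEnd ℂ) (w j))
      rw [RCLike.norm_conj] at this
      linarith [hwb j]
    have hvc : ∀ l, (starRingEnd ℂ) (v l) = v l := fun l => by
      simp [hvdef, Complex.conj_ofNat, add_comm]
    have hv : Matrix.vecMul v (G t₀) = 0 := by
      have h1 : ∀ j, ∑ l, w l * G t₀ l j = 0 := fun j => congrFun hw j
      ext j
      have h2 := congrArg (starRingEnd ℂ) (h1 j)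
      rw [map_sum, map_zero] at h2
      have h3 : ∀ l, (starRingEnd ℂ) (w l * G t₀ l j) = (starRingEnd ℂ) (w l) * G t₀ l j := by
        intro l
        have := hGs t₀ ht₀ l j
        rw [hreal] at this
        rw [map_mul, ← this]
      simp only [h3] at h2
      have h4 : ∑ l, v l * G t₀ l j =
          (∑ l, w l * G t₀ l j + ∑ l, (starRingEnd ℂ) (w l) * G t₀ l j) / 2 := by
        rw [← Finset.sum_add_distrib, Finset.sum_div]
        exact Finset.sum_congr rfl fun l _ => by rw [hvdef]; ring
      change ∑ l, v l * G t₀ l j = 0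
      rw [h4, h1, h2]; simp
    refine ⟨fun z => (G z).updateRow i (rowQuotRe v G t₀ z),
      fun z => (1 : CMat n).updateRow i (rowRe v t₀ z),
      isReduction_of_entries hc0 hu hp hdet hZ hZα ?_ ?_ ?_ ?_ ?_ ?_ (ς := 1) (by simp)
        (g := Polynomial.X - Polynomial.C t₀) ?_ ?_ ?_ ?_⟩
    · intro z hz l j
      simp only [Matrix.updateRow_apply]
      split_ifs
      · exact differentiableAt_rowRe (hZ1 z hz) (hZ2 z hz) j
      · exact differentiableAt_const _
    · intro z l j
      simp only [Matrix.updateRow_apply]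
      split_ifs
      · exact rowRe_conj _ _ _ _
      · exact hone' _ _
    · intro z hz l j
      simp only [Matrix.updateRow_apply]
      split_ifs
      · linarith [norm_rowRe_le hδ hz htα hvb j]
      · linarith [hone l j]
    · intro l j
      simp only [Matrix.updateRow_apply]
      split_ifs
      · exact hdRe v j
      · exact hGe l j
    · intro z hz l j
      simp only [Matrix.updateRow_apply]
      split_ifs
      · exact rowQuotRe_conj _ _ _ _ _
      · exact hGs z hz l j
    · intro z hz hzZ
      rw [updateRow_mul_one, rowRe_vecMul hv hs hz (hZ1 z hzZ) (hZ2 z hzZ)]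
    · intro z hz
      have := sub_ne_zero.2 (hZ1 z hz)
      rw [det_one_updateRow, rowRe, hvc, hvi, hreal, Polynomial.eval_sub, Polynomial.eval_X,
        Polynomial.eval_C]
      field_simp
      norm_num
    · rw [Polynomial.natDegree_X_sub_C]
    · exact Polynomial.dvd_iff_isRoot.2 hroot
    · intro z _
      rw [Polynomial.eval_sub, Polynomial.eval_X, Polynomial.eval_C]
      have := norm_sub_le z t₀
      nlinarith [norm_nonneg z]
  · have him : t₀.im ≠ 0 := fun h => hreal (conj_eq_iff_im.2 h)
    have himp : 0 < |t₀.im| := abs_pos.2 him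
    have himC : (t₀.im : ℂ) ≠ 0 := ofReal_ne_zero.2 him
    have hsubim : t₀ - (starRingEnd ℂ) t₀ = 2 * I * t₀.im := by
      apply Complex.ext <;> simp; ring
    obtain ⟨g, hgdef⟩ : ∃ g : Polynomial ℂ, g = (Polynomial.X - Polynomial.C t₀) *
      (Polynomial.X - Polynomial.C ((starRingEnd ℂ) t₀)) := ⟨_, rfl⟩
    have hgev : ∀ z, g.eval z = (z - t₀) * (z - (starRingEnd ℂ) t₀) := fun z => by
      simp [hgdef]
    have hgd : 1 ≤ g.natDegree := by
      rw [hgdef, Polynomial.natDegree_mul (Polynomial.X_sub_C_ne_zero _)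
        (Polynomial.X_sub_C_ne_zero _), Polynomial.natDegree_X_sub_C]
      exact Nat.le_add_right _ _
    have hgp : g ∣ p := by
      rw [hgdef]
      exact IsCoprime.mul_dvd (Polynomial.isCoprime_X_sub_C_of_isUnit_sub
        (isUnit_iff_ne_zero.2 (sub_ne_zero.2 (Ne.symm hreal))))
        (Polynomial.dvd_iff_isRoot.2 hroot) (Polynomial.dvd_iff_isRoot.2 hroot')
    have hgb : ∀ z : ℂ, α < ‖z‖ → ‖g.eval z‖ ≤ (‖z‖ + 1) ^ 2 := fun z _ => by
      rw [hgev, norm_mul, sq]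
      have h1 := norm_sub_le z t₀
      have h2 := norm_sub_le z ((starRingEnd ℂ) t₀)
      exact mul_le_mul (by linarith) (by linarith) (norm_nonneg _) (by positivity)
    obtain ⟨k, -, hk⟩ := Finset.exists_max_image Finset.univ (fun j => |(w j).im|)
      ⟨i, Finset.mem_univ i⟩
    have hk' : ∀ j, |(w j).im| ≤ |(w k).im| := fun j => hk j (Finset.mem_univ j)
    -- Dividing w G by t - t₀ alone would break the symmetry, while the imaginary row degenerates as
    -- t₀ and w become real; hence the comparison of imaginary parts. If Im t₀ dominates, the single
    -- row Im (w / (t - t₀)) / Im t₀ has i-th entry 1 / ((t - t₀) (t - conj t₀)) and removes both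
    -- zeros.
    by_cases hcase : |(w k).im| ≤ |t₀.im|
    · refine ⟨fun z => (G z).updateRow i (fun j => rowQuotIm w G t₀ z j / t₀.im),
        fun z => (1 : CMat n).updateRow i (fun j => rowIm w t₀ z j / t₀.im),
        isReduction_of_entries hc0 hu hp hdet hZ hZα ?_ ?_ ?_ ?_ ?_ ?_ (ς := 1) (by simp)
          (g := g) ?_ hgd hgp hgb⟩
      · intro z hz l j
        simp only [Matrix.updateRow_apply]
        split_ifs
        · exact (differentiableAt_rowIm (hZ1 z hz) (hZ2 z hz) j).div_const _
        · exact differentiableAt_const _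
      · intro z l j
        simp only [Matrix.updateRow_apply]
        split_ifs
        · rw [rowIm_conj, map_div₀, conj_ofReal]
        · exact hone' _ _
      · intro z hz l j
        simp only [Matrix.updateRow_apply]
        split_ifs
        · rw [norm_div, norm_real, Real.norm_eq_abs, div_le_iff₀ himp]
          refine (norm_rowIm_le hδ hz htα hwb j).trans ?_
          have h1 : |(w j).im| / δ ≤ |t₀.im| / δ :=
            div_le_div_of_nonneg_right ((hk' j).trans hcase) hδ.le
          calc |t₀.im| / δ ^ 2 + |(w j).im| / δ ≤ |t₀.im| / δ ^ 2 + |t₀.im| / δ := by linarith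
            _ = (1 / δ + 1 / δ ^ 2) * |t₀.im| := by ring
            _ ≤ _ := by gcongr; linarith
        · linarith [hone l j]
      · intro l j
        simp only [Matrix.updateRow_apply]
        split_ifs
        · exact hdIm w j _
        · exact hGe l j
      · intro z hz l j
        simp only [Matrix.updateRow_apply]
        split_ifs
        · rw [rowQuotIm_conj, map_div₀, conj_ofReal]
        · exact hGs z hz l j
      · intro z hz hzZ
        rw [updateRow_mul_one, rowIm_vecMul hw hs hz (hZ1 z hzZ) (hZ2 z hzZ)]
      · intro z hz
        have h1 := sub_ne_zero.2 (hZ1 z hz)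
        have h2 := sub_ne_zero.2 (hZ2 z hz)
        rw [det_one_updateRow, rowIm, hwi, map_one, hgev, div_sub_div _ _ h1 h2, one_mul, mul_one]
        have h3 : z - (starRingEnd ℂ) t₀ - (z - t₀) = 2 * I * t₀.im := by rw [← hsubim]; ring
        rw [h3]
        have hI : I ≠ 0 := I_ne_zero
        field_simp
    -- If Im w_k dominates, row i becomes the real part and row k the imaginary part divided by |Im
    -- w_k|. With x = 1 / (t - t₀) and y = w_k x, the minor Re x · Im y - Re y · Im x equals Im w_k
    -- / ((t - t₀) (t - conj t₀)), so only the sign of Im w_k is left, as ς.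
    · rw [not_le] at hcase
      have hη : 0 < |(w k).im| := himp.trans hcase
      have hηC : ((|(w k).im| : ℝ) : ℂ) ≠ 0 := ofReal_ne_zero.2 hη.ne'
      have hik : i ≠ k := by
        rintro rfl
        rw [hwi] at hη; simp at hη
      have hwsub : w k - (starRingEnd ℂ) (w k) = 2 * I * (w k).im := by
        apply Complex.ext <;> simp; ring
      refine ⟨fun z => ((G z).updateRow i (rowQuotRe w G t₀ z)).updateRow k
          (fun j => rowQuotIm w G t₀ z j / (|(w k).im| : ℝ)),
        fun z => ((1 : CMat n).updateRow i (rowRe w t₀ z)).updateRow k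
          (fun j => rowIm w t₀ z j / (|(w k).im| : ℝ)),
        isReduction_of_entries hc0 hu hp hdet hZ hZα ?_ ?_ ?_ ?_ ?_ ?_
          (ς := ((w k).im / |(w k).im| : ℝ)) ?_ (g := g) ?_ hgd hgp hgb⟩
      · intro z hz l j
        simp only [Matrix.updateRow_apply]
        split_ifs
        · exact (differentiableAt_rowIm (hZ1 z hz) (hZ2 z hz) j).div_const _
        · exact differentiableAt_rowRe (hZ1 z hz) (hZ2 z hz) j
        · exact differentiableAt_const _
      · intro z l j
        simp only [Matrix.updateRow_apply]
        split_ifs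
        · rw [rowIm_conj, map_div₀, conj_ofReal]
        · exact rowRe_conj _ _ _ _
        · exact hone' _ _
      · intro z hz l j
        simp only [Matrix.updateRow_apply]
        split_ifs
        · rw [norm_div, norm_real, Real.norm_eq_abs, abs_abs, div_le_iff₀ hη]
          refine (norm_rowIm_le hδ hz htα hwb j).trans ?_
          have h1 : |(w j).im| / δ ≤ |(w k).im| / δ :=
            div_le_div_of_nonneg_right (hk' j) hδ.le
          have h2 : |t₀.im| / δ ^ 2 ≤ |(w k).im| / δ ^ 2 :=
            div_le_div_of_nonneg_right hcase.le (by positivity)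
          calc |t₀.im| / δ ^ 2 + |(w j).im| / δ ≤ |(w k).im| / δ ^ 2 + |(w k).im| / δ := by linarith
            _ = (1 / δ + 1 / δ ^ 2) * |(w k).im| := by ring
            _ ≤ _ := by gcongr; linarith
        · linarith [norm_rowRe_le hδ hz htα hwb j]
        · linarith [hone l j]
      · intro l j
        simp only [Matrix.updateRow_apply]
        split_ifs
        · exact hdIm w j _
        · exact hdRe w j
        · exact hGe l j
      · intro z hz l j
        simp only [Matrix.updateRow_apply]
        split_ifs
        · rw [rowQuotIm_conj, map_div₀, conj_ofReal]
        · exact rowQuotRe_conj _ _ _ _ _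
        · exact hGs z hz l j
      · intro z hz hzZ
        rw [Matrix.updateRow_mul, updateRow_mul_one,
          rowIm_vecMul hw hs hz (hZ1 z hzZ) (hZ2 z hzZ),
          rowRe_vecMul hw hs hz (hZ1 z hzZ) (hZ2 z hzZ)]
      · rw [norm_real, Real.norm_eq_abs, abs_div, abs_abs, div_self hη.ne']
      · intro z hz
        have h1 := sub_ne_zero.2 (hZ1 z hz)
        have h2 := sub_ne_zero.2 (hZ2 z hz)
        have hI : I ≠ 0 := I_ne_zero
        rw [det_one_updateRow_updateRow hik, rowRe, rowRe, rowIm, rowIm, hwi, map_one, hgev]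
        have h3 : ((w k).im : ℂ) = (w k - (starRingEnd ℂ) (w k)) / (2 * I) := by
          rw [hwsub]; field_simp
        rw [ofReal_div, h3]
        field_simp
        ring

/-- Removal of all zeros of the determinant. -/
theorem exists_reduction_isUnit [NeZero n] {α β δ : ℝ} (hαβ : α < β) (hβ1 : β ≤ 1) (hδ : 0 < δ)
    {u : ℂ → ℂ} (hu : ContinuousOn u (ball 0 β)) (hu0 : ∀ z ∈ ball (0 : ℂ) β, u z ≠ 0) (m : ℕ) :
    ∀ (G : ℂ → CMat n) (p : Polynomial ℂ), DifferentiableOn ℂ G (ball 0 β) →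
      ConjSymm G (ball 0 β) → p ≠ 0 → p.natDegree ≤ m →
      (∀ z ∈ ball (0 : ℂ) β, (G z).det = u z * p.eval z) →
      (∀ z ∈ annulus α β, (G z).det ≠ 0) →
      ∃ G₁ R : ℂ → CMat n, (∀ z ∈ ball (0 : ℂ) β, IsUnit (G₁ z)) ∧
        IsReduction α β δ ((n * (1 + 1 / δ + 1 / δ ^ 2)) ^ m) (2 * m) G G₁ R := by
  have hC : 1 ≤ n * (1 + 1 / δ + 1 / δ ^ 2) := by
    have h1 : (1 : ℝ) ≤ n := by exact_mod_cast NeZero.one_le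
    have h2 : 0 ≤ 1 / δ + 1 / δ ^ 2 := by positivity
    nlinarith
  -- If the zeros run out early, the unused factors of the bounds are at least 1 and may be kept.
  have triv : ∀ m (G : ℂ → CMat n), DifferentiableOn ℂ G (ball 0 β) → ConjSymm G (ball 0 β) →
      IsReduction α β δ ((n * (1 + 1 / δ + 1 / δ ^ 2)) ^ m) (2 * m) G G (fun _ => 1) := by
    intro m G hG hs
    refine ⟨differentiableOn_const _, fun z _ => cj_one.symm, fun z _ => ?_, fun z _ => ?_,
      fun z _ => one_mul _, hG, hs⟩
    · rw [norm_one]; exact one_le_pow₀ hC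
    · rw [Matrix.det_one, norm_one, one_mul]
      exact one_le_pow₀ (by linarith [norm_nonneg z])
  induction m with
  | zero =>
    intro G p hG hs hp hm hdet hann
    refine ⟨G, fun _ => 1, fun z hz => ?_, triv 0 G hG hs⟩
    rw [CMat.isUnit_iff_det_ne, hdet z hz]
    refine mul_ne_zero (hu0 z hz) fun h => ?_
    rw [Polynomial.eq_C_of_natDegree_le_zero hm, Polynomial.eval_C] at h
    rw [Polynomial.eq_C_of_natDegree_le_zero hm, h, Polynomial.C_0] at hp
    exact hp rfl
  | succ m ih =>
    intro G p hG hs hp hm hdet hann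
    by_cases hr : ∃ t₀ ∈ ball (0 : ℂ) β, p.eval t₀ = 0
    · obtain ⟨t₀, ht₀, hroot⟩ := hr
      obtain ⟨G₁, R₁, p₁, hp₁, hdeg, hdet₁, hred⟩ := exists_reduction_step hαβ hβ1 hδ hG hs hu hu0
        hp hdet hann ht₀ hroot
      obtain ⟨G₂, R₂, hunit, hred₂⟩ := ih G₁ p₁ hred.diff hred.symm hp₁ (by omega) hdet₁ (by
        intro z hz
        rw [← hred.mul_eq z hz, Matrix.det_mul]
        refine mul_ne_zero (fun h => ?_) (hann z hz)
        have := hred.det_R z hz.1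
        rw [h, norm_zero, zero_mul] at this
        linarith)
      refine ⟨G₂, fun z => R₂ z * R₁ z, hunit, ?_⟩
      have := hred.trans hred₂ (by positivity)
      rwa [← pow_succ, ← mul_add_one] at this
    · refine ⟨G, fun _ => 1, fun z hz => ?_, triv (m + 1) G hG hs⟩
      rw [CMat.isUnit_iff_det_ne, hdet z hz]
      exact mul_ne_zero (hu0 z hz) fun h => hr ⟨z, hz, h⟩

end Elimination

end

noncomputable section

open Complex Metric

/-! ### Quantitative factorization with a pole at infinity. -/

section Gauge

variable {n : ℕ}

lemma natDegree_det_le {P : Matrix (Fin n) (Fin n) (Polynomial ℂ)} {m : ℕ}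
    (h : ∀ i j, (P i j).natDegree ≤ m) : P.det.natDegree ≤ n * m := by
  rw [Matrix.det_apply]
  refine Polynomial.natDegree_sum_le_of_forall_le _ _ fun σ _ => ?_
  refine (Polynomial.natDegree_smul_le _ _).trans ((Polynomial.natDegree_prod_le _ _).trans ?_)
  refine (Finset.sum_le_sum fun i _ => h (σ i) i).trans ?_
  simp

lemma exists_det_matPoly (c : ℕ → CMat n) (N : ℕ) :
    ∃ p : Polynomial ℂ, p.natDegree ≤ n * N ∧ ∀ z, (matPoly c N z).det = p.eval z := by
  let P : Matrix (Fin n) (Fin n) (Polynomial ℂ) := fun i j =>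
    ∑ k ∈ Finset.range N, Polynomial.C (c k i j) * Polynomial.X ^ k
  refine ⟨P.det, natDegree_det_le fun i j => ?_, fun z => ?_⟩
  · refine Polynomial.natDegree_sum_le_of_forall_le _ _ fun k hk => ?_
    exact (Polynomial.natDegree_C_mul_X_pow_le _ _).trans (Finset.mem_range.1 hk).le
  · have hP : (Polynomial.evalRingHom z).mapMatrix P = matPoly c N z := by
      ext i j
      rw [RingHom.mapMatrix_apply, Matrix.map_apply, Polynomial.coe_evalRingHom, matPoly,
        Matrix.sum_apply, Polynomial.eval_finsetSum]
      exact Finset.sum_congr rfl fun k _ => by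
        rw [Polynomial.eval_mul, Polynomial.eval_C, Polynomial.eval_pow, Polynomial.eval_X,
          Matrix.smul_apply, smul_eq_mul, mul_comm]
    rw [← hP, ← RingHom.map_det, Polynomial.coe_evalRingHom]

lemma norm_inv_le_two [NeZero n] {M : CMat n} (h : ‖M - 1‖ ≤ 1 / 2) : ‖M⁻¹‖ ≤ 2 := by
  have hu := isUnit_of_norm_sub_one_le h
  have h1 : M⁻¹ = 1 - (M - 1) * M⁻¹ := by
    rw [sub_mul, CMat.mul_inv hu, one_mul, sub_sub_cancel]
  have h2 : ‖M⁻¹‖ ≤ 1 + 1 / 2 * ‖M⁻¹‖ := by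
    calc ‖M⁻¹‖ = ‖1 - (M - 1) * M⁻¹‖ := by rw [← h1]
      _ ≤ ‖(1 : CMat n)‖ + ‖(M - 1) * M⁻¹‖ := norm_sub_le _ _
      _ ≤ 1 + 1 / 2 * ‖M⁻¹‖ := by
        rw [norm_one]
        gcongr
        exact (norm_mul_le _ _).trans (by gcongr)
  linarith

lemma norm_le_three_halves [NeZero n] {M : CMat n} (h : ‖M - 1‖ ≤ 1 / 2) : ‖M‖ ≤ 3 / 2 := by
  have := norm_add_le (M - 1) 1
  rw [sub_add_cancel, norm_one] at this
  linarith

/-- The norm bound of the elimination factor. -/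
def elimBound (n N : ℕ) (d : ℝ) : ℝ := (n * (1 + 1 / (d / 4) + 1 / (d / 4) ^ 2)) ^ (n * (2 * N))

/-- The norm bound of the inverse of the elimination factor, up to a power of `|z| + 1`. -/
def elimInvBound (n N : ℕ) (d : ℝ) : ℝ := n * (n.factorial * (1 + elimBound n N d) ^ n)

lemma elimBound_nonneg (n N : ℕ) {d : ℝ} (hd : 0 ≤ d) : 0 ≤ elimBound n N d := by
  unfold elimBound; positivity

lemma elimInvBound_nonneg (n N : ℕ) {d : ℝ} (hd : 0 ≤ d) : 0 ≤ elimInvBound n N d := by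
  have := elimBound_nonneg n N hd
  unfold elimInvBound; positivity

/-- Quantitative left factorization `F = G⁻¹ E` of an invertible matrix function in an annulus,
with `E` having a pole at infinity. -/
theorem exists_gauge [NeZero n] {α β d : ℝ} (hα : 0 ≤ α) (hd : 0 < d)
    (hβ : β = α + 4 * d) (hβ1 : β ≤ 1) {F : ℂ → CMat n}
    (hF : DifferentiableOn ℂ F (annulus α β)) (hFu : ∀ z ∈ annulus α β, IsUnit (F z))
    (hsym : ConjSymm F (annulus α β)) {κ : ℝ} (hκ : ∀ z ∈ annulus α β, ‖F z‖ ≤ κ)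
    (hκ' : ∀ z ∈ annulus α β, ‖(F z)⁻¹‖ ≤ κ) {N : ℕ}
    (hN : (1 + 4 / d) * (4 * κ / d * (1 - d / 2) ^ N * κ) ≤ 1 / 4) :
    ∃ G E : ℂ → CMat n,
      DifferentiableOn ℂ G (ball 0 (α + 5 / 2 * d)) ∧
      (∀ z ∈ ball (0 : ℂ) (α + 5 / 2 * d), IsUnit (G z)) ∧
      ConjSymm G (ball 0 (α + 5 / 2 * d)) ∧
      DifferentiableOn ℂ E (exterior (α + 3 / 2 * d)) ∧
      (∀ z ∈ exterior (α + 3 / 2 * d), IsUnit (E z)) ∧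
      ConjSymm E (exterior (α + 3 / 2 * d)) ∧
      (∀ z ∈ annulus (α + 3 / 2 * d) (α + 5 / 2 * d), G z * F z = E z) ∧
      (∀ z ∈ annulus (α + 7 / 4 * d) (α + 5 / 2 * d), ‖G z‖ ≤ elimBound n N d * (3 / 2) * κ) ∧
      (∀ z ∈ annulus (α + 7 / 4 * d) (α + 5 / 2 * d),
        ‖(G z)⁻¹‖ ≤ κ * (2 * (elimInvBound n N d * 2 ^ (2 * (n * (2 * N)))) / d ^ N)) ∧
      ∃ c : ℝ, ∀ z : ℂ, 1 ≤ ‖z‖ → ‖E z‖ ≤ c * ‖z‖ ^ N ∧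
        ‖(E z)⁻¹‖ ≤ c * ‖z‖ ^ (2 * (n * (2 * N))) := by
  obtain ⟨c, G₀, E₀, hc, hG₀, hE₀, hG₀b, hE₀b, hG₀s, hE₀s, hGE⟩ :=
    exists_left_quotient hα hd hβ hβ1 hF hFu hsym hκ hκ' hN
  obtain ⟨α', hα'⟩ : ∃ α', α' = α + 3 / 2 * d := ⟨_, rfl⟩
  obtain ⟨β', hβ'⟩ : ∃ β', β' = α + 5 / 2 * d := ⟨_, rfl⟩
  simp only [← hα', ← hβ'] at hG₀ hE₀ hG₀b hE₀b hGE ⊢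
  have hαβ : α' < β' := by linarith
  have hβ'1 : β' ≤ 1 := by linarith
  have hsub : annulus α' β' ⊆ annulus α β := fun z hz => ⟨by linarith [hz.1], by linarith [hz.2]⟩
  have hext0 : ∀ z ∈ exterior α', z ≠ 0 := fun z hz => by
    have : α' < ‖z‖ := hz
    exact norm_pos_iff.1 (by linarith)
  obtain ⟨p, hpd, hpe⟩ := exists_det_matPoly c (2 * N)
  have hE₀u : ∀ z ∈ exterior α', IsUnit (E₀ z) := fun z hz => isUnit_of_norm_sub_one_le (hE₀b z hz)
  have hG₁ann : ∀ z ∈ annulus α' β', (G₀ z * matPoly c (2 * N) z).det ≠ 0 := by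
    intro z hz h0
    have h1 := congrArg Matrix.det (hGE z hz)
    rw [Matrix.det_mul, h0, zero_mul, Matrix.det_smul] at h1
    exact mul_ne_zero (pow_ne_zero _ (pow_ne_zero _ (hext0 z hz.1)))
      (CMat.isUnit_iff_det_ne.1 (hE₀u z hz.1)) h1.symm
  have hp0 : p ≠ 0 := by
    rintro rfl
    have hm : (((α' + β') / 2 : ℝ) : ℂ) ∈ annulus α' β' := by
      constructor <;> rw [norm_real, Real.norm_of_nonneg (by linarith)] <;> linarith
    refine hG₁ann _ hm ?_
    rw [Matrix.det_mul, hpe]; simp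
  -- The degree of the determinant, at most n · 2N, bounds the number of eliminations. R is bounded
  -- only at distance d / 4 from its domain's inner circle, so the estimates start at α + 7/4 d.
  obtain ⟨G, R, hGu, hred⟩ := exists_reduction_isUnit hαβ hβ'1 (by linarith : 0 < d / 4)
    (CMat.continuousOn_det hG₀.continuousOn)
    (fun z hz => CMat.isUnit_iff_det_ne.1 (isUnit_of_norm_sub_one_le (hG₀b z hz)))
    (n * (2 * N)) (fun z => G₀ z * matPoly c (2 * N) z) p
    (hG₀.mul (differentiable_matPoly c _).differentiableOn)
    (fun z hz => by simp only [hG₀s, matPoly_conj hc, cj_mul]) hp0 hpd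
    (fun z hz => by rw [Matrix.det_mul, hpe]) hG₁ann
  have hRu : ∀ z ∈ exterior α', IsUnit (R z) := by
    intro z hz
    rw [CMat.isUnit_iff_det_ne]
    intro h
    have := hred.det_R z hz
    rw [h, norm_zero, zero_mul] at this
    linarith
  have hRb : ∀ z : ℂ, α' + d / 4 ≤ ‖z‖ → ‖R z‖ ≤ elimBound n N d := hred.norm_R
  have hRinv : ∀ z : ℂ, α' + d / 4 ≤ ‖z‖ →
      ‖(R z)⁻¹‖ ≤ elimInvBound n N d * (‖z‖ + 1) ^ (2 * (n * (2 * N))) := by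
    intro z hz
    have hz' : z ∈ exterior α' := show α' < ‖z‖ by linarith
    have hdet := hred.det_R z hz'
    have hpos : 0 < ‖(R z).det‖ := norm_pos_iff.2 (CMat.isUnit_iff_det_ne.1 (hRu z hz'))
    refine (CMat.norm_inv_le _).trans ?_
    rw [div_le_iff₀ hpos, mul_assoc, mul_comm _ ‖(R z).det‖]
    have h1 : n * (n.factorial * (1 + ‖R z‖) ^ n) ≤ elimInvBound n N d := by
      unfold elimInvBound
      have := hRb z hz
      gcongr
    exact h1.trans (le_mul_of_one_le_right (elimInvBound_nonneg n N hd.le) hdet)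
  have hEinv : ∀ z ∈ exterior α', (z ^ N • (R z * E₀ z))⁻¹ = (z ^ N)⁻¹ • ((E₀ z)⁻¹ * (R z)⁻¹) := by
    intro z hz
    symm
    apply CMat.eq_inv_of_mul_eq_one
    rw [smul_mul_smul_comm, mul_inv_cancel₀ (pow_ne_zero _ (hext0 z hz)), one_smul, mul_assoc,
      ← mul_assoc (E₀ z), CMat.mul_inv (hE₀u z hz), one_mul, CMat.mul_inv (hRu z hz)]
  have hGF : ∀ z ∈ annulus α' β', G z * F z = z ^ N • (R z * E₀ z) := by
    intro z hz
    rw [← hred.mul_eq z hz, mul_assoc, hGE z hz, mul_smul_comm]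
  have hEu : ∀ z ∈ exterior α', IsUnit (z ^ N • (R z * E₀ z)) := by
    intro z hz
    have h1 := (hRu z hz).mul (hE₀u z hz)
    rw [CMat.isUnit_iff_det_ne] at h1 ⊢
    rw [Matrix.det_smul]
    exact mul_ne_zero (pow_ne_zero _ (pow_ne_zero _ (hext0 z hz))) h1
  have hEn : ∀ z : ℂ, α' + d / 4 ≤ ‖z‖ →
      ‖z ^ N • (R z * E₀ z)‖ ≤ ‖z‖ ^ N * (elimBound n N d * (3 / 2)) := by
    intro z hz
    rw [norm_smul, norm_pow]
    have hz' : z ∈ exterior α' := show α' < ‖z‖ by linarith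
    refine mul_le_mul_of_nonneg_left ((norm_mul_le _ _).trans ?_) (by positivity)
    exact mul_le_mul (hRb z hz) (norm_le_three_halves (hE₀b z hz')) (norm_nonneg _)
      (elimBound_nonneg n N hd.le)
  have hEin : ∀ z : ℂ, α' + d / 4 ≤ ‖z‖ → ‖(z ^ N • (R z * E₀ z))⁻¹‖ ≤
      2 * (elimInvBound n N d * (‖z‖ + 1) ^ (2 * (n * (2 * N)))) / ‖z‖ ^ N := by
    intro z hz
    have hz' : z ∈ exterior α' := show α' < ‖z‖ by linarith
    rw [hEinv z hz', norm_smul, norm_inv, norm_pow, ← div_eq_inv_mul]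
    refine div_le_div_of_nonneg_right ((norm_mul_le _ _).trans ?_) (by positivity)
    exact mul_le_mul (norm_inv_le_two (hE₀b z hz')) (hRinv z hz) (norm_nonneg _) (by norm_num)
  have hEI0 := elimInvBound_nonneg n N hd.le
  have hE0 := elimBound_nonneg n N hd.le
  refine ⟨G, fun z => z ^ N • (R z * E₀ z), hred.diff, hGu, hred.symm, ?_, hEu, ?_, hGF, ?_, ?_,
    elimBound n N d * (3 / 2) + 2 * (elimInvBound n N d * 2 ^ (2 * (n * (2 * N)))), ?_⟩
  · exact (differentiable_id.pow N).differentiableOn.smul (hred.diff_R.mul hE₀)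
  · intro z hz
    simp only [hred.symm_R z hz, hE₀s, cj_smul, cj_mul, map_pow]
  · intro z hz
    have hz1 : α + 7 / 4 * d < ‖z‖ := hz.1
    have hz2 : ‖z‖ < β' := hz.2
    have hm : z ∈ annulus α' β' := ⟨by linarith, hz2⟩
    -- The construction does not bound G directly: on the annulus the bound comes from G = E F⁻¹,
    -- and that of the inverse from F E⁻¹.
    have h1 : G z = (z ^ N • (R z * E₀ z)) * (F z)⁻¹ := by
      rw [← hGF z hm, mul_assoc, CMat.mul_inv (hFu z (hsub hm)), mul_one]
    rw [h1]
    refine (norm_mul_le _ _).trans (mul_le_mul ((hEn z (by linarith)).trans ?_)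
      (hκ' z (hsub hm)) (norm_nonneg _) (by positivity))
    exact mul_le_of_le_one_left (by positivity) (pow_le_one₀ (norm_nonneg _) (by linarith))
  · intro z hz
    have hz1 : α + 7 / 4 * d < ‖z‖ := hz.1
    have hz2 : ‖z‖ < β' := hz.2
    have hm : z ∈ annulus α' β' := ⟨by linarith, hz2⟩
    have h1 : (G z)⁻¹ = F z * (z ^ N • (R z * E₀ z))⁻¹ := by
      symm
      apply CMat.eq_inv_of_mul_eq_one
      rw [← mul_assoc, hGF z hm, CMat.mul_inv (hEu z hm.1)]
    rw [h1]
    refine (norm_mul_le _ _).trans (mul_le_mul (hκ z (hsub hm)) ((hEin z (by linarith)).trans ?_)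
      (norm_nonneg _) ((norm_nonneg _).trans (hκ z (hsub hm))))
    have h2 : d ≤ ‖z‖ := by linarith
    have h3 : ‖z‖ + 1 ≤ 2 := by linarith
    gcongr
  -- The constant is hidden by the existential quantifier: of the growth at infinity only the
  -- exponents enter the final bounds.
  · intro z hz
    have hza : α' + d / 4 ≤ ‖z‖ := by linarith
    have hz0 : 0 < ‖z‖ := by linarith
    constructor
    · refine (hEn z hza).trans ?_
      rw [mul_comm]
      gcongr
      exact le_add_of_nonneg_right (by positivity)
    · refine (hEin z hza).trans ?_
      refine (div_le_self (by positivity) (one_le_pow₀ hz)).trans ?_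
      have h3 : (‖z‖ + 1) ^ (2 * (n * (2 * N))) ≤
          2 ^ (2 * (n * (2 * N))) * ‖z‖ ^ (2 * (n * (2 * N))) := by
        rw [← mul_pow]; gcongr; linarith
      calc 2 * (elimInvBound n N d * (‖z‖ + 1) ^ (2 * (n * (2 * N))))
          ≤ 2 * (elimInvBound n N d * (2 ^ (2 * (n * (2 * N))) * ‖z‖ ^ (2 * (n * (2 * N))))) := by
            gcongr
        _ = 2 * (elimInvBound n N d * 2 ^ (2 * (n * (2 * N)))) * ‖z‖ ^ (2 * (n * (2 * N))) := by
            ring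
        _ ≤ _ := by
            gcongr
            exact le_add_of_nonneg_left (by positivity)

end Gauge

end

noncomputable section

open Complex Metric

/-! ### Real logarithms of matrices, with bounds. -/

section MatrixLog

variable {n : ℕ}

/-- A chord of the unit circle has length 2 |sin (x / 2)|, and Jordan's inequality bounds the sine
from below. -/
lemma norm_exp_sub_exp_ge {a b : ℝ} (h : |a - b| ≤ 1) :
    |a - b| / 2 ≤ ‖Complex.exp (a * I) - Complex.exp (b * I)‖ := by
  have h1 : Complex.exp (a * I) - Complex.exp (b * I) =
      Complex.exp (b * I) * (Complex.exp (I * (a - b : ℝ)) - 1) := by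
    rw [mul_sub, ← Complex.exp_add, mul_one]
    congr 2
    push_cast; ring
  rw [h1, norm_mul, norm_exp_ofReal_mul_I, one_mul, norm_exp_I_mul_ofReal_sub_one, norm_mul,
    Real.norm_eq_abs, Real.norm_eq_abs]
  have h2 := Real.mul_abs_le_abs_sin (x := (a - b) / 2) (by
    rw [abs_div, abs_two]; linarith [Real.pi_gt_three])
  rw [abs_div, abs_two] at h2
  have h3 : 1 / 2 ≤ 2 / Real.pi := by
    rw [div_le_div_iff₀ two_pos Real.pi_pos]; linarith [Real.pi_le_four]
  rw [abs_two]
  nlinarith [abs_nonneg (a - b)]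

/-- Among finitely many directions there is a well separated opposite direction. -/
lemma exists_separated_angle (s : Finset ℂ) :
    ∃ θ : ℝ, 0 ≤ θ ∧ θ ≤ 1 ∧
      ∀ z ∈ s, 1 / (4 * ((s.card : ℝ) + 1)) ≤ ‖z + Complex.exp (θ * I)‖ := by
  by_contra hcon
  push Not at hcon
  obtain ⟨c, hc⟩ : ∃ c : ℝ, c = (s.card : ℝ) + 1 := ⟨_, rfl⟩
  have hc0 : 0 < c := by rw [hc]; positivity
  rw [← hc] at hcon
  -- Pigeonhole: two of the card + 1 angles k / c would be close to the antipode of the same z, so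
  -- their points on the circle would be closer than 1 / (2 c), a lower bound for the distance
  -- between distinct ones.
  have hθ : ∀ k ∈ Finset.range (s.card + 1), ∃ z ∈ s,
      ‖z + Complex.exp (((k : ℝ) / c : ℝ) * I)‖ < 1 / (4 * c) := fun k hk =>
    hcon (k / c) (by positivity) (by
      rw [div_le_one hc0, hc]
      have : k ≤ s.card + 1 := (Finset.mem_range.1 hk).le
      exact_mod_cast this)
  choose! f hf1 hf2 using hθ
  obtain ⟨k, hk, l, hl, hkl, hfe⟩ := Finset.exists_ne_map_eq_of_card_lt_of_maps_to
    (s := Finset.range (s.card + 1)) (t := s) (by simp) hf1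
  have e1 := hf2 k hk
  have e2 := hf2 l hl
  rw [hfe] at e1
  have hkl' : (1 : ℝ) ≤ |(k : ℝ) - l| := by
    have : (k : ℤ) - l ≠ 0 := sub_ne_zero.2 (by exact_mod_cast hkl)
    exact_mod_cast Int.one_le_abs this
  have hkl2 : |(k : ℝ) - l| ≤ c := by
    have h1 : (k : ℝ) < s.card + 1 := by exact_mod_cast Finset.mem_range.1 hk
    have h2 : (l : ℝ) < s.card + 1 := by exact_mod_cast Finset.mem_range.1 hl
    have h3 : (0 : ℝ) ≤ k := Nat.cast_nonneg _
    have h4 : (0 : ℝ) ≤ l := Nat.cast_nonneg _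
    rw [abs_le, hc]; constructor <;> linarith
  have hd : |(k : ℝ) / c - l / c| = |(k : ℝ) - l| / c := by
    rw [← sub_div, abs_div, abs_of_pos hc0]
  have e3 := norm_exp_sub_exp_ge (a := k / c) (b := l / c) (by rw [hd, div_le_one hc0]; exact hkl2)
  rw [hd] at e3
  have e4 : ‖Complex.exp (((k : ℝ) / c : ℝ) * I) - Complex.exp (((l : ℝ) / c : ℝ) * I)‖ ≤
      ‖f l + Complex.exp (((k : ℝ) / c : ℝ) * I)‖ + ‖f l + Complex.exp (((l : ℝ) / c : ℝ) * I)‖ := by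
    have := norm_sub_le (f l + Complex.exp (((k : ℝ) / c : ℝ) * I))
      (f l + Complex.exp (((l : ℝ) / c : ℝ) * I))
    rwa [add_sub_add_left_eq_sub] at this
  have e5 : 1 / (4 * c) + 1 / (4 * c) = 1 / c / 2 := by field_simp; norm_num
  have e6 : 1 / c / 2 ≤ |(k : ℝ) - l| / c / 2 := by gcongr
  linarith

/-- A + B ω and B + A ω have equal moduli by reflection, and their sum is (A + B) (1 + ω). -/
lemma norm_add_mul_ge {ω : ℂ} (hω : ‖ω‖ = 1) (A B : ℝ) :
    (A + B) * (‖1 + ω‖ / 2) ≤ ‖(A : ℂ) + B * ω‖ := by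
  have h1 : ‖(B : ℂ) + A * ω‖ = ‖(A : ℂ) + B * ω‖ := by
    have h2 : (B : ℂ) + A * ω = ω * (starRingEnd ℂ) ((A : ℂ) + B * ω) := by
      have : ω * (starRingEnd ℂ) ω = 1 := by rw [mul_conj, normSq_eq_norm_sq, hω]; simp
      rw [map_add, map_mul, conj_ofReal, conj_ofReal, mul_add, mul_left_comm, this]; ring
    rw [h2, norm_mul, hω, one_mul, RCLike.norm_conj]
  have h3 : ((A + B : ℝ) : ℂ) * (1 + ω) = ((A : ℂ) + B * ω) + ((B : ℂ) + A * ω) := by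
    push_cast; ring
  have h4 := norm_add_le ((A : ℂ) + B * ω) ((B : ℂ) + A * ω)
  rw [← h3, norm_mul, norm_real, h1] at h4
  have h5 : (A + B) * ‖1 + ω‖ ≤ ‖A + B‖ * ‖1 + ω‖ :=
    mul_le_mul_of_nonneg_right (Real.le_norm_self _) (norm_nonneg _)
  linarith

lemma det_smul_one_add_smul (M : CMat n) (a b : ℂ) :
    (a • (1 : CMat n) + b • M).det = (M.charpoly.roots.map fun z => a + b * z).prod := by
  have hcard : M.charpoly.roots.card = n := by
    rw [← (IsAlgClosed.splits M.charpoly).natDegree_eq_card_roots, Matrix.charpoly_natDegree_eq_dim,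
      Fintype.card_fin]
  by_cases hb : b = 0
  · simp [hb, hcard]
  · have h1 : a • (1 : CMat n) + b • M = (-b) • (Matrix.scalar (Fin n) (-a / b) - M) := by
      rw [smul_sub, neg_smul b M, sub_neg_eq_add]
      congr 1
      ext i j
      by_cases hij : i = j
      · subst hij; simp; field_simp
      · simp [hij]
    rw [h1, Matrix.det_smul, Fintype.card_fin, ← Matrix.eval_charpoly,
      (IsAlgClosed.splits M.charpoly).eval_eq_prod_roots_of_monic (Matrix.charpoly_monic M)]
    have h2 : ∀ s : Multiset ℂ, (-b) ^ s.card * (s.map fun z => -a / b - z).prod =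
        (s.map fun z => a + b * z).prod := fun s => by
      induction s using Multiset.induction with
      | empty => simp
      | cons z s ih =>
        rw [Multiset.card_cons, Multiset.map_cons, Multiset.map_cons, Multiset.prod_cons,
          Multiset.prod_cons, ← ih]
        field_simp
        ring
    have h3 := h2 M.charpoly.roots
    rwa [hcard] at h3

lemma pow_card_le_norm_prod (s : Multiset ℂ) {c : ℝ} (hc : 0 ≤ c) (h : ∀ z ∈ s, c ≤ ‖z‖) :
    c ^ s.card ≤ ‖s.prod‖ := by
  induction s using Multiset.induction with
  | empty => simp
  | cons a s ih =>
    rw [Multiset.card_cons, Multiset.prod_cons, norm_mul, pow_succ, mul_comm]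
    exact mul_le_mul (h a (Multiset.mem_cons_self _ _))
      (ih fun z hz => h z (Multiset.mem_cons_of_mem hz)) (by positivity) (norm_nonneg _)

/-- If κ |z| < 1, then 1 - z M⁻¹ is invertible by the Neumann series, so z is not an eigenvalue. -/
lemma norm_eigenvalue_ge [NeZero n] {M : CMat n} (hM : IsUnit M) {κ : ℝ} (hκ : ‖M⁻¹‖ ≤ κ) {z : ℂ}
    (hz : z ∈ M.charpoly.roots) : 1 ≤ κ * ‖z‖ := by
  by_contra hcon
  rw [not_le] at hcon
  have h1 : ‖z • M⁻¹‖ < 1 := by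
    rw [norm_smul, mul_comm]
    exact (mul_le_mul_of_nonneg_right hκ (norm_nonneg _)).trans_lt hcon
  have h2 := (isUnit_one_sub_of_norm_lt_one h1).mul hM
  rw [sub_mul, smul_mul_assoc, CMat.inv_mul hM, one_mul, CMat.isUnit_iff_det_ne] at h2
  apply h2
  have h3 : M - z • (1 : CMat n) = (-z) • (1 : CMat n) + (1 : ℂ) • M := by
    rw [neg_smul, one_smul]; abel
  rw [h3, det_smul_one_add_smul, Multiset.prod_eq_zero_iff, Multiset.mem_map]
  exact ⟨z, hz, by ring⟩

/-- The norm bound of the resolvent along the segment from `1` to a rotated matrix. -/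
def resolventBound (n : ℕ) (κ : ℝ) : ℝ :=
  n * (n.factorial * (2 + κ) ^ n) * (8 * ((n : ℝ) + 1) * κ) ^ n

/-- After a suitable rotation no eigenvalue direction is close to -1, so the segment from 1 to the
rotated matrix avoids the singular matrices. Each factor of the determinant is at least (1 / κ) · (1
/ (4 (n + 1))) / 2, which explains 8 (n + 1) κ in `resolventBound`. -/
lemma exists_angle_segment [NeZero n] {M : CMat n} (hM : IsUnit M) {κ : ℝ} (hκ1 : 1 ≤ κ)
    (hκ : ‖M‖ ≤ κ) (hκ' : ‖M⁻¹‖ ≤ κ) :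
    ∃ θ : ℝ, 0 ≤ θ ∧ θ ≤ 1 ∧ ∀ x ∈ Set.Icc (0 : ℝ) 1,
      IsUnit (((1 - x : ℝ) : ℂ) • (1 : CMat n) + (x : ℂ) • Complex.exp (-θ * I) • M) ∧
      ‖(((1 - x : ℝ) : ℂ) • (1 : CMat n) + (x : ℂ) • Complex.exp (-θ * I) • M)⁻¹‖ ≤
        resolventBound n κ := by
  have hκ0 : 0 < κ := by linarith
  have hcard : M.charpoly.roots.card = n := by
    rw [← (IsAlgClosed.splits M.charpoly).natDegree_eq_card_roots, Matrix.charpoly_natDegree_eq_dim,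
      Fintype.card_fin]
  obtain ⟨θ, hθ0, hθ1, hθ⟩ :=
    exists_separated_angle ((M.charpoly.roots.map fun z => z / (‖z‖ : ℂ)).toFinset)
  have hcard' : (((M.charpoly.roots.map fun z => z / (‖z‖ : ℂ)).toFinset.card : ℝ)) ≤ n := by
    have := Multiset.toFinset_card_le (M.charpoly.roots.map fun z => z / (‖z‖ : ℂ))
    rw [Multiset.card_map, hcard] at this
    exact_mod_cast this
  refine ⟨θ, hθ0, hθ1, fun x hx => ?_⟩
  have hc0 : 0 ≤ 1 / (8 * ((n : ℝ) + 1) * κ) := by positivity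
  have hdet : (1 / (8 * ((n : ℝ) + 1) * κ)) ^ n ≤
      ‖(((1 - x : ℝ) : ℂ) • (1 : CMat n) + (x : ℂ) • Complex.exp (-θ * I) • M).det‖ := by
    rw [smul_smul, det_smul_one_add_smul]
    have := pow_card_le_norm_prod (M.charpoly.roots.map fun z =>
      ((1 - x : ℝ) : ℂ) + x * Complex.exp (-θ * I) * z) hc0 ?_
    · rwa [Multiset.card_map, hcard] at this
    intro y hy
    obtain ⟨z, hz, rfl⟩ := Multiset.mem_map.1 hy
    have hz1 := norm_eigenvalue_ge hM hκ' hz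
    have hznorm : 0 < ‖z‖ := by
      by_contra h
      have : ‖z‖ = 0 := le_antisymm (not_lt.1 h) (norm_nonneg _)
      rw [this, mul_zero] at hz1; linarith
    have hzn : (‖z‖ : ℂ) ≠ 0 := ofReal_ne_zero.2 hznorm.ne'
    have hsep := hθ (z / ‖z‖) (Multiset.mem_toFinset.2 (Multiset.mem_map_of_mem _ hz))
    have hsep' : 1 / (4 * ((n : ℝ) + 1)) ≤ ‖z / ‖z‖ + Complex.exp (θ * I)‖ :=
      le_trans (by gcongr) hsep
    have hω : ‖Complex.exp (-θ * I) * (z / ‖z‖)‖ = 1 := by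
      rw [norm_mul, norm_div, norm_real, norm_norm, div_self hznorm.ne', mul_one, ← ofReal_neg,
        norm_exp_ofReal_mul_I]
    have h1 := norm_add_mul_ge hω (1 - x) (x * ‖z‖)
    have h2 : ‖1 + Complex.exp (-θ * I) * (z / ‖z‖)‖ = ‖z / ‖z‖ + Complex.exp (θ * I)‖ := by
      have : 1 + Complex.exp (-θ * I) * (z / ‖z‖) =
          Complex.exp (-θ * I) * (z / ‖z‖ + Complex.exp (θ * I)) := by
        rw [mul_add, ← Complex.exp_add, neg_mul, neg_add_cancel, Complex.exp_zero, add_comm]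
      rw [this, norm_mul, ← ofReal_neg, norm_exp_ofReal_mul_I, one_mul]
    have h3 : ((1 - x : ℝ) : ℂ) + ((x * ‖z‖ : ℝ) : ℂ) * (Complex.exp (-θ * I) * (z / ‖z‖)) =
        ((1 - x : ℝ) : ℂ) + x * Complex.exp (-θ * I) * z := by
      push_cast; field_simp
    rw [h3, h2] at h1
    refine le_trans ?_ h1
    have h4 : 1 / κ ≤ 1 - x + x * ‖z‖ := by
      have h5 : 1 / κ ≤ ‖z‖ := by rw [div_le_iff₀ hκ0]; linarith
      have h6 : 1 / κ ≤ 1 := by rw [div_le_one hκ0]; exact hκ1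
      nlinarith [hx.1, hx.2]
    calc 1 / (8 * ((n : ℝ) + 1) * κ) = 1 / κ * (1 / (4 * ((n : ℝ) + 1)) / 2) := by
          field_simp; norm_num
      _ ≤ _ := by gcongr; exact le_trans (by positivity) h4
  have hpos : 0 < (1 / (8 * ((n : ℝ) + 1) * κ)) ^ n := by positivity
  refine ⟨CMat.isUnit_iff_det_ne.2 (norm_pos_iff.1 (hpos.trans_le hdet)), ?_⟩
  refine (CMat.norm_inv_le _).trans ?_
  have hnorm : ‖((1 - x : ℝ) : ℂ) • (1 : CMat n) + (x : ℂ) • Complex.exp (-θ * I) • M‖ ≤ 1 + κ := by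
    refine (norm_add_le _ _).trans ?_
    rw [norm_smul, norm_smul, norm_smul, norm_one, ← ofReal_neg, norm_exp_ofReal_mul_I, norm_real,
      norm_real, Real.norm_of_nonneg hx.1, Real.norm_of_nonneg (by linarith [hx.2])]
    nlinarith [hx.1, hx.2, norm_nonneg M]
  unfold resolventBound
  rw [div_le_iff₀ (hpos.trans_le hdet)]
  calc (n : ℝ) * (n.factorial * (1 + ‖((1 - x : ℝ) : ℂ) • (1 : CMat n) +
        (x : ℂ) • Complex.exp (-θ * I) • M‖) ^ n)
      ≤ n * (n.factorial * (2 + κ) ^ n) :=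
        mul_le_mul_of_nonneg_left (mul_le_mul_of_nonneg_left
          (pow_le_pow_left₀ (by positivity) (by linarith) n) (by positivity)) (by positivity)
    _ = n * (n.factorial * (2 + κ) ^ n) * (8 * ((n : ℝ) + 1) * κ) ^ n *
        (1 / (8 * ((n : ℝ) + 1) * κ)) ^ n := by
      rw [mul_assoc (_ * _) (_ ^ n), ← mul_pow, mul_one_div_cancel (by positivity), one_pow, mul_one]
    _ ≤ _ := by gcongr

lemma CMat.exp_smul_one (c : ℂ) : NormedSpace.exp (c • (1 : CMat n)) = Complex.exp c • 1 := by
  rw [Matrix.smul_one_eq_diagonal, Matrix.exp_diagonal, Matrix.smul_one_eq_diagonal,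
    Complex.exp_eq_exp_ℂ]
  congr 1
  funext i
  exact Pi.coe_exp _ i

/-- Commutation moves the differentiation to the origin, where the derivative of the exponential is
the identity. -/
lemma hasDerivAt_exp_of_commute {f : ℝ → CMat n} {f' : CMat n} {x : ℝ} (hf : HasDerivAt f f' x)
    (hc : ∀ y, Commute (f x) (f y)) :
    HasDerivAt (fun y => NormedSpace.exp (f y)) (NormedSpace.exp (f x) * f') x := by
  have h1 : ∀ y, NormedSpace.exp (f y) = NormedSpace.exp (f x) * NormedSpace.exp (f y - f x) :=
    fun y => by
      rw [← Matrix.exp_add_of_commute _ _ ((hc y).sub_right (Commute.refl _)), add_sub_cancel]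
  rw [funext h1]
  have h2 : HasDerivAt (fun y => f y - f x) f' x := hf.sub_const _
  have h3 : HasFDerivAt (NormedSpace.exp : CMat n → CMat n)
      (1 : CMat n →L[ℝ] CMat n) (f x - f x) := by
    rw [sub_self]
    exact hasFDerivAt_exp_zero (𝕂 := ℝ) (𝔸 := CMat n)
  exact (h3.comp_hasDerivAt x h2).const_mul _

/-- Entrywise conjugation as a continuous real-linear map. -/
def cjCLM (n : ℕ) : CMat n →L[ℝ] CMat n where
  toFun := cj
  map_add' := cj_add
  map_smul' c M := by
    ext i j
    simp [cj_apply]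
  cont := continuous_cj

/-- A matrix with well-placed spectrum is the exponential of a path integral of resolvents. -/
lemma exists_log_of_segment {P : CMat n} {R : ℝ}
    (hP : ∀ x ∈ Set.Icc (0 : ℝ) 1, IsUnit (1 + x • (P - 1)) ∧ ‖(1 + x • (P - 1))⁻¹‖ ≤ R) :
    ∃ l : CMat n, NormedSpace.exp l = P ∧ ‖l‖ ≤ ‖P - 1‖ * R ∧ (cj P = P⁻¹ → cj l = -l) := by
  obtain ⟨N, hN⟩ : ∃ N, N = P - 1 := ⟨_, rfl⟩
  rw [← hN] at hP ⊢
  -- Clamping to [0, 1] makes the integrand continuous on the whole line, so the integral is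
  -- differentiable everywhere.
  set clamp : ℝ → ℝ := fun y => max 0 (min 1 y) with hclamp
  have hcl : ∀ y, clamp y ∈ Set.Icc (0 : ℝ) 1 := fun y =>
    ⟨le_max_left _ _, max_le zero_le_one (min_le_left _ _)⟩
  have hcl' : ∀ y ∈ Set.Icc (0 : ℝ) 1, clamp y = y := fun y hy => by
    simp [hclamp, hy.1, hy.2]
  have hclc : Continuous clamp := by fun_prop
  set g : ℝ → CMat n := fun y => N * (1 + clamp y • N)⁻¹ with hg
  have hgc : Continuous g := by
    refine continuous_const.mul (continuous_iff_continuousAt.2 fun y => ?_)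
    have h1 : ContinuousAt (fun y => 1 + clamp y • N) y := by fun_prop
    have h2 := (hP _ (hcl y)).1
    have h3 : (fun y => (1 + clamp y • N)⁻¹) = fun y => Ring.inverse (1 + clamp y • N) := by
      funext z; rw [Matrix.nonsing_inv_eq_ringInverse]
    rw [h3]
    have h4 := NormedRing.inverse_continuousAt h2.unit
    rw [IsUnit.unit_spec] at h4
    exact ContinuousAt.comp (f := fun y => 1 + clamp y • N) h4 h1
  set l : ℝ → CMat n := fun x => ∫ y in (0 : ℝ)..x, g y with hl
  have hl0 : l 0 = 0 := by simp [hl]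
  have hld : ∀ x, HasDerivAt l (g x) x := fun x =>
    (hgc.integral_hasStrictDerivAt 0 x).hasDerivAt
  have hgN : ∀ C : CMat n, Commute C N → ∀ y, Commute C (g y) := fun C hC y => by
    have h1 : Commute C (1 + clamp y • N) :=
      (Commute.one_right C).add_right (hC.smul_right _)
    refine hC.mul_right ?_
    have h2 := (hP _ (hcl y)).1
    have h3 := h1.eq
    change C * (1 + clamp y • N)⁻¹ = (1 + clamp y • N)⁻¹ * C
    calc C * (1 + clamp y • N)⁻¹
        = (1 + clamp y • N)⁻¹ * ((1 + clamp y • N) * C) * (1 + clamp y • N)⁻¹ := by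
          rw [← mul_assoc, CMat.inv_mul h2, one_mul]
      _ = (1 + clamp y • N)⁻¹ * C := by
          rw [← h3, mul_assoc, mul_assoc, CMat.mul_inv h2, mul_one]
  have hlC : ∀ C : CMat n, (∀ y, Commute C (g y)) → ∀ x, Commute C (l x) := fun C hC x => by
    have h1 : ∀ x, HasDerivAt (fun x => C * l x - l x * C) 0 x := fun x => by
      have := ((hld x).const_mul C).sub ((hld x).mul_const C)
      rwa [(hC x).eq, sub_self] at this
    have h2 := is_const_of_deriv_eq_zero (fun x => (h1 x).differentiableAt)
      (fun x => (h1 x).deriv) x 0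
    simp only [hl0, mul_zero, zero_mul, sub_self] at h2
    exact sub_eq_zero.1 h2
  have hNg : ∀ y, Commute N (g y) := hgN N (Commute.refl N)
  have hgg : ∀ x y, Commute (g x) (g y) := fun x y => hgN _ (hNg x).symm y
  have hgl : ∀ x y, Commute (g x) (l y) := fun x y => hlC _ (hgg x) y
  have hll : ∀ x y, Commute (l x) (l y) := fun x y => hlC _ (fun z => (hgl z x).symm) y
  -- On [0, 1] the derivative of exp (-l) (1 + x N) vanishes, because l' = N (1 + x N)⁻¹.
  have hconst : ∀ x ∈ Set.Icc (0 : ℝ) 1,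
      NormedSpace.exp (-l x) * (1 + x • N) = NormedSpace.exp (-l 0) * (1 + (0 : ℝ) • N) := by
    have hd : ∀ x, HasDerivAt (fun x => NormedSpace.exp (-l x) * (1 + x • N))
        (NormedSpace.exp (-l x) * (-g x) * (1 + x • N) + NormedSpace.exp (-l x) * N) x := fun x => by
      have h1 := hasDerivAt_exp_of_commute (f := fun x => -l x) (hld x).neg
        (fun y => (hll x y).neg_left.neg_right)
      have h2 : HasDerivAt (fun x : ℝ => (1 : CMat n) + x • N) N x := by
        have := ((hasDerivAt_id x).smul_const N).const_add (1 : CMat n)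
        rwa [one_smul] at this
      exact h1.mul h2
    refine constant_of_has_deriv_right_zero (fun x _ => (hd x).continuousAt.continuousWithinAt) ?_
    intro x hx
    have hx' : x ∈ Set.Icc (0 : ℝ) 1 := ⟨hx.1, hx.2.le⟩
    have h0 : NormedSpace.exp (-l x) * (-g x) * (1 + x • N) + NormedSpace.exp (-l x) * N = 0 := by
      rw [mul_assoc, ← mul_add, neg_mul, hg]
      simp only [hcl' x hx']
      rw [mul_assoc, CMat.inv_mul (hP x hx').1, mul_one, neg_add_cancel, mul_zero]
    have := hd x
    rw [h0] at this
    exact this.hasDerivWithinAt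
  have hexp : NormedSpace.exp (l 1) = P := by
    have h1 := hconst 1 (by simp)
    rw [hl0, neg_zero, NormedSpace.exp_zero, zero_smul, add_zero, mul_one, one_smul, hN,
      add_sub_cancel] at h1
    have h2 : NormedSpace.exp (l 1) * NormedSpace.exp (-l 1) = 1 := by
      rw [← Matrix.exp_add_of_commute _ _ ((Commute.refl (l 1)).neg_right), add_neg_cancel,
        NormedSpace.exp_zero]
    calc NormedSpace.exp (l 1) = NormedSpace.exp (l 1) * (NormedSpace.exp (-l 1) * P) := by
          rw [h1, mul_one]
      _ = P := by rw [← mul_assoc, h2, one_mul]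
  refine ⟨l 1, hexp, ?_, fun hcj => ?_⟩
  · have h1 : ∀ y ∈ Set.uIoc (0 : ℝ) 1, ‖g y‖ ≤ ‖N‖ * R := fun y _ =>
      (norm_mul_le _ _).trans (mul_le_mul_of_nonneg_left (hP _ (hcl y)).2 (norm_nonneg _))
    simpa using intervalIntegral.norm_integral_le_of_norm_le_const h1
  · have hPu : IsUnit P := by
      have := (hP 1 (by simp)).1
      rwa [one_smul, hN, add_sub_cancel] at this
    have hclr : ∀ x, clamp (1 - x) = 1 - clamp x := fun x => by
      simp only [hclamp]
      rcases le_total x 0 with h | h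
      · simp [h, show (1 : ℝ) ≤ 1 - x by linarith, h.trans zero_le_one]
      rcases le_total x 1 with h' | h'
      · simp [h, h', show 1 - x ≤ (1 : ℝ) by linarith]
      · simp [h', show 1 - x ≤ (0 : ℝ) by linarith, show 1 - x ≤ (1 : ℝ) by linarith]
    -- If conj P = P⁻¹, conjugation carries 1 + x N to (1 + (1 - x) N) P⁻¹: it runs through the
    -- segment backwards, up to the factor P⁻¹. Integration then gives conj l = -l.
    have hcg : ∀ x, cj (g x) = -g (1 - x) := fun x => by
      simp only [hg, hclr]
      have hu := (hP _ (hcl (1 - x))).1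
      rw [hclr] at hu
      have e1 : cj N = -(N * P⁻¹) := by
        rw [hN, cj_sub, hcj, cj_one, sub_mul, CMat.mul_inv hPu, one_mul, neg_sub]
      have e2 : cj (1 + clamp x • N) = (1 + (1 - clamp x) • N) * P⁻¹ := by
        have : cj (clamp x • N) = clamp x • cj N := (cjCLM n).map_smul _ _
        rw [cj_add, cj_one, this, e1, add_mul, sub_smul, one_smul, sub_mul, smul_mul_assoc, one_mul,
          smul_neg]
        have : P⁻¹ + N * P⁻¹ = 1 := by
          rw [hN, sub_mul, CMat.mul_inv hPu, one_mul, add_sub_cancel]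
        rw [← this]; abel
      rw [cj_mul, cj_inv, e1, e2, Matrix.mul_inv_rev, Matrix.nonsing_inv_nonsing_inv _
        ((Matrix.isUnit_iff_isUnit_det _).1 hPu), neg_mul, mul_assoc N, ← mul_assoc P⁻¹,
        CMat.inv_mul hPu, one_mul]
    have h1 : ∀ x, HasDerivAt (fun x => cj (l x) - l (1 - x)) 0 x := fun x => by
      have h2 : HasDerivAt (fun x => cj (l x)) (cj (g x)) x :=
        (cjCLM n).hasFDerivAt.comp_hasDerivAt x (hld x)
      have h3 : HasDerivAt (fun x => l (1 - x)) (-g (1 - x)) x := by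
        have := HasDerivAt.scomp (g₁ := l) (h := fun x : ℝ => 1 - x) x (hld (1 - x))
          ((hasDerivAt_id x).const_sub 1)
        rwa [neg_smul, one_smul] at this
      have h4 := h2.sub h3
      rwa [hcg, sub_self] at h4
    have h2 := is_const_of_deriv_eq_zero (fun x => (h1 x).differentiableAt)
      (fun x => (h1 x).deriv) 1 0
    simpa [hl0, cj_zero] using h2

/-- A unitary-type reality condition on an invertible matrix yields a real logarithm, with a
uniform norm bound. -/
theorem exists_real_log [NeZero n] {M : CMat n} (hM : IsUnit M) {κ : ℝ} (hκ1 : 1 ≤ κ)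
    (hκ : ‖M‖ ≤ κ) (hκ' : ‖M⁻¹‖ ≤ κ) (hcj : cj M = M⁻¹) :
    ∃ L : CMat n, cj L = L ∧ NormedSpace.exp ((2 * Real.pi * I) • L) = M ∧
      ‖L‖ ≤ 1 + (1 + κ) * resolventBound n κ := by
  obtain ⟨θ, hθ0, hθ1, hθ⟩ := exists_angle_segment hM hκ1 hκ hκ'
  have hR0 : 0 ≤ resolventBound n κ := by unfold resolventBound; positivity
  have hcexp : (starRingEnd ℂ) (Complex.exp (-θ * I)) = Complex.exp (θ * I) := by
    rw [← Complex.exp_conj]; simp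
  obtain ⟨l, hl1, hl2, hl3⟩ := exists_log_of_segment (P := Complex.exp (-θ * I) • M)
    (R := resolventBound n κ) (fun x hx => by
      have := hθ x hx
      have e : (1 : CMat n) + x • (Complex.exp (-θ * I) • M - 1) =
          ((1 - x : ℝ) : ℂ) • (1 : CMat n) + (x : ℂ) • Complex.exp (-θ * I) • M := by
        rw [smul_sub]
        push_cast
        rw [sub_smul, one_smul, Complex.coe_smul, Complex.coe_smul]; abel
      rwa [e])
  have hl4 : cj l = -l := hl3 (by
    rw [cj_smul, hcexp, hcj]
    refine CMat.eq_inv_of_mul_eq_one ?_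
    rw [smul_mul_smul_comm, ← Complex.exp_add, CMat.mul_inv hM]
    simp)
  have hpi : (2 * Real.pi * I : ℂ) ≠ 0 := by
    simp [Real.pi_ne_zero]
  -- l is a purely imaginary logarithm of exp (-i θ) M. Division by 2 π i makes it real, and undoing
  -- the rotation adds the real scalar θ / (2 π).
  refine ⟨((θ / (2 * Real.pi) : ℝ) : ℂ) • 1 + (2 * Real.pi * I : ℂ)⁻¹ • l, ?_, ?_, ?_⟩
  · rw [cj_add, cj_smul, cj_smul, hl4, cj_one, conj_ofReal]
    congr 1
    rw [map_inv₀, map_mul, map_mul, conj_I, conj_ofReal, Complex.conj_ofNat, mul_neg, inv_neg,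
      neg_smul_neg]
  · rw [smul_add, smul_inv_smul₀ hpi, smul_smul, Matrix.exp_add_of_commute _ _
      ((Commute.one_left l).smul_left _), hl1]
    have h1 : NormedSpace.exp ((2 * Real.pi * I * ((θ / (2 * Real.pi) : ℝ) : ℂ)) • (1 : CMat n)) =
        Complex.exp (θ * I) • 1 := by
      rw [CMat.exp_smul_one]
      congr 2
      have := Real.pi_ne_zero
      push_cast
      field_simp
    rw [h1, smul_mul_smul_comm, ← Complex.exp_add]
    simp
  · refine (norm_add_le _ _).trans ?_
    have hpi1 : (1 : ℝ) ≤ 2 * Real.pi := by linarith [Real.pi_gt_three]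
    rw [norm_smul, norm_smul, norm_one, mul_one, norm_inv, norm_mul, norm_mul, norm_I, mul_one,
      norm_real, norm_real, Real.norm_of_nonneg (by positivity), Complex.norm_ofNat,
      Real.norm_of_nonneg Real.pi_pos.le]
    refine add_le_add (by rw [div_le_one (by linarith)]; linarith) ?_
    have h2 : ‖Complex.exp (-θ * I) • M - 1‖ ≤ 1 + κ := by
      refine (norm_sub_le _ _).trans ?_
      rw [norm_smul, ← ofReal_neg, norm_exp_ofReal_mul_I, norm_one]; linarith
    calc (2 * Real.pi)⁻¹ * ‖l‖ ≤ 1 * ‖l‖ :=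
          mul_le_mul_of_nonneg_right (inv_le_one_of_one_le₀ hpi1) (norm_nonneg _)
      _ ≤ _ := by rw [one_mul]; exact hl2.trans (mul_le_mul_of_nonneg_right h2 hR0)

end MatrixLog

end

noncomputable section

open Complex Metric

/-! ### One-parameter groups and fundamental solutions. -/

section Flow

variable {n : ℕ}

/-- The one-parameter group `exp (s L)`. -/
def expFlow (L : CMat n) (s : ℂ) : CMat n := NormedSpace.exp (s • L)

lemma expFlow_zero (L : CMat n) : expFlow L 0 = 1 := by
  rw [expFlow, zero_smul, NormedSpace.exp_zero]

lemma expFlow_add (L : CMat n) (s t : ℂ) : expFlow L (s + t) = expFlow L s * expFlow L t := by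
  rw [expFlow, add_smul, Matrix.exp_add_of_commute _ _
    (((Commute.refl L).smul_left s).smul_right t)]
  rfl

lemma expFlow_mul_neg (L : CMat n) (s : ℂ) : expFlow L s * expFlow L (-s) = 1 := by
  rw [← expFlow_add, add_neg_cancel, expFlow_zero]

lemma isUnit_expFlow (L : CMat n) (s : ℂ) : IsUnit (expFlow L s) := Matrix.isUnit_exp _

lemma expFlow_inv (L : CMat n) (s : ℂ) : (expFlow L s)⁻¹ = expFlow L (-s) :=
  (CMat.eq_inv_of_mul_eq_one (expFlow_mul_neg L s)).symm

lemma commute_expFlow (L : CMat n) (s : ℂ) : L * expFlow L s = expFlow L s * L :=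
  (((Commute.refl L).smul_right s).exp_right).eq

lemma hasDerivAt_expFlow (L : CMat n) (s : ℂ) :
    HasDerivAt (expFlow L) (expFlow L s * L) s :=
  hasDerivAt_exp_smul_const (𝕂 := ℂ) (𝔸 := CMat n) L s

lemma cj_expFlow (L : CMat n) (s : ℂ) (hL : cj L = L) :
    cj (expFlow L s) = expFlow L ((starRingEnd ℂ) s) := by
  have h : ∀ M : CMat n, cj M = (M.conjTranspose).transpose := fun M => rfl
  rw [expFlow, h, ← Matrix.exp_conjTranspose, ← Matrix.exp_transpose, ← h, cj_smul, hL]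
  rfl

lemma norm_expFlow_le [NeZero n] (L : CMat n) (s : ℂ) :
    ‖expFlow L s‖ ≤ Real.exp (‖L‖ * ‖s‖) := by
  have := norm_le_exp_of_linear_ode (convex_univ (𝕜 := ℝ) (E := ℂ))
    (fun s _ => hasDerivAt_expFlow L s) (K := ‖L‖)
    (fun s _ => (norm_mul_le _ _).trans_eq (mul_comm _ _)) (Set.mem_univ 0) (Set.mem_univ s)
  simpa [expFlow_zero] using this

/-- Existence of a fundamental solution together with its inverse on a convex domain. -/
lemma exists_fundamental_convex {W : Set ℂ} (hW : Convex ℝ W) (hWo : IsOpen W) {A : ℂ → CMat n}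
    (hA : DifferentiableOn ℂ A W) {K : ℝ} (hK : ∀ s ∈ W, ‖A s‖ ≤ K) {s₀ : ℂ} (h₀ : s₀ ∈ W) :
    ∃ X Z : ℂ → CMat n, X s₀ = 1 ∧ Z s₀ = 1 ∧ ∀ s ∈ W, HasDerivAt X (A s * X s) s ∧
      HasDerivAt Z (-(Z s * A s)) s ∧ Z s * X s = 1 := by
  obtain ⟨X, hX0, hX⟩ := exists_linear_ode_solution hW hWo
    (T := fun s => ContinuousLinearMap.mul ℂ (CMat n) (A s))
    ((ContinuousLinearMap.mul ℂ (CMat n)).differentiable.comp_differentiableOn hA)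
    (fun s hs => (ContinuousLinearMap.opNorm_mul_apply_le ℂ (CMat n) (A s)).trans (hK s hs)) h₀ 1
  -- The inverse is built as a solution of the adjoint equation Z' = -Z A; then Z X is constant,
  -- which also yields the invertibility of X.
  obtain ⟨Z, hZ0, hZ⟩ := exists_linear_ode_solution hW hWo (K := K)
    (T := fun s => (ContinuousLinearMap.mul ℂ (CMat n)).flip (-A s))
    ((ContinuousLinearMap.mul ℂ (CMat n)).flip.differentiable.comp_differentiableOn hA.neg)
    (fun s hs => ContinuousLinearMap.opNorm_le_bound _ ((norm_nonneg _).trans (hK s hs))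
      fun M => by
        rw [ContinuousLinearMap.flip_apply, ContinuousLinearMap.mul_apply', mul_comm K]
        refine (norm_mul_le _ _).trans (mul_le_mul_of_nonneg_left ?_ (norm_nonneg _))
        rw [norm_neg]; exact hK s hs) h₀ 1
  have hX' : ∀ s ∈ W, HasDerivAt X (A s * X s) s := hX
  have hZ' : ∀ s ∈ W, HasDerivAt Z (-(Z s * A s)) s := fun s hs => by
    have h : HasDerivAt Z (Z s * -A s) s := hZ s hs
    rwa [mul_neg] at h
  refine ⟨X, Z, hX0, hZ0, fun s hs => ⟨hX' s hs, hZ' s hs, ?_⟩⟩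
  have := eq_of_hasDerivAt_zero hW (y := fun s => Z s * X s) (fun s hs => by
    have h := (hZ' s hs).fun_mul (hX' s hs)
    rwa [neg_mul, mul_assoc, neg_add_cancel] at h) h₀ hs
  simpa [hX0, hZ0] using this

/-- Uniqueness: Z is the inverse of the fundamental solution X, and Z Y has derivative zero. -/
lemma eq_mul_of_fundamental {W : Set ℂ} (hW : Convex ℝ W) {A X Z Y : ℂ → CMat n} {s₀ : ℂ}
    (h₀ : s₀ ∈ W) (hZ0 : Z s₀ = 1)
    (hXZ : ∀ s ∈ W, HasDerivAt X (A s * X s) s ∧ HasDerivAt Z (-(Z s * A s)) s ∧ Z s * X s = 1)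
    (hY : ∀ s ∈ W, HasDerivAt Y (A s * Y s) s) {s : ℂ} (hs : s ∈ W) : Y s = X s * Y s₀ := by
  have h1 := eq_of_hasDerivAt_zero hW (y := fun s => Z s * Y s) (fun s hs => by
    have h := (hXZ s hs).2.1.fun_mul (hY s hs)
    rwa [neg_mul, mul_assoc, neg_add_cancel] at h) h₀ hs
  simp only [hZ0, one_mul] at h1
  rw [← h1, ← mul_assoc, mul_eq_one_comm.1 (hXZ s hs).2.2, one_mul]

/-- A vertical strip. -/
def strip (x y : ℝ) : Set ℂ := {s | x < s.re ∧ s.re < y}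

lemma isOpen_strip (x y : ℝ) : IsOpen (strip x y) :=
  (isOpen_lt continuous_const continuous_re).inter (isOpen_lt continuous_re continuous_const)

lemma convex_strip (x y : ℝ) : Convex ℝ (strip x y) :=
  (convex_halfSpace_re_gt x).inter (convex_halfSpace_re_lt y)

lemma exp_mem_annulus {α β : ℝ} (hα : 0 < α) (hβ : 0 < β) {s : ℂ} :
    Complex.exp s ∈ annulus α β ↔ s ∈ strip (Real.log α) (Real.log β) := by
  rw [annulus, strip, Set.mem_ofPred_eq, Set.mem_ofPred_eq, Complex.norm_exp, Real.log_lt_iff_lt_exp hα,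
    Real.lt_log_iff_exp_lt hβ]

end Flow

end

noncomputable section

open Complex Metric

/-! ### Solutions of the form F(t) t^L on an annulus. -/

section Floquet

variable {n : ℕ}

/-- Bound for a solution transported over a bounded distance on the logarithmic chart. -/
def solBound (K Λ : ℝ) : ℝ := Real.exp (K * (2 * Λ + 8))

/-- Bound for the logarithm of the monodromy. -/
def logBound (n : ℕ) (K Λ : ℝ) : ℝ := 1 + (1 + solBound K Λ) * resolventBound n (solBound K Λ)

/-- Bound for the single-valued factor of a fundamental solution on an annulus. -/
def floquetBound (n : ℕ) (K Λ : ℝ) : ℝ := solBound K Λ * Real.exp (logBound n K Λ * (Λ + 4))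

/-- A fundamental solution on an annulus is `F(t) t ^ L` with `F` single-valued and `L` real. -/
theorem exists_floquet [NeZero n] {A : ℂ → CMat n} {α β β' K Λ : ℝ} (hα : 0 < α) (hαβ : α < β')
    (hββ : β' ≤ β) (hA : DifferentiableOn ℂ A (annulus α β)) (hAs : ConjSymm A (annulus α β))
    (hAb : ∃ K₀ : ℝ, ∀ z ∈ annulus α β, ‖z • A z‖ ≤ K₀)
    (hK : ∀ z ∈ annulus α β', ‖z • A z‖ ≤ K) (hΛ : ∀ x, α < x → x < β' → |Real.log x| ≤ Λ) :
    ∃ (L : CMat n) (F : ℂ → CMat n), cj L = L ∧ ‖L‖ ≤ logBound n K Λ ∧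
      (∀ z ∈ annulus α β, IsUnit (F z) ∧ HasDerivAt F (A z * F z - z⁻¹ • (F z * L)) z) ∧
      ConjSymm F (annulus α β) ∧
      ∀ z ∈ annulus α β', ‖F z‖ ≤ floquetBound n K Λ ∧ ‖(F z)⁻¹‖ ≤ floquetBound n K Λ := by
  have hβ' : 0 < β' := hα.trans hαβ
  have hβ : 0 < β := hβ'.trans_le hββ
  obtain ⟨ρ, hρ1, hρ2⟩ := exists_between hαβ
  have hρ0 : 0 < ρ := hα.trans hρ1
  -- The chart t = e^s turns the annulus into a strip. Two strips are needed: up to β the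
  -- coefficient has only some bound K₀, while the estimates with K hold up to β'.
  set W := strip (Real.log α) (Real.log β) with hWdef
  set W' := strip (Real.log α) (Real.log β') with hWdef'
  have hWW : W' ⊆ W := fun s hs => ⟨hs.1, hs.2.trans_le (Real.log_le_log hβ' hββ)⟩
  have hWc : Convex ℝ W := convex_strip _ _
  have hWc' : Convex ℝ W' := convex_strip _ _
  have hWo : IsOpen W := isOpen_strip _ _
  set s₀ : ℂ := (Real.log ρ : ℂ) with hs₀
  have hs₀W' : s₀ ∈ W' := ⟨by simpa [hs₀] using Real.log_lt_log hα hρ1,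
    by simpa [hs₀] using Real.log_lt_log hρ0 hρ2⟩
  have hs₀W : s₀ ∈ W := hWW hs₀W'
  have hmem : ∀ s ∈ W, Complex.exp s ∈ annulus α β := fun s hs => (exp_mem_annulus hα hβ).2 hs
  have hmem' : ∀ s ∈ W', Complex.exp s ∈ annulus α β' := fun s hs => (exp_mem_annulus hα hβ').2 hs
  set T : ℂ → CMat n := fun s => Complex.exp s • A (Complex.exp s) with hT
  have hTd : DifferentiableOn ℂ T W :=
    Complex.differentiable_exp.differentiableOn.smul
      (hA.comp Complex.differentiable_exp.differentiableOn hmem)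
  obtain ⟨K₀, hK₀⟩ := hAb
  obtain ⟨X, Z, hX0, hZ0, hXZ⟩ := exists_fundamental_convex hWc hWo hTd
    (fun s hs => hK₀ _ (hmem s hs)) hs₀W
  have hXu : ∀ s ∈ W, IsUnit (X s) := fun s hs => IsUnit.of_mul_eq_one _
    (mul_eq_one_comm.1 (hXZ s hs).2.2)
  have hXi : ∀ s ∈ W, (X s)⁻¹ = Z s := fun s hs =>
    (CMat.eq_inv_of_mul_eq_one (mul_eq_one_comm.1 (hXZ s hs).2.2)).symm
  have hK0 : 0 ≤ K := (norm_nonneg _).trans (hK _ (hmem' _ hs₀W'))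
  have hΛ0 : 0 ≤ Λ := (abs_nonneg _).trans (hΛ _ hρ1 hρ2)
  have hre : ∀ s ∈ W', |s.re| ≤ Λ := fun s hs => by
    have h1 := hmem' s hs
    have := hΛ ‖Complex.exp s‖ h1.1 h1.2
    rwa [Complex.norm_exp, Real.log_exp] at this
  -- translation by the period
  have hper : ∀ s, s + 2 * Real.pi * I ∈ W ↔ s ∈ W := fun s => by
    simp [hWdef, strip]
  have hper' : ∀ s, s + 2 * Real.pi * I ∈ W' ↔ s ∈ W' := fun s => by
    simp [hWdef', strip]
  have hTper : ∀ s, T (s + 2 * Real.pi * I) = T s := fun s => by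
    simp only [hT, Complex.exp_periodic s]
  have hconjW : ∀ s ∈ W, (starRingEnd ℂ) s ∈ W := fun s hs => by
    simpa [hWdef, strip] using hs
  have hTconj : ∀ s ∈ W, T ((starRingEnd ℂ) s) = cj (T s) := fun s hs => by
    simp only [hT, Complex.exp_conj, cj_smul]
    rw [hAs _ (hmem s hs)]
  -- M is the monodromy of the circle, X being normalized at the real point s₀.
  obtain ⟨M, hM⟩ : ∃ M, M = X (s₀ + 2 * Real.pi * I) := ⟨_, rfl⟩
  have hXM : ∀ s ∈ W, X (s + 2 * Real.pi * I) = X s * M := fun s hs => by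
    rw [hM]
    refine eq_mul_of_fundamental hWc (Y := fun s => X (s + 2 * Real.pi * I)) hs₀W hZ0 hXZ
      (fun s hs => ?_) hs
    have h1 := (hXZ _ ((hper s).2 hs)).1
    rw [hTper] at h1
    exact h1.comp_add_const s (2 * Real.pi * I)
  have hXcj : ∀ s ∈ W, cj (X ((starRingEnd ℂ) s)) = X s := fun s hs => by
    have := eq_mul_of_fundamental hWc (Y := fun s => cj (X ((starRingEnd ℂ) s))) hs₀W hZ0 hXZ
      (fun s hs => ?_) hs
    · rw [this, hs₀, conj_ofReal, ← hs₀, hX0, cj_one, mul_one]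
    · have h1 := (hXZ _ (hconjW s hs)).1.cj_conj
      rw [Complex.conj_conj, cj_mul, hTconj s hs, cj_cj] at h1
      exact h1
  have hs₀p : s₀ + 2 * Real.pi * I ∈ W := (hper _).2 hs₀W
  have hMu : IsUnit M := by rw [hM]; exact hXu _ hs₀p
  -- Conjugation fixes s₀ and exchanges the translations by 2 π i and -2 π i, so it inverts the
  -- monodromy.
  have hMcj : cj M = M⁻¹ := by
    have e1 : (starRingEnd ℂ) (s₀ + 2 * Real.pi * I) + 2 * Real.pi * I = s₀ := by
      simp [hs₀, Complex.conj_ofNat]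
    have h1 := hXM _ (hconjW _ hs₀p)
    rw [e1, hX0] at h1
    have h2 := hXcj _ (hconjW _ hs₀p)
    rw [Complex.conj_conj, ← hM] at h2
    rw [← h2] at h1
    exact CMat.eq_inv_of_mul_eq_one (mul_eq_one_comm.1 h1.symm)
  -- norm bounds
  have hXb : ∀ s ∈ W', ‖s - s₀‖ ≤ 2 * Λ + 8 → ‖X s‖ ≤ solBound K Λ ∧ ‖Z s‖ ≤ solBound K Λ := by
    intro s hs hd
    have h1 := norm_le_exp_of_linear_ode hWc' (fun s hs => (hXZ s (hWW hs)).1) (K := K)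
      (fun s hs => (norm_mul_le _ _).trans (mul_le_mul_of_nonneg_right (hK _ (hmem' s hs))
        (norm_nonneg _))) hs₀W' hs
    have h2 := norm_le_exp_of_linear_ode hWc' (fun s hs => (hXZ s (hWW hs)).2.1) (K := K)
      (fun s hs => by
        rw [norm_neg, mul_comm K]
        exact (norm_mul_le _ _).trans (mul_le_mul_of_nonneg_left (hK _ (hmem' s hs))
        (norm_nonneg _))) hs₀W' hs
    rw [hX0, norm_one, one_mul] at h1
    rw [hZ0, norm_one, one_mul] at h2
    have h3 : Real.exp (K * ‖s - s₀‖) ≤ solBound K Λ :=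
      Real.exp_le_exp.2 (mul_le_mul_of_nonneg_left hd hK0)
    exact ⟨h1.trans h3, h2.trans h3⟩
  -- The 8 in `solBound` covers one period, as 2 π ≤ 8, and later the imaginary part of the
  -- principal logarithm.
  have hM2 := hXb _ ((hper' _).2 hs₀W') (by
    rw [add_sub_cancel_left, norm_mul, norm_mul, norm_I, norm_real, Real.norm_of_nonneg
      Real.pi_pos.le, Complex.norm_ofNat]
    linarith [Real.pi_le_four])
  rw [← hXi _ hs₀p, ← hM] at hM2
  have hsol1 : 1 ≤ solBound K Λ := Real.one_le_exp (by positivity)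
  obtain ⟨L, hLcj, hLexp, hLn⟩ := exists_real_log hMu hsol1 hM2.1 hM2.2 hMcj
  have hLexp' : expFlow L (2 * Real.pi * I) = M := hLexp
  -- the single-valued factor
  obtain ⟨Φ, hΦ⟩ : ∃ Φ : ℂ → CMat n, Φ = W.indicator fun s => X s * expFlow L (-s) := ⟨_, rfl⟩
  have hΦW : ∀ s ∈ W, Φ s = X s * expFlow L (-s) := fun s hs => by
    rw [hΦ, Set.indicator_of_mem hs]
  -- The extension by 0 off the strip makes Φ periodic on all of ℂ, so that F does not depend on the
  -- branch of the logarithm.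
  have hΦper : Function.Periodic Φ (2 * Real.pi * I) := fun s => by
    by_cases hs : s ∈ W
    · rw [hΦW _ ((hper s).2 hs), hΦW s hs, hXM s hs, neg_add_rev, expFlow_add, ← mul_assoc,
        mul_assoc (X s), ← hLexp', expFlow_mul_neg, mul_one]
    · rw [hΦ, Set.indicator_of_notMem hs, Set.indicator_of_notMem (fun h => hs ((hper s).1 h))]
  obtain ⟨F, hF⟩ : ∃ F : ℂ → CMat n, F = fun z => Φ (Complex.log z) := ⟨_, rfl⟩
  have hFexp : ∀ s, F (Complex.exp s) = Φ s := fun s => by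
    obtain ⟨k, hk⟩ := Complex.exp_eq_exp_iff_exists_int.1 (Complex.exp_log (Complex.exp_ne_zero s))
    rw [hF]
    simp only [hk]
    exact hΦper.int_mul k s
  have hne : ∀ z ∈ annulus α β, z ≠ 0 := fun z hz => norm_pos_iff.1 (hα.trans hz.1)
  have hlog : ∀ z ∈ annulus α β, Complex.log z ∈ W := fun z hz => by
    rw [← exp_mem_annulus hα hβ, Complex.exp_log (hne z hz)]; exact hz
  have hFlog : ∀ z ∈ annulus α β, F z = X (Complex.log z) * expFlow L (-Complex.log z) :=
    fun z hz => by rw [hF]; exact hΦW _ (hlog z hz)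
  refine ⟨L, F, hLcj, hLn, fun z hz => ⟨?_, ?_⟩, fun z hz => ?_, fun z hz => ?_⟩
  · rw [hFlog z hz]
    exact (hXu _ (hlog z hz)).mul (isUnit_expFlow _ _)
  · have hz0 := hne z hz
    obtain ⟨s, hs⟩ : ∃ s, s = Complex.log z := ⟨_, rfl⟩
    have hsW : s ∈ W := hs ▸ hlog z hz
    have hes : Complex.exp s = z := by rw [hs, Complex.exp_log hz0]
    have h1 : HasDerivAt (fun s => X s * expFlow L (-s))
        (T s * X s * expFlow L (-s) + X s * -(expFlow L (-s) * L)) s := by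
      refine ((hXZ s hsW).1).fun_mul ?_
      have := HasDerivAt.scomp (g₁ := expFlow L) (h := fun s => -s) s (hasDerivAt_expFlow L (-s))
        (hasDerivAt_neg s)
      rwa [neg_smul, one_smul] at this
    -- A branch of the logarithm centred at z, since z may lie on the cut of the principal one.
    have h2 : HasDerivAt (fun w => s + Complex.log (w / z)) z⁻¹ z := by
      have h3 : HasDerivAt (fun w => w / z) z⁻¹ z := by
        simpa [div_eq_mul_inv] using (hasDerivAt_id z).mul_const z⁻¹
      have h4 := h3.clog (by rw [div_self hz0]; exact Complex.one_mem_slitPlane)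
      rw [div_self hz0, div_one] at h4
      exact h4.const_add s
    have h5 : s + Complex.log (z / z) = s := by rw [div_self hz0, Complex.log_one, add_zero]
    have h6 := HasDerivAt.scomp (g₁ := fun s => X s * expFlow L (-s))
      (h := fun w => s + Complex.log (w / z)) z (by rw [h5]; exact h1) h2
    have h7 : (fun w => X (s + Complex.log (w / z)) * expFlow L (-(s + Complex.log (w / z))))
        =ᶠ[nhds z] F := by
      have hz' : ∀ᶠ w in nhds z, w ∈ annulus α β := (isOpen_annulus α β).mem_nhds hz
      filter_upwards [hz'] with w hw
      have h8 : Complex.exp (s + Complex.log (w / z)) = w := by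
        rw [Complex.exp_add, hes, Complex.exp_log (div_ne_zero (hne w hw) hz0),
          mul_div_cancel₀ _ hz0]
      have h9 : s + Complex.log (w / z) ∈ W := by
        rw [hWdef, ← exp_mem_annulus hα hβ, h8]; exact hw
      rw [← hΦW _ h9, ← hFexp, h8]
    have h10 := h6.congr_of_eventuallyEq h7.symm
    convert! h10 using 1
    rw [hFlog z hz, ← hs, smul_add, hT]
    simp only [hes]
    rw [smul_mul_assoc, smul_mul_assoc, smul_smul, inv_mul_cancel₀ hz0, one_smul, mul_neg, smul_neg,
      ← mul_assoc, ← mul_assoc, sub_eq_add_neg]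
  · have h1 := hlog z hz
    have h2 : (starRingEnd ℂ) z = Complex.exp ((starRingEnd ℂ) (Complex.log z)) := by
      rw [Complex.exp_conj, Complex.exp_log (hne z hz)]
    rw [h2, hFexp, hΦW _ (hconjW _ h1), hFlog z hz, cj_mul, cj_expFlow _ _ hLcj, map_neg]
    congr 1
    rw [← hXcj _ h1, cj_cj]
  · have hz2 : z ∈ annulus α β := ⟨hz.1, hz.2.trans_le hββ⟩
    have h1 := hlog z hz2
    have h2 : Complex.log z ∈ W' := by
      rw [hWdef', ← exp_mem_annulus hα hβ', Complex.exp_log (hne z hz2)]; exact hz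
    have him : |(Complex.log z).im| ≤ 4 := by
      rw [Complex.log_im]
      exact (Complex.abs_arg_le_pi z).trans Real.pi_le_four
    have hr := hre _ h2
    have hn1 : ‖Complex.log z‖ ≤ Λ + 4 := (Complex.norm_le_abs_re_add_abs_im _).trans (by linarith)
    have hn2 : ‖Complex.log z - s₀‖ ≤ 2 * Λ + 8 := by
      have h3 := hre _ hs₀W'
      have h4 : ‖s₀‖ = |s₀.re| := by rw [hs₀, norm_real, ofReal_re, Real.norm_eq_abs]
      have := norm_sub_le (Complex.log z) s₀
      linarith
    obtain ⟨b1, b2⟩ := hXb _ h2 hn2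
    have hL0 : 0 ≤ logBound n K Λ := (norm_nonneg _).trans hLn
    have hflow : ∀ s : ℂ, ‖s‖ ≤ Λ + 4 → ‖expFlow L s‖ ≤ Real.exp (logBound n K Λ * (Λ + 4)) :=
      fun s hs => (norm_expFlow_le L s).trans (Real.exp_le_exp.2
        (mul_le_mul hLn hs (norm_nonneg _) hL0))
    constructor
    · rw [hFlog z hz2]
      exact (norm_mul_le _ _).trans (mul_le_mul b1 (hflow _ (by rwa [norm_neg])) (norm_nonneg _)
        (zero_le_one.trans hsol1))
    · rw [hFlog z hz2, Matrix.mul_inv_rev, expFlow_inv, neg_neg, hXi _ h1, floquetBound, mul_comm]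
      refine (norm_mul_le _ _).trans ((mul_comm _ _).trans_le ?_)
      exact (mul_le_mul b2 (hflow _ hn1) (norm_nonneg _) (zero_le_one.trans hsol1)).trans_eq
        (mul_comm _ _)

end Floquet

end

noncomputable section

open Complex Metric

/-! ### Entire matrix functions of polynomial growth. -/

section Entire

variable {n : ℕ}

lemma ConjSymm.deriv {f : ℂ → CMat n} {W : Set ℂ} (hWo : IsOpen W)
    (hW : ∀ z ∈ W, (starRingEnd ℂ) z ∈ W) (hf : DifferentiableOn ℂ f W) (hs : ConjSymm f W) :
    ConjSymm (deriv f) W := fun z hz => by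
  have h1 := (hf.hasDerivAt (hWo.mem_nhds hz)).cj_conj
  have h2 : f =ᶠ[nhds ((starRingEnd ℂ) z)] fun w => cj (f ((starRingEnd ℂ) w)) := by
    filter_upwards [hWo.mem_nhds (hW z hz)] with w hw
    rw [hs w hw, cj_cj]
  exact (h1.congr_of_eventuallyEq h2).deriv

lemma ConjSymm.iteratedDeriv {f : ℂ → CMat n} (hf : Differentiable ℂ f)
    (hs : ConjSymm f Set.univ) (k : ℕ) : ConjSymm (iteratedDeriv k f) Set.univ := by
  induction k with
  | zero => simpa using hs
  | succ k ih =>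
    rw [iteratedDeriv_succ]
    refine ConjSymm.deriv isOpen_univ (fun _ _ => Set.mem_univ _) ?_ ih
    exact ((hf.contDiff (n := (⊤ : ℕ∞))).differentiable_iteratedDeriv k
      (by exact_mod_cast ENat.natCast_lt_top k)).differentiableOn

/-- An entire function of polynomial growth is a polynomial, with coefficients bounded through
the values on a circle. -/
lemma exists_coeff_of_entire_of_growth {H : ℂ → CMat n} (hH : Differentiable ℂ H)
    (hs : ConjSymm H Set.univ) {c : ℝ} {D : ℕ} (hc : ∀ z, 2 ≤ ‖z‖ → ‖H z‖ ≤ c * ‖z‖ ^ D) {ρ h : ℝ}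
    (hρ : 0 < ρ) (hh : ∀ z, ‖z‖ = ρ → ‖H z‖ ≤ h) :
    ∃ p : ℕ → CMat n, (∀ k, cj (p k) = p k) ∧ (∀ k, ‖p k‖ ≤ h / ρ ^ k) ∧
      ∀ z, H z = ∑ k ∈ Finset.range (D + 1), z ^ k • p k := by
  obtain ⟨p, hp⟩ : ∃ p : ℕ → CMat n, p = fun k => ((k.factorial : ℂ))⁻¹ • iteratedDeriv k H 0 :=
    ⟨_, rfl⟩
  have hbound : ∀ R C : ℝ, 0 < R → (∀ z, ‖z‖ = R → ‖H z‖ ≤ C) → ∀ k, ‖p k‖ ≤ C / R ^ k := by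
    intro R C hR hC k
    have h1 := Complex.norm_iteratedDeriv_le_of_forall_mem_sphere_norm_le k hR
      hH.diffContOnCl (fun z hz => hC z (by simpa using hz)) (c := 0)
    have hk : (0 : ℝ) < k.factorial := by exact_mod_cast k.factorial_pos
    rw [hp]
    simp only [norm_smul, norm_inv, Complex.norm_natCast]
    rw [inv_mul_le_iff₀ hk, ← mul_div_assoc]
    exact h1
  refine ⟨p, fun k => ?_, hbound ρ h hρ hh, fun z => ?_⟩
  · have := ConjSymm.iteratedDeriv hH hs k 0 (Set.mem_univ _)
    rw [map_zero] at this
    rw [hp]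
    simp only [cj_smul, ← this, map_inv₀, map_natCast]
  -- Circles tending to infinity kill the coefficients beyond D whatever c is; the quantitative
  -- bound comes from the fixed circle of radius ρ.
  · have hzero : ∀ k, D < k → p k = 0 := fun k hk => by
      have h1 : ∀ R : ℝ, 2 ≤ R → ‖p k‖ ≤ |c| * R⁻¹ := fun R hR => by
        have hR0 : 0 < R := by linarith
        have hb : ∀ z : ℂ, ‖z‖ = R → ‖H z‖ ≤ |c| * R ^ D := fun z hz => by
          have h2 := hc z (by rw [hz]; exact hR)
          rw [hz] at h2
          exact h2.trans (mul_le_mul_of_nonneg_right (le_abs_self c) (by positivity))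
        refine (hbound R _ hR0 hb k).trans ?_
        rw [mul_div_assoc]
        refine mul_le_mul_of_nonneg_left ?_ (abs_nonneg c)
        rw [div_le_iff₀ (by positivity), inv_mul_eq_div, le_div_iff₀ hR0, ← pow_succ]
        exact pow_le_pow_right₀ (by linarith) hk
      have h2 : Filter.Tendsto (fun R : ℝ => |c| * R⁻¹) Filter.atTop (nhds 0) := by
        simpa using tendsto_inv_atTop_zero.const_mul |c|
      have h3 : ‖p k‖ ≤ 0 := ge_of_tendsto h2 (by
        filter_upwards [Filter.eventually_ge_atTop 2] with R hR using h1 R hR)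
      exact norm_le_zero_iff.1 h3
    have h1 := Complex.hasSum_taylorSeries_of_entire hH 0 z
    have h2 : (fun k : ℕ => ((k.factorial : ℂ))⁻¹ • (z - 0) ^ k • iteratedDeriv k H 0) =
        fun k => z ^ k • p k := by
      funext k
      rw [hp, sub_zero, smul_comm]
    rw [h2] at h1
    refine h1.unique (hasSum_sum_of_ne_finset_zero fun k hk => ?_)
    rw [hzero k (by simpa using hk), smul_zero]

end Entire

/-! ### The gauge relation on the annulus. -/

section Gauge

variable {n : ℕ}

/-- Gauge data transforming a system `A` on a disk into a system with a regular singular point of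
exponent matrix `L` outside. -/
structure IsGauge (A : ℂ → CMat n) (σ b : ℝ) (L : CMat n) (G F E : ℂ → CMat n) : Prop where
  L_real : cj L = L
  G_diff : DifferentiableOn ℂ G (ball 0 b)
  G_unit : ∀ z ∈ ball (0 : ℂ) b, IsUnit (G z)
  G_symm : ConjSymm G (ball 0 b)
  E_diff : DifferentiableOn ℂ E (exterior σ)
  E_unit : ∀ z ∈ exterior σ, IsUnit (E z)
  E_symm : ConjSymm E (exterior σ)
  F_unit : ∀ z ∈ annulus σ b, IsUnit (F z)
  F_deriv : ∀ z ∈ annulus σ b, HasDerivAt F (A z * F z - z⁻¹ • (F z * L)) z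
  G_mul_F : ∀ z ∈ annulus σ b, G z * F z = E z

variable {A : ℂ → CMat n} {σ b : ℝ} {L : CMat n} {G F E : ℂ → CMat n}

lemma CMat.differentiableOn_inv {f : ℂ → CMat n} {W : Set ℂ} (hWo : IsOpen W)
    (hf : DifferentiableOn ℂ f W) (hu : ∀ z ∈ W, IsUnit (f z)) :
    DifferentiableOn ℂ (fun z => (f z)⁻¹) W := fun z hz =>
  (CMat.hasDerivAt_inv (hf.hasDerivAt (hWo.mem_nhds hz)) (hu z hz)).differentiableAt.differentiableWithinAt

/-- Both sides are the coefficient of the equation solved by E(z) z^L = G(z) F(z) z^L; the proof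
differentiates G F = E. -/
lemma IsGauge.transform_eq (h : IsGauge A σ b L G F E) {z : ℂ} (hz : z ∈ annulus σ b) :
    deriv G z * (G z)⁻¹ + G z * A z * (G z)⁻¹ =
      deriv E z * (E z)⁻¹ + z⁻¹ • (E z * L * (E z)⁻¹) := by
  have hzb : z ∈ ball (0 : ℂ) b := by simpa using hz.2
  have hG := h.G_diff.hasDerivAt (isOpen_ball.mem_nhds hzb)
  have h1 : HasDerivAt E (deriv G z * F z + G z * (A z * F z - z⁻¹ • (F z * L))) z := by
    refine (hG.mul (h.F_deriv z hz)).congr_of_eventuallyEq ?_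
    filter_upwards [(isOpen_annulus σ b).mem_nhds hz] with w hw
    exact (h.G_mul_F w hw).symm
  have hFu := h.F_unit z hz
  have hE : deriv E z = deriv G z * F z + G z * (A z * F z - z⁻¹ • (F z * L)) := h1.deriv
  rw [hE, ← h.G_mul_F z hz, Matrix.mul_inv_rev]
  have e1 : ∀ M : CMat n, M * F z * ((F z)⁻¹ * (G z)⁻¹) = M * (G z)⁻¹ := fun M => by
    rw [mul_assoc, ← mul_assoc (F z), CMat.mul_inv hFu, one_mul]
  rw [add_mul, e1, mul_sub, sub_mul, ← mul_assoc (G z), e1, mul_smul_comm, smul_mul_assoc,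
    ← mul_assoc (G z)]
  abel

end Gauge

end

noncomputable section

open Complex Metric

/-! ### Principal part and entire remainder of the new coefficient. -/

section Remainder

variable {n m r : ℕ} {pole : Fin m → ℝ} {res : Fin m → RMat n} {poly : Fin (r + 1) → RMat n}
  {σ b : ℝ} {L : CMat n} {G F E : ℂ → CMat n}

/-- The residues of the transformed system. -/
def gaugeRes (pole : Fin m → ℝ) (res : Fin m → RMat n) (b : ℝ) (G : ℂ → CMat n) (j : Fin m) :
    CMat n :=
  if |pole j| < b then G (pole j) * complexify (res j) * (G (pole j))⁻¹ else 0

/-- The principal part of the transformed system. -/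
def gaugePrincipal (pole : Fin m → ℝ) (res : Fin m → RMat n) (b : ℝ) (G : ℂ → CMat n) (z : ℂ) :
    CMat n :=
  ∑ j, (z - (pole j : ℂ))⁻¹ • gaugeRes pole res b G j

lemma complexify_zero : complexify (0 : RMat n) = 0 := by ext; simp [complexify]

lemma gaugeRes_of_res_eq_zero {j : Fin m} (h : res j = 0) : gaugeRes pole res b G j = 0 := by
  simp [gaugeRes, h, complexify_zero]

lemma cj_gaugeRes (hG : ConjSymm G (ball 0 b)) (j : Fin m) :
    cj (gaugeRes pole res b G j) = gaugeRes pole res b G j := by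
  unfold gaugeRes
  split_ifs with h
  · have h1 := hG (pole j) (by simpa using h)
    rw [conj_ofReal] at h1
    rw [cj_mul, cj_mul, cj_inv, ← h1, cj_complexify]
  · exact cj_zero

lemma gaugePrincipal_conj (hG : ConjSymm G (ball 0 b)) (z : ℂ) :
    gaugePrincipal pole res b G ((starRingEnd ℂ) z) = cj (gaugePrincipal pole res b G z) := by
  unfold gaugePrincipal
  rw [cj_sum]
  refine Finset.sum_congr rfl fun j _ => ?_
  rw [cj_smul, cj_gaugeRes hG, map_inv₀, map_sub, conj_ofReal]

lemma differentiableOn_gaugePrincipal (hp : ∀ j, res j ≠ 0 → |pole j| < σ ∨ b < |pole j|) :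
    DifferentiableOn ℂ (gaugePrincipal pole res b G) (exterior σ) := by
  unfold gaugePrincipal
  refine DifferentiableOn.fun_sum fun j _ => ?_
  by_cases hr : res j = 0
  · simp only [gaugeRes_of_res_eq_zero hr, smul_zero]
    exact differentiableOn_const _
  rcases hp j hr with h | h
  · refine DifferentiableOn.smul_const (DifferentiableOn.inv (by fun_prop) fun z hz h0 => ?_) _
    rw [sub_eq_zero] at h0
    have : σ < ‖z‖ := hz
    rw [h0, norm_real, Real.norm_eq_abs] at this
    exact lt_asymm h this
  · have : gaugeRes pole res b G j = 0 := if_neg (not_lt.2 h.le)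
    simp only [this, smul_zero]
    exact differentiableOn_const _

/-- The part of the transformed coefficient coming from one pole, with its singularity in the disk
removed. -/
def poleRemainder (pole : Fin m → ℝ) (res : Fin m → RMat n) (b : ℝ) (G : ℂ → CMat n) (j : Fin m)
    (z : ℂ) : CMat n :=
  if |pole j| < b then dslope (fun w => G w * complexify (res j) * (G w)⁻¹) (pole j) z
  else (z - (pole j : ℂ))⁻¹ • (G z * complexify (res j) * (G z)⁻¹)

lemma differentiableOn_poleRemainder (hG : DifferentiableOn ℂ G (ball 0 b))
    (hGu : ∀ z ∈ ball (0 : ℂ) b, IsUnit (G z)) (j : Fin m) :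
    DifferentiableOn ℂ (poleRemainder pole res b G j) (ball 0 b) := by
  have hP : DifferentiableOn ℂ (fun w => G w * complexify (res j) * (G w)⁻¹) (ball 0 b) :=
    (hG.mul_const _).mul (CMat.differentiableOn_inv isOpen_ball hG hGu)
  unfold poleRemainder
  split_ifs with h
  · refine (Complex.differentiableOn_dslope (isOpen_ball.mem_nhds ?_)).2 hP
    simpa using h
  · refine DifferentiableOn.smul (DifferentiableOn.inv
      (differentiableOn_id.sub (differentiableOn_const _)) fun z hz h0 => ?_) hP
    change z - _ = 0 at h0
    rw [sub_eq_zero] at h0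
    rw [h0, mem_ball_zero_iff, norm_real, Real.norm_eq_abs] at hz
    exact h hz

/-- A pole outside the disk contributes nothing to the principal part and stays in the remainder,
holomorphic in the disk. A pole with zero residue is no singular point, so z may coincide with it:
both sides are then 0. -/
lemma poleRemainder_eq {j : Fin m} {z : ℂ} (hz : res j ≠ 0 → z ≠ pole j) :
    poleRemainder pole res b G j z + (z - (pole j : ℂ))⁻¹ • gaugeRes pole res b G j =
      (z - (pole j : ℂ))⁻¹ • (G z * complexify (res j) * (G z)⁻¹) := by
  unfold poleRemainder gaugeRes
  split_ifs with h
  · by_cases hr : res j = 0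
    · simp only [hr, complexify_zero, mul_zero, zero_mul, smul_zero, add_zero]
      by_cases hzp : z = pole j
      · rw [hzp, dslope_same]; exact deriv_const _ _
      · rw [dslope_of_ne _ hzp, slope_def_module]; simp
    · rw [dslope_of_ne _ (hz hr), slope_def_module, smul_sub, sub_add_cancel]
  · rw [smul_zero, add_zero]

/-- The transformed coefficient is its principal part plus an entire function. -/
theorem exists_entire_remainder (h : IsGauge (coeffMatrix pole res poly) σ b L G F E) (hσ : 0 < σ)
    (hσb : σ < b) (hp : ∀ j, res j ≠ 0 → |pole j| < σ ∨ b < |pole j|) :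
    ∃ H : ℂ → CMat n, Differentiable ℂ H ∧ ConjSymm H Set.univ ∧
      (∀ z ∈ ball (0 : ℂ) b, (∀ j, res j ≠ 0 → z ≠ pole j) →
        HasDerivAt G ((gaugePrincipal pole res b G z + H z) * G z -
          G z * coeffMatrix pole res poly z) z) ∧
      ∀ z ∈ exterior σ, HasDerivAt E ((gaugePrincipal pole res b G z + H z) * E z -
        z⁻¹ • (E z * L)) z := by
  -- Inside, the transform of A minus the principal part; outside, the coefficient of the equation
  -- solved by E(z) z^L minus the same principal part. They agree on the annulus by
  -- `IsGauge.transform_eq`.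
  obtain ⟨Hin, hHin⟩ : ∃ Hin : ℂ → CMat n, Hin = fun z => deriv G z * (G z)⁻¹ +
      ∑ j, poleRemainder pole res b G j z +
      ∑ k : Fin (r + 1), z ^ (k : ℕ) • (G z * complexify (poly k) * (G z)⁻¹) := ⟨_, rfl⟩
  obtain ⟨Hout, hHout⟩ : ∃ Hout : ℂ → CMat n, Hout = fun z => deriv E z * (E z)⁻¹ +
      z⁻¹ • (E z * L * (E z)⁻¹) - gaugePrincipal pole res b G z := ⟨_, rfl⟩
  have hGi := CMat.differentiableOn_inv isOpen_ball h.G_diff h.G_unit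
  have hEi := CMat.differentiableOn_inv (isOpen_exterior σ) h.E_diff h.E_unit
  have hne : ∀ z ∈ exterior σ, z ≠ 0 := fun z hz => norm_pos_iff.1 (hσ.trans hz)
  have hin_d : DifferentiableOn ℂ Hin (ball 0 b) := by
    rw [hHin]
    refine (((h.G_diff.deriv isOpen_ball).mul hGi).add ?_).add ?_
    · exact DifferentiableOn.fun_sum fun j _ => differentiableOn_poleRemainder h.G_diff h.G_unit j
    · exact DifferentiableOn.fun_sum fun k _ =>
        DifferentiableOn.smul (differentiableOn_pow _) ((h.G_diff.mul_const _).mul hGi)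
  have hout_d : DifferentiableOn ℂ Hout (exterior σ) := by
    rw [hHout]
    refine (((h.E_diff.deriv (isOpen_exterior σ)).mul hEi).add ?_).sub
      (differentiableOn_gaugePrincipal hp)
    exact DifferentiableOn.smul (differentiableOn_inv.mono fun z hz => hne z hz)
      ((h.E_diff.mul_const _).mul hEi)
  have hin_eq : ∀ z ∈ ball (0 : ℂ) b, (∀ j, res j ≠ 0 → z ≠ pole j) →
      gaugePrincipal pole res b G z + Hin z =
        deriv G z * (G z)⁻¹ + G z * coeffMatrix pole res poly z * (G z)⁻¹ := by
    intro z _ hz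
    have e1 : ∑ j, poleRemainder pole res b G j z + gaugePrincipal pole res b G z =
        ∑ j, (z - (pole j : ℂ))⁻¹ • (G z * complexify (res j) * (G z)⁻¹) := by
      rw [gaugePrincipal, ← Finset.sum_add_distrib]
      exact Finset.sum_congr rfl fun j _ => poleRemainder_eq (hz j)
    have e2 : G z * coeffMatrix pole res poly z * (G z)⁻¹ =
        ∑ j, (z - (pole j : ℂ))⁻¹ • (G z * complexify (res j) * (G z)⁻¹) +
        ∑ k : Fin (r + 1), z ^ (k : ℕ) • (G z * complexify (poly k) * (G z)⁻¹) := by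
      rw [coeffMatrix, mul_add, add_mul, Finset.mul_sum, Finset.sum_mul, Finset.mul_sum,
        Finset.sum_mul]
      simp only [mul_smul_comm, smul_mul_assoc]
    rw [e2, ← e1, hHin]
    beta_reduce
    abel
  have hann : ∀ z ∈ annulus σ b, ∀ j, res j ≠ 0 → z ≠ pole j := fun z hz j hj hzj => by
    have h1 : ‖z‖ = |pole j| := by rw [hzj, norm_real, Real.norm_eq_abs]
    have h2 := hz.1
    have h3 := hz.2
    rcases hp j hj with h4 | h4 <;> linarith
  have hinout : ∀ z ∈ annulus σ b, Hin z = Hout z := fun z hz => by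
    have h1 := hin_eq z (by simpa using hz.2) (hann z hz)
    rw [h.transform_eq hz] at h1
    rw [hHout]
    simp only
    rw [← h1]; abel
  obtain ⟨H, hH⟩ : ∃ H : ℂ → CMat n, H = fun z => if ‖z‖ < b then Hin z else Hout z := ⟨_, rfl⟩
  have hH1 : ∀ z ∈ ball (0 : ℂ) b, H z = Hin z := fun z hz => by
    rw [hH]; exact if_pos (by simpa using hz)
  have hH2 : ∀ z ∈ exterior σ, H z = Hout z := fun z hz => by
    by_cases hb : ‖z‖ < b
    · rw [hH1 z (by simpa using hb), hinout z ⟨hz, hb⟩]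
    · rw [hH]; exact if_neg hb
  have hHd : Differentiable ℂ H := fun z => by
    by_cases hb : ‖z‖ < b
    · have hz : z ∈ ball (0 : ℂ) b := by simpa using hb
      refine (hin_d.differentiableAt (isOpen_ball.mem_nhds hz)).congr_of_eventuallyEq ?_
      filter_upwards [isOpen_ball.mem_nhds hz] with w hw using hH1 w hw
    · have hz : z ∈ exterior σ := hσb.trans_le (not_lt.1 hb)
      refine (hout_d.differentiableAt ((isOpen_exterior σ).mem_nhds hz)).congr_of_eventuallyEq ?_
      filter_upwards [(isOpen_exterior σ).mem_nhds hz] with w hw using hH2 w hw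
  have hout_s : ∀ z ∈ exterior σ, cj (H ((starRingEnd ℂ) z)) = H z := fun z hz => by
    have hz' := conj_mem_exterior hz
    rw [hH2 _ hz', hH2 z hz, hHout]
    have hd := ConjSymm.deriv (isOpen_exterior σ) (fun z hz => conj_mem_exterior hz) h.E_diff
      h.E_symm z hz
    simp only
    rw [gaugePrincipal_conj h.G_symm, hd, h.E_symm z hz, ← cj_inv, ← map_inv₀]
    conv_lhs => rw [← h.L_real]
    rw [← cj_mul, ← cj_mul, ← cj_mul, ← cj_smul, ← cj_add, ← cj_sub, cj_cj]
  -- The symmetry has been checked in the exterior, where no singularity had to be removed, and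
  -- spreads by the identity theorem.
  have hHs : ConjSymm H Set.univ := by
    obtain ⟨w, hw⟩ : ∃ w : ℂ, w ∈ exterior σ := ⟨(σ + 1 : ℝ), by
      change σ < ‖((σ + 1 : ℝ) : ℂ)‖
      rw [norm_real, Real.norm_of_nonneg (by linarith)]; linarith⟩
    have hd2 : Differentiable ℂ fun z => cj (H ((starRingEnd ℂ) z)) := fun z => by
      have := (hHd ((starRingEnd ℂ) z)).hasDerivAt.cj_conj
      rw [Complex.conj_conj] at this
      exact this.differentiableAt
    have h1 := AnalyticOnNhd.eq_of_eventuallyEq (𝕜 := ℂ)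
      (f := fun z => cj (H ((starRingEnd ℂ) z))) (g := H)
      (fun z _ => hd2.analyticAt z) (fun z _ => hHd.analyticAt z) (z₀ := w) (by
        filter_upwards [(isOpen_exterior σ).mem_nhds hw] with z hz using hout_s z hz)
    intro z _
    have : cj (H ((starRingEnd ℂ) z)) = H z := congrFun h1 z
    rw [← this, cj_cj]
  refine ⟨H, hHd, hHs, fun z hz hzp => ?_, fun z hz => ?_⟩
  · have h1 := h.G_diff.hasDerivAt (isOpen_ball.mem_nhds hz)
    convert! h1 using 1
    rw [hH1 z hz, hin_eq z hz hzp, add_mul, mul_assoc, mul_assoc _ _ (G z),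
      CMat.inv_mul (h.G_unit z hz), mul_one, mul_one, add_sub_cancel_right]
    rfl
  · have h1 := h.E_diff.hasDerivAt ((isOpen_exterior σ).mem_nhds hz)
    convert! h1 using 1
    rw [hH2 z hz, hHout]
    simp only
    rw [add_sub_cancel, add_mul, smul_mul_assoc, mul_assoc, mul_assoc _ _ (E z),
      CMat.inv_mul (h.E_unit z hz), mul_one, mul_one, add_sub_cancel_right]
    rfl

end Remainder

end

noncomputable section

open Complex Metric

/-! ### Bounds for the coefficients of the new system. -/

section Bounds

variable {n m r : ℕ} {pole : Fin m → ℝ} {res : Fin m → RMat n} {poly : Fin (r + 1) → RMat n}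
  {σ b : ℝ} {L : CMat n} {G F E H : ℂ → CMat n}

lemma norm_gaugePrincipal_le {z : ℂ} {δ : ℝ} (hδ : 0 < δ)
    (hz : ∀ j, gaugeRes pole res b G j ≠ 0 → δ ≤ ‖z - pole j‖) :
    ‖gaugePrincipal pole res b G z‖ ≤ δ⁻¹ * ∑ j, ‖gaugeRes pole res b G j‖ := by
  unfold gaugePrincipal
  rw [Finset.mul_sum]
  refine norm_sum_le_of_le _ fun j _ => ?_
  by_cases h0 : gaugeRes pole res b G j = 0
  · simp [h0]
  · rw [norm_smul, norm_inv]
    exact mul_le_mul_of_nonneg_right (inv_anti₀ hδ (hz j h0)) (norm_nonneg _)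

/-- Polynomial growth of the entire part of the transformed coefficient. -/
lemma growth_of_remainder (hσ : σ < 1) (hEd : DifferentiableOn ℂ E (exterior σ))
    (hEu : ∀ z ∈ exterior σ, IsUnit (E z)) (hpole : ∀ j, |pole j| ≤ 1)
    (hE : ∀ z ∈ exterior σ, HasDerivAt E ((gaugePrincipal pole res b G z + H z) * E z -
        z⁻¹ • (E z * L)) z) {N N' : ℕ}
    (hg : ∃ c : ℝ, ∀ z, 1 ≤ ‖z‖ → ‖E z‖ ≤ c * ‖z‖ ^ N ∧ ‖(E z)⁻¹‖ ≤ c * ‖z‖ ^ N') :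
    ∃ c : ℝ, ∀ z, 2 ≤ ‖z‖ → ‖H z‖ ≤ c * ‖z‖ ^ (N + N') := by
  obtain ⟨c, hc⟩ := hg
  have hc0 : 0 ≤ c := by
    have := (hc 1 (by simp)).1
    simp only [norm_one, one_pow, mul_one] at this
    exact (norm_nonneg _).trans this
  refine ⟨2 ^ N * c * c + c * ‖L‖ * c + ∑ j, ‖gaugeRes pole res b G j‖, fun z hz => ?_⟩
  have hz0 : z ≠ 0 := norm_pos_iff.1 (by linarith)
  have hzσ : z ∈ exterior σ := show σ < ‖z‖ by linarith
  obtain ⟨e1, e2⟩ := hc z (by linarith)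
  have hpow : ∀ k : ℕ, 1 ≤ ‖z‖ ^ k := fun k => one_le_pow₀ (by linarith)
  -- Cauchy's estimate on the unit circle about z, where |w| ≤ 2 |z|.
  have hder : ‖deriv E z‖ ≤ 2 ^ N * c * ‖z‖ ^ N := by
    have hsub : closedBall z 1 ⊆ exterior σ := fun w hw => by
      have h1 : ‖z - w‖ ≤ 1 := by rw [← dist_eq_norm, dist_comm]; exact hw
      have h2 := norm_sub_norm_le z w
      change σ < ‖w‖
      linarith
    have h1 := Complex.norm_deriv_le_of_forall_mem_sphere_norm_le (f := E) (c := z) one_pos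
      (C := 2 ^ N * c * ‖z‖ ^ N) ((hEd.mono hsub).diffContOnCl_ball Set.Subset.rfl) (fun w hw => by
        have h1 : ‖z - w‖ = 1 := by rw [← dist_eq_norm, dist_comm]; exact hw
        have h2 := norm_sub_norm_le z w
        have h3 := norm_sub_norm_le w z
        rw [norm_sub_rev, h1] at h3
        have h4 : ‖w‖ ≤ 2 * ‖z‖ := by linarith
        refine (hc w (by linarith)).1.trans ?_
        rw [mul_comm (2 ^ N) c, mul_assoc, ← mul_pow]
        gcongr)
    rw [div_one] at h1
    exact h1
  have hHz : H z = deriv E z * (E z)⁻¹ + z⁻¹ • (E z * L * (E z)⁻¹) -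
      gaugePrincipal pole res b G z := by
    have h1 : deriv E z = (gaugePrincipal pole res b G z + H z) * E z - z⁻¹ • (E z * L) :=
      (hE z hzσ).deriv
    rw [h1, sub_mul, mul_assoc, CMat.mul_inv (hEu z hzσ), mul_one, smul_mul_assoc]
    abel
  have hP : ‖gaugePrincipal pole res b G z‖ ≤ ∑ j, ‖gaugeRes pole res b G j‖ := by
    have := norm_gaugePrincipal_le (pole := pole) (res := res) (b := b) (G := G) (z := z) one_pos
      (fun j _ => by
        have h1 := norm_sub_norm_le z (pole j)
        rw [norm_real, Real.norm_eq_abs] at h1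
        linarith [hpole j])
    simpa using this
  have hzi : ‖z⁻¹‖ ≤ 1 := by rw [norm_inv]; exact inv_le_one_of_one_le₀ (by linarith)
  have t1 : ‖deriv E z * (E z)⁻¹‖ ≤ 2 ^ N * c * c * ‖z‖ ^ (N + N') := by
    refine (norm_mul_le _ _).trans ((mul_le_mul hder e2 (norm_nonneg _) (by positivity)).trans_eq ?_)
    rw [pow_add]; ring
  have t2 : ‖z⁻¹ • (E z * L * (E z)⁻¹)‖ ≤ c * ‖L‖ * c * ‖z‖ ^ (N + N') := by
    rw [norm_smul]
    calc ‖z⁻¹‖ * ‖E z * L * (E z)⁻¹‖ ≤ 1 * (‖E z‖ * ‖L‖ * ‖(E z)⁻¹‖) := by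
          gcongr
          exact (norm_mul_le _ _).trans (mul_le_mul_of_nonneg_right (norm_mul_le _ _) (norm_nonneg _))
      _ ≤ 1 * (c * ‖z‖ ^ N * ‖L‖ * (c * ‖z‖ ^ N')) := by gcongr
      _ = _ := by rw [pow_add]; ring
  have t3 : ‖gaugePrincipal pole res b G z‖ ≤
      (∑ j, ‖gaugeRes pole res b G j‖) * ‖z‖ ^ (N + N') :=
    hP.trans (le_mul_of_one_le_right (Finset.sum_nonneg fun j _ => norm_nonneg _) (hpow _))
  rw [hHz, add_mul, add_mul]
  exact (norm_sub_le _ _).trans (add_le_add ((norm_add_le _ _).trans (add_le_add t1 t2)) t3)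

/-- Residue bounds and a bound on a circle for the transformed coefficient. -/
lemma norm_remainder_le {ρ δ κ₁ κ₂ K : ℝ} (hδ : 0 < δ) (hδ1 : δ < ρ) (hρb : ρ + δ < b)
    (hGd : DifferentiableOn ℂ G (ball 0 b)) (hGu : ∀ z ∈ ball (0 : ℂ) b, IsUnit (G z))
    (hGb : ∀ w : ℂ, ρ - δ ≤ ‖w‖ → ‖w‖ ≤ ρ + δ → ‖G w‖ ≤ κ₁ ∧ ‖(G w)⁻¹‖ ≤ κ₂)
    (hp : ∀ j, res j ≠ 0 → |pole j| ≤ ρ - δ ∨ b < |pole j|)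
    (hG : ∀ z ∈ ball (0 : ℂ) b, (∀ j, res j ≠ 0 → z ≠ pole j) →
        HasDerivAt G ((gaugePrincipal pole res b G z + H z) * G z -
          G z * coeffMatrix pole res poly z) z)
    (hA : ∀ z : ℂ, ‖z‖ = ρ → ‖coeffMatrix pole res poly z‖ ≤ K) {s : ℝ} (hs : ∑ j, ‖res j‖ ≤ s) :
    ∑ j, ‖gaugeRes pole res b G j‖ ≤ κ₁ * κ₂ * s ∧
      ∀ z : ℂ, ‖z‖ = ρ → ‖H z‖ ≤ κ₁ * κ₂ * (δ⁻¹ + K + δ⁻¹ * s) := by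
  have hρ0 : 0 < ρ := hδ.trans hδ1
  have hw : ‖((ρ : ℝ) : ℂ)‖ = ρ := by rw [norm_real, Real.norm_of_nonneg hρ0.le]
  have hκ₁ : 0 ≤ κ₁ := (norm_nonneg _).trans (hGb (ρ : ℂ) (by linarith) (by linarith)).1
  have hκ₂ : 0 ≤ κ₂ := (norm_nonneg _).trans (hGb (ρ : ℂ) (by linarith) (by linarith)).2
  have hGi := CMat.differentiableOn_inv isOpen_ball hGd hGu
  have hsub : closedBall (0 : ℂ) ρ ⊆ ball 0 b := closedBall_subset_ball (by linarith)
  -- Maximum principle: bounds for G and G⁻¹ on |z| = ρ hold at all the poles inside, whose mutual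
  -- distances play no role.
  have hmax : ∀ (f : ℂ → CMat n) (C : ℝ), DifferentiableOn ℂ f (ball 0 b) →
      (∀ z : ℂ, ‖z‖ = ρ → ‖f z‖ ≤ C) → ∀ z : ℂ, ‖z‖ ≤ ρ → ‖f z‖ ≤ C := fun f C hf hC z hz =>
    Complex.norm_le_of_forall_mem_frontier_norm_le isBounded_ball
      ((hf.mono hsub).diffContOnCl_ball Set.Subset.rfl)
      (fun w hw => hC w (by rw [frontier_ball _ hρ0.ne'] at hw; simpa using hw))
      (by rw [closure_ball _ hρ0.ne']; simpa using hz)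
  have hG1 := hmax G κ₁ hGd fun z hz => (hGb z (by linarith) (by linarith)).1
  have hG2 := hmax _ κ₂ hGi fun z hz => (hGb z (by linarith) (by linarith)).2
  have hres : ∀ j, ‖gaugeRes pole res b G j‖ ≤ κ₁ * κ₂ * ‖res j‖ := fun j => by
    by_cases hr : res j = 0
    · simp [gaugeRes_of_res_eq_zero hr, hr]
    · unfold gaugeRes
      split_ifs with hb
      · have hpj : ‖((pole j : ℝ) : ℂ)‖ ≤ ρ := by
          rw [norm_real, Real.norm_eq_abs]
          rcases hp j hr with h | h <;> linarith
        calc ‖G (pole j) * complexify (res j) * (G (pole j))⁻¹‖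
            ≤ ‖G (pole j)‖ * ‖complexify (res j)‖ * ‖(G (pole j))⁻¹‖ :=
              (norm_mul_le _ _).trans (mul_le_mul_of_nonneg_right (norm_mul_le _ _) (norm_nonneg _))
          _ ≤ κ₁ * ‖res j‖ * κ₂ := by
              rw [norm_complexify]
              exact mul_le_mul (mul_le_mul_of_nonneg_right (hG1 _ hpj) (norm_nonneg _)) (hG2 _ hpj)
                (norm_nonneg _) (by positivity)
          _ = _ := by ring
      · rw [norm_zero]; positivity
  have hsum : ∑ j, ‖gaugeRes pole res b G j‖ ≤ κ₁ * κ₂ * s := by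
    refine (Finset.sum_le_sum fun j _ => hres j).trans ?_
    rw [← Finset.mul_sum]
    exact mul_le_mul_of_nonneg_left hs (by positivity)
  refine ⟨hsum, fun z hz => ?_⟩
  have hzb : z ∈ ball (0 : ℂ) b := by rw [mem_ball_zero_iff]; linarith
  have hdist : ∀ j, res j ≠ 0 → |pole j| < b → δ ≤ ‖z - pole j‖ := fun j hj hjb => by
    have h1 := norm_sub_norm_le z (pole j)
    rw [norm_real, Real.norm_eq_abs] at h1
    rcases hp j hj with h | h <;> linarith
  have hzp : ∀ j, res j ≠ 0 → z ≠ pole j := fun j hj hzj => by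
    have h1 : ‖z‖ = |pole j| := by rw [hzj, norm_real, Real.norm_eq_abs]
    rcases hp j hj with h | h <;> linarith
  have hder : ‖deriv G z‖ ≤ κ₁ / δ := by
    have hd : closedBall z δ ⊆ ball 0 b := fun w hw => by
      have h1 : ‖w - z‖ ≤ δ := by rw [← dist_eq_norm]; exact hw
      have h2 := norm_sub_norm_le w z
      rw [mem_ball_zero_iff]; linarith
    refine Complex.norm_deriv_le_of_forall_mem_sphere_norm_le hδ
      ((hGd.mono hd).diffContOnCl_ball Set.Subset.rfl) fun w hw => ?_
    have h1 : ‖w - z‖ = δ := by rw [← dist_eq_norm]; exact hw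
    have h2 := norm_sub_norm_le w z
    have h3 := norm_sub_norm_le z w
    rw [norm_sub_rev] at h3
    exact (hGb w (by linarith) (by linarith)).1
  have hHz : H z = deriv G z * (G z)⁻¹ + G z * coeffMatrix pole res poly z * (G z)⁻¹ -
      gaugePrincipal pole res b G z := by
    have h1 : deriv G z = (gaugePrincipal pole res b G z + H z) * G z -
        G z * coeffMatrix pole res poly z := (hG z hzb hzp).deriv
    rw [h1, sub_mul, mul_assoc, CMat.mul_inv (hGu z hzb), mul_one]
    abel
  have hP : ‖gaugePrincipal pole res b G z‖ ≤ δ⁻¹ * (κ₁ * κ₂ * s) := by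
    refine (norm_gaugePrincipal_le hδ fun j hj => ?_).trans
      (mul_le_mul_of_nonneg_left hsum (by positivity))
    refine hdist j (fun h0 => hj (gaugeRes_of_res_eq_zero h0)) ?_
    by_contra hcon
    exact hj (if_neg hcon)
  have b1 := hG1 z hz.le
  have b2 := hG2 z hz.le
  have hK0 : 0 ≤ K := (norm_nonneg _).trans (hA z hz)
  have t1 : ‖deriv G z * (G z)⁻¹‖ ≤ κ₁ / δ * κ₂ :=
    (norm_mul_le _ _).trans (mul_le_mul hder b2 (norm_nonneg _) (by positivity))
  have t2 : ‖G z * coeffMatrix pole res poly z * (G z)⁻¹‖ ≤ κ₁ * K * κ₂ :=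
    (norm_mul_le _ _).trans (mul_le_mul ((norm_mul_le _ _).trans
      (mul_le_mul b1 (hA z hz) (norm_nonneg _) hκ₁)) b2 (norm_nonneg _) (by positivity))
  rw [hHz]
  refine (norm_sub_le _ _).trans ((add_le_add ((norm_add_le _ _).trans (add_le_add t1 t2)) hP).trans_eq ?_)
  rw [div_eq_mul_inv]; ring

/-- Real coefficients, padded by zeros. -/
def paddedPoly (p : ℕ → CMat n) (D r' : ℕ) (k : Fin (r' + 1)) : RMat n :=
  if (k : ℕ) ≤ D then reMat (p k) else 0

lemma coeffMatrix_paddedPoly (hG : ConjSymm G (ball 0 b)) {p : ℕ → CMat n} {D r' : ℕ}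
    (hp : ∀ k, cj (p k) = p k) (hD : D ≤ r') (z : ℂ) :
    coeffMatrix pole (fun j => reMat (gaugeRes pole res b G j)) (paddedPoly p D r') z =
      gaugePrincipal pole res b G z + ∑ k ∈ Finset.range (D + 1), z ^ k • p k := by
  unfold coeffMatrix gaugePrincipal
  congr 1
  · exact Finset.sum_congr rfl fun j _ => by rw [complexify_reMat (cj_gaugeRes hG j)]
  · have h1 : ∀ k : Fin (r' + 1), z ^ (k : ℕ) • complexify (paddedPoly p D r' k) =
        (fun k : ℕ => if k ≤ D then z ^ k • p k else 0) k := fun k => by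
      unfold paddedPoly
      beta_reduce
      split_ifs
      · rw [complexify_reMat (hp _)]
      · rw [complexify_zero, smul_zero]
    rw [Finset.sum_congr rfl fun k _ => h1 k, Fin.sum_univ_eq_sum_range
      (fun k : ℕ => if k ≤ D then z ^ k • p k else 0), ← Finset.sum_filter]
    refine Finset.sum_congr ?_ fun _ _ => rfl
    ext k
    simp only [Finset.mem_filter, Finset.mem_range]
    omega

lemma sum_norm_paddedPoly_le {p : ℕ → CMat n} {D r' : ℕ} (hp : ∀ k, cj (p k) = p k) (hD : D ≤ r')
    {h ρ : ℝ} (hh : 0 ≤ h) (hρ : 0 < ρ) (hρ1 : ρ ≤ 1) (hb : ∀ k, ‖p k‖ ≤ h / ρ ^ k) :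
    ∑ k, ‖paddedPoly p D r' k‖ ≤ (D + 1) * (h / ρ ^ D) := by
  have h1 : ∀ k : Fin (r' + 1), ‖paddedPoly p D r' k‖ ≤
      (fun k : ℕ => if k ≤ D then h / ρ ^ D else 0) k := fun k => by
    unfold paddedPoly
    beta_reduce
    split_ifs with hk
    · rw [← norm_complexify, complexify_reMat (hp _)]
      refine (hb k).trans (div_le_div_of_nonneg_left hh (by positivity) ?_)
      exact pow_le_pow_of_le_one hρ.le hρ1 hk
    · rw [norm_zero]
  refine (Finset.sum_le_sum fun k _ => h1 k).trans ?_
  rw [Fin.sum_univ_eq_sum_range (fun k : ℕ => if k ≤ D then h / ρ ^ D else 0), ← Finset.sum_filter]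
  have : (Finset.range (r' + 1)).filter (fun k => k ≤ D) = Finset.range (D + 1) := by
    ext k
    simp only [Finset.mem_filter, Finset.mem_range]
    omega
  rw [this, Finset.sum_const, Finset.card_range, nsmul_eq_mul]
  push_cast; rfl

end Bounds

end

noncomputable section

open Complex Metric

/-! ### Continuation and monodromy under gauge transformations. -/

section Continuation

variable {n : ℕ} {A B : ℂ → CMat n}

/-- The equation G' = B G - G A means that X ↦ G X carries solutions of A to solutions of B. The
constant C serves to renormalize at the base point. -/
lemma IsContinuationAlong.gauge {x y : ℂ} {γ : Path x y} {Y : unitInterval → CMat n}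
    (hY : IsContinuationAlong A γ Y) {G : ℂ → CMat n}
    (hG : ∀ τ, ∀ᶠ z in nhds (γ τ), HasDerivAt G (B z * G z - G z * A z) z) (C : CMat n) :
    IsContinuationAlong B γ fun τ => G (γ τ) * Y τ * C := fun τ => by
  obtain ⟨X, hX, hYX⟩ := hY τ
  refine ⟨fun z => G z * X z * C, ?_, ?_⟩
  · filter_upwards [hX, hG τ] with z h1 h2
    have h3 := (h2.fun_mul h1).mul_const C
    convert! h3 using 1
    rw [sub_mul]
    simp only [← mul_assoc]
    rw [sub_add_cancel]
  · filter_upwards [hYX] with s hs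
    rw [hs]

lemma IsMonodromyFactor.gauge {x : ℂ} {γ : Path x x} {M : CMat n} (hM : IsMonodromyFactor A γ M)
    {G : ℂ → CMat n} (hG : ∀ τ, ∀ᶠ z in nhds (γ τ), HasDerivAt G (B z * G z - G z * A z) z)
    (hu : IsUnit (G x)) : IsMonodromyFactor B γ (G x * M * (G x)⁻¹) := by
  obtain ⟨Y, hY, hY0, hY1⟩ := hM
  refine ⟨_, hY.gauge hG (G x)⁻¹, ?_, ?_⟩
  · simp [hY0, CMat.mul_inv hu]
  · simp [hY1]

lemma HasDerivAt.gauge_inv {G : ℂ → CMat n} {z : ℂ} (h : HasDerivAt G (B z * G z - G z * A z) z)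
    (hu : IsUnit (G z)) :
    HasDerivAt (fun z => (G z)⁻¹) (A z * (G z)⁻¹ - (G z)⁻¹ * B z) z := by
  convert! CMat.hasDerivAt_inv h hu using 1
  rw [mul_sub, sub_mul, ← mul_assoc, ← mul_assoc, CMat.inv_mul hu, one_mul, mul_assoc _ (G z),
    CMat.mul_inv hu, mul_one, neg_sub]

/-- Gauge-equivalent systems have conjugate monodromy. -/
lemma isMonodromyFactor_gauge_iff {x : ℂ} {γ : Path x x} {M : CMat n} {G : ℂ → CMat n} {V : Set ℂ}
    (hV : IsOpen V) (hγ : ∀ τ, γ τ ∈ V)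
    (hG : ∀ z ∈ V, IsUnit (G z) ∧ HasDerivAt G (B z * G z - G z * A z) z) :
    IsMonodromyFactor A γ M ↔ IsMonodromyFactor B γ (G x * M * (G x)⁻¹) := by
  have hx : x ∈ V := by simpa using hγ 0
  have hu := (hG x hx).1
  constructor
  · intro h
    refine h.gauge (fun τ => ?_) hu
    filter_upwards [hV.mem_nhds (hγ τ)] with z hz using (hG z hz).2
  · intro h
    have h1 := h.gauge (G := fun z => (G z)⁻¹) (B := A) (fun τ => by
      filter_upwards [hV.mem_nhds (hγ τ)] with z hz using (hG z hz).2.gauge_inv (hG z hz).1)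
      (CMat.isUnit_inv hu)
    have h2 : (G x)⁻¹ * (G x * M * (G x)⁻¹) * ((G x)⁻¹)⁻¹ = M := by
      rw [Matrix.nonsing_inv_nonsing_inv _ ((Matrix.isUnit_iff_isUnit_det _).1 hu), mul_assoc,
        mul_assoc, CMat.inv_mul hu, mul_one, ← mul_assoc, CMat.inv_mul hu, one_mul]
    rwa [h2] at h1

end Continuation

/-! ### Growth of solutions at infinity. -/

section Growth

variable {n : ℕ} {B E : ℂ → CMat n} {L : CMat n} {σ : ℝ}

lemma hasDerivAt_inv_of_exterior {z : ℂ} (hE : HasDerivAt E (B z * E z - z⁻¹ • (E z * L)) z)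
    (hu : IsUnit (E z)) :
    HasDerivAt (fun z => (E z)⁻¹) (z⁻¹ • (L * (E z)⁻¹) - (E z)⁻¹ * B z) z := by
  convert! CMat.hasDerivAt_inv hE hu using 1
  rw [mul_sub, sub_mul, ← mul_assoc, mul_smul_comm, smul_mul_assoc, ← mul_assoc, CMat.inv_mul hu,
    one_mul, mul_assoc _ (E z), CMat.mul_inv hu, mul_one, neg_sub]

/-- On the logarithmic chart a solution is `E(t) t ^ L` times a constant. -/
lemma exists_const_of_solution {W V : Set ℂ} (hW : Convex ℝ W) {X : ℂ → CMat n} {w : ℂ}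
    (hV : ∀ s ∈ W, w * Complex.exp s ∈ V) (hw : w ≠ 0)
    (hE : ∀ z ∈ V, IsUnit (E z) ∧ HasDerivAt E (B z * E z - z⁻¹ • (E z * L)) z)
    (hX : ∀ z ∈ V, HasDerivAt X (B z * X z) z) {s₀ : ℂ} (hs₀ : s₀ ∈ W) :
    ∃ C : CMat n, ∀ s ∈ W, X (w * Complex.exp s) = E (w * Complex.exp s) * expFlow L s * C := by
  set D : ℂ → CMat n := fun s =>
    expFlow L (-s) * ((E (w * Complex.exp s))⁻¹ * X (w * Complex.exp s)) with hD
  have hd : ∀ s ∈ W, HasDerivAt D 0 s := fun s hs => by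
    have hz := hV s hs
    obtain ⟨z, hzdef⟩ : ∃ z, z = w * Complex.exp s := ⟨_, rfl⟩
    rw [← hzdef] at hz
    have hz0 : z ≠ 0 := by rw [hzdef]; exact mul_ne_zero hw (Complex.exp_ne_zero s)
    have h1 := (hasDerivAt_inv_of_exterior (hE z hz).2 (hE z hz).1).fun_mul (hX z hz)
    have h2 : HasDerivAt (fun s => w * Complex.exp s) z s := by
      rw [hzdef]; exact (Complex.hasDerivAt_exp s).const_mul w
    rw [hzdef] at h1
    have h3 := HasDerivAt.scomp (g₁ := fun z => (E z)⁻¹ * X z) (h := fun s => w * Complex.exp s) s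
      h1 h2
    rw [← hzdef] at h3
    have h4 : HasDerivAt (fun s => expFlow L (-s)) (-(expFlow L (-s) * L)) s := by
      have := HasDerivAt.scomp (g₁ := expFlow L) (h := fun s => -s) s (hasDerivAt_expFlow L (-s))
        (hasDerivAt_neg s)
      rwa [neg_smul, one_smul] at this
    have h5 := h4.fun_mul h3
    convert! h5 using 1
    rw [sub_mul, smul_mul_assoc, mul_assoc _ (B z), sub_add_cancel, smul_smul, mul_inv_cancel₀ hz0,
      one_smul]
    simp only [Function.comp_apply, ← hzdef]
    rw [neg_mul, mul_assoc, mul_assoc, neg_add_cancel]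
  refine ⟨D s₀, fun s hs => ?_⟩
  rw [← eq_of_hasDerivAt_zero hW hd hs₀ hs, hD]
  simp only
  rw [mul_assoc, ← mul_assoc (expFlow L s), expFlow_mul_neg, one_mul, ← mul_assoc,
    CMat.mul_inv (hE _ (hV s hs)).1, one_mul]

lemma log_mem_of_slitExterior {u t : ℂ} (hu : ‖u‖ = 1) (ht : t ∈ slitExterior u) :
    u * Complex.exp (Complex.log (t / u)) = t ∧ 0 < (Complex.log (t / u)).re ∧
      ‖Complex.log (t / u)‖ ≤ Real.log ‖t‖ + 4 ∧ |(Complex.log (t / u)).im| < Real.pi := by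
  have hu0 : u ≠ 0 := norm_pos_iff.1 (by rw [hu]; exact one_pos)
  have ht0 : t ≠ 0 := norm_pos_iff.1 (one_pos.trans ht.1)
  have hre : (Complex.log (t / u)).re = Real.log ‖t‖ := by
    rw [Complex.log_re, norm_div, hu, div_one]
  have hpos : 0 < Real.log ‖t‖ := Real.log_pos ht.1
  refine ⟨?_, by rw [hre]; exact hpos, ?_, ?_⟩
  · rw [Complex.exp_log (div_ne_zero ht0 hu0), mul_div_cancel₀ _ hu0]
  · refine (Complex.norm_le_abs_re_add_abs_im _).trans ?_
    rw [hre, abs_of_pos hpos, Complex.log_im]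
    linarith [Complex.abs_arg_le_pi (t / u), Real.pi_le_four]
  · rw [Complex.log_im, abs_lt]
    have h1 := Complex.mem_slitPlane_iff_arg.1 ht.2
    exact ⟨Complex.neg_pi_lt_arg _, lt_of_le_of_ne (Complex.arg_le_pi _) h1.1⟩

/-- Every branch is E(t) t^L times a constant, up to the choice of the base direction u, and t^L
grows with exponent at most ‖L‖ on a slit plane. The inverse is treated alike, so only N, N' and l
enter the exponents. -/
lemma fundamental_growth [NeZero n] (hσ : σ < 1)
    (hE : ∀ z ∈ exterior σ, IsUnit (E z) ∧ HasDerivAt E (B z * E z - z⁻¹ • (E z * L)) z)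
    {N N' l : ℕ} (hl : ‖L‖ ≤ l)
    (hg : ∃ c : ℝ, ∀ z, 1 ≤ ‖z‖ → ‖E z‖ ≤ c * ‖z‖ ^ N ∧ ‖(E z)⁻¹‖ ≤ c * ‖z‖ ^ N')
    {u : ℂ} (hu : ‖u‖ = 1) {X : ℂ → CMat n} (hX : IsFundamentalOn B X (slitExterior u)) :
    ∃ c : ℝ, ∀ t ∈ slitExterior u, ‖X t‖ ≤ c * ‖t‖ ^ (N + l) ∧
      ‖(X t)⁻¹‖ ≤ c * ‖t‖ ^ (N' + l) := by
  obtain ⟨c, hc⟩ := hg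
  have hu0 : u ≠ 0 := norm_pos_iff.1 (by rw [hu]; exact one_pos)
  have hc0 : 0 ≤ c := by
    have := (hc 1 (by simp)).1
    simp only [norm_one, one_pow, mul_one] at this
    exact (norm_nonneg _).trans this
  -- The half-strip is a single logarithmic chart for the whole slit exterior, through s ↦ u e^s.
  set W : Set ℂ := {s | 0 < s.re} ∩ ({s | -Real.pi < s.im} ∩ {s | s.im < Real.pi}) with hWdef
  have hW : Convex ℝ W := (convex_halfSpace_re_gt 0).inter
    ((convex_halfSpace_im_gt _).inter (convex_halfSpace_im_lt _))
  have hslit : ∀ s ∈ W, u * Complex.exp s ∈ slitExterior u := fun s hs => by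
    have him : s.im < Real.pi := hs.2.2
    constructor
    · rw [norm_mul, hu, one_mul, Complex.norm_exp]; exact Real.one_lt_exp_iff.2 hs.1
    · rw [mul_div_cancel_left₀ _ hu0, Complex.mem_slitPlane_iff_arg, Complex.arg_exp,
        (toIocMod_eq_self _).2 ⟨hs.2.1, by linarith⟩]
      exact ⟨him.ne, Complex.exp_ne_zero s⟩
  have hext : ∀ z ∈ slitExterior u, z ∈ exterior σ := fun z hz => hσ.trans hz.1
  have h1W : (1 : ℂ) ∈ W := ⟨by simp, by simp [Real.pi_pos], by simp [Real.pi_pos]⟩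
  obtain ⟨C, hC⟩ := exists_const_of_solution hW hslit hu0
    (fun z hz => hE z (hext z hz)) (fun z hz => (hX z hz).1) h1W
  refine ⟨c * Real.exp (‖L‖ * 4) * (‖C‖ + ‖C⁻¹‖), fun t ht => ?_⟩
  obtain ⟨e1, e2, e3, e4⟩ := log_mem_of_slitExterior hu ht
  set s := Complex.log (t / u)
  have ht1 : 1 < ‖t‖ := ht.1
  have hXt := hC s ⟨e2, (abs_lt.1 e4).1, (abs_lt.1 e4).2⟩
  rw [e1] at hXt
  have hflow : ∀ s' : ℂ, ‖s'‖ ≤ Real.log ‖t‖ + 4 →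
      ‖expFlow L s'‖ ≤ Real.exp (‖L‖ * 4) * ‖t‖ ^ l := fun s' hs' => by
    refine (norm_expFlow_le L s').trans ?_
    calc Real.exp (‖L‖ * ‖s'‖) ≤ Real.exp (‖L‖ * 4 + l * Real.log ‖t‖) := by
          refine Real.exp_le_exp.2 ?_
          have h1 : ‖L‖ * ‖s'‖ ≤ ‖L‖ * (Real.log ‖t‖ + 4) :=
            mul_le_mul_of_nonneg_left hs' (norm_nonneg _)
          have h2 : ‖L‖ * Real.log ‖t‖ ≤ l * Real.log ‖t‖ :=
            mul_le_mul_of_nonneg_right hl (Real.log_nonneg ht1.le)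
          linarith
      _ = _ := by
          rw [Real.exp_add, Real.exp_nat_mul, Real.exp_log (by linarith)]
  obtain ⟨b1, b2⟩ := hc t ht1.le
  have f1 := hflow s e3
  have f2 := hflow (-s) (by rwa [norm_neg])
  constructor
  · rw [hXt]
    calc ‖E t * expFlow L s * C‖ ≤ ‖E t‖ * ‖expFlow L s‖ * ‖C‖ :=
          (norm_mul_le _ _).trans (mul_le_mul_of_nonneg_right (norm_mul_le _ _) (norm_nonneg _))
      _ ≤ (c * ‖t‖ ^ N) * (Real.exp (‖L‖ * 4) * ‖t‖ ^ l) * (‖C‖ + ‖C⁻¹‖) := by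
          gcongr
          linarith [norm_nonneg C⁻¹]
      _ = _ := by rw [pow_add]; ring
  · rw [hXt, Matrix.mul_inv_rev, Matrix.mul_inv_rev, expFlow_inv]
    calc ‖C⁻¹ * (expFlow L (-s) * (E t)⁻¹)‖ ≤ ‖C⁻¹‖ * (‖expFlow L (-s)‖ * ‖(E t)⁻¹‖) :=
          (norm_mul_le _ _).trans (mul_le_mul_of_nonneg_left (norm_mul_le _ _) (norm_nonneg _))
      _ ≤ (‖C‖ + ‖C⁻¹‖) * ((Real.exp (‖L‖ * 4) * ‖t‖ ^ l) * (c * ‖t‖ ^ N')) := by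
          gcongr
          linarith [norm_nonneg C]
      _ = _ := by rw [pow_add]; ring

lemma regularAtInfinity_of_exterior [NeZero n] (hσ : σ < 1)
    (hE : ∀ z ∈ exterior σ, IsUnit (E z) ∧ HasDerivAt E (B z * E z - z⁻¹ • (E z * L)) z)
    {N N' l : ℕ} (hl : ‖L‖ ≤ l)
    (hg : ∃ c : ℝ, ∀ z, 1 ≤ ‖z‖ → ‖E z‖ ≤ c * ‖z‖ ^ N ∧ ‖(E z)⁻¹‖ ≤ c * ‖z‖ ^ N') :
    RegularAtInfinity B := fun u hu X hX => by
  obtain ⟨c, hc⟩ := fundamental_growth hσ hE hl hg hu hX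
  exact ⟨N + l, c, fun t ht _ => (hc t ht).1⟩

lemma growthAtInfinityLE_of_exterior [NeZero n] (hσ : σ < 1)
    (hE : ∀ z ∈ exterior σ, IsUnit (E z) ∧ HasDerivAt E (B z * E z - z⁻¹ • (E z * L)) z)
    {N N' l : ℕ} (hl : ‖L‖ ≤ l)
    (hg : ∃ c : ℝ, ∀ z, 1 ≤ ‖z‖ → ‖E z‖ ≤ c * ‖z‖ ^ N ∧ ‖(E z)⁻¹‖ ≤ c * ‖z‖ ^ N') {r : ℕ}
    (hr : N + l ≤ r) (hr' : N' + l ≤ r) : GrowthAtInfinityLE B r := fun u hu X hX v hv hvu => by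
  obtain ⟨c, hc⟩ := fundamental_growth hσ hE hl hg hu hX
  refine ⟨2 * |c| + 1, by positivity, ?_⟩
  filter_upwards [Filter.eventually_gt_atTop 1] with s hs
  have hs0 : 0 < s := by linarith
  have hn : ‖(s : ℂ) * v‖ = s := by rw [norm_mul, hv, mul_one, norm_real, Real.norm_of_nonneg hs0.le]
  have hmem : (s : ℂ) * v ∈ slitExterior u := by
    refine ⟨by rw [hn]; exact hs, ?_⟩
    rw [mul_div_assoc, Complex.mem_slitPlane_iff_arg] at *
    rw [Complex.arg_real_mul _ hs0]
    exact ⟨hvu.1, mul_ne_zero (ofReal_ne_zero.2 hs0.ne') hvu.2⟩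
  obtain ⟨h1, h2⟩ := hc _ hmem
  rw [hn] at h1 h2
  have hp : ∀ k, k ≤ r → c * s ^ k ≤ |c| * s ^ r := fun k hk =>
    mul_le_mul (le_abs_self c) (pow_le_pow_right₀ hs.le hk) (by positivity) (abs_nonneg c)
  have h3 := hp _ hr
  have h4 := hp _ hr'
  have h5 : 0 ≤ s ^ r := by positivity
  linarith

end Growth

end

noncomputable section

open Complex Metric

/-! ### A radial embedding of the plane into a disk. -/

section Radial

/-- An increasing function on `[0, ∞)` with values below `b`, equal to the identity up to `c`. -/
def squeeze (c b s : ℝ) : ℝ := min s c + (b - c) * (max (s - c) 0 / (1 + max (s - c) 0))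

variable {c b : ℝ}

lemma squeeze_of_le {s : ℝ} (h : s ≤ c) : squeeze c b s = s := by
  simp [squeeze, h]

lemma squeeze_of_ge {s : ℝ} (h : c ≤ s) :
    squeeze c b s = b - (b - c) / (1 + (s - c)) := by
  have h1 : 0 ≤ s - c := by linarith
  rw [squeeze, min_eq_right h, max_eq_left h1]
  field_simp
  ring

lemma le_squeeze {s : ℝ} (hcb : c < b) (h : c ≤ s) : c ≤ squeeze c b s := by
  have h1 : 0 ≤ s - c := by linarith
  rw [squeeze, min_eq_right h, max_eq_left h1]
  have : 0 ≤ (b - c) * ((s - c) / (1 + (s - c))) :=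
    mul_nonneg (by linarith) (div_nonneg h1 (by linarith))
  linarith

lemma squeeze_lt {s : ℝ} (hcb : c < b) : squeeze c b s < b := by
  rcases le_total s c with h | h
  · rw [squeeze_of_le h]; linarith
  · rw [squeeze_of_ge h]
    have : 0 < (b - c) / (1 + (s - c)) := div_pos (by linarith) (by linarith)
    linarith

lemma squeeze_injective (hcb : c < b) : Function.Injective (squeeze c b) := by
  refine StrictMono.injective fun s t hst => ?_
  rcases le_total t c with h | h
  · rwa [squeeze_of_le h, squeeze_of_le (hst.le.trans h)]
  rcases le_total s c with h' | h'
  · rw [squeeze_of_le h']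
    rcases h'.lt_or_eq with h2 | h2
    · exact h2.trans_le (le_squeeze hcb h)
    · rw [h2] at hst ⊢
      rw [squeeze_of_ge h]
      have : (b - c) / (1 + (t - c)) < b - c := div_lt_self (by linarith) (by linarith)
      linarith
  · rw [squeeze_of_ge h', squeeze_of_ge h]
    have : (b - c) / (1 + (t - c)) < (b - c) / (1 + (s - c)) :=
      div_lt_div_of_pos_left (by linarith) (by linarith) (by linarith)
    linarith

lemma squeeze_pos {s : ℝ} (hc : 0 < c) (hcb : c < b) (hs : 0 < s) : 0 < squeeze c b s := by
  rcases le_total s c with h | h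
  · rwa [squeeze_of_le h]
  · exact hc.trans_le (le_squeeze hcb h)

lemma continuous_squeeze : Continuous (squeeze c b) := by
  unfold squeeze
  refine (continuous_id.min continuous_const).add (continuous_const.mul (Continuous.div
    (by fun_prop) (by fun_prop) fun s => ?_))
  have := le_max_right (s - c) 0
  linarith

/-- The radial factor of the embedding of the plane into a disk. -/
def radialFactor (c b : ℝ) (z : ℂ) : ℝ := squeeze c b ‖z‖ / ‖z‖

/-- A radial embedding of the plane into the disk of radius `b`, the identity on the disk of
radius `c`. -/
def radialEmb (c b : ℝ) (z : ℂ) : ℂ := (radialFactor c b z : ℂ) * z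

lemma radialFactor_of_le {z : ℂ} (hz : z ≠ 0) (h : ‖z‖ ≤ c) : radialFactor c b z = 1 := by
  rw [radialFactor, squeeze_of_le h, div_self (norm_ne_zero_iff.2 hz)]

lemma radialFactor_pos {z : ℂ} (hc : 0 < c) (hcb : c < b) (hz : z ≠ 0) :
    0 < radialFactor c b z :=
  div_pos (squeeze_pos hc hcb (norm_pos_iff.2 hz)) (norm_pos_iff.2 hz)

lemma radialEmb_of_le {z : ℂ} (h : ‖z‖ ≤ c) : radialEmb c b z = z := by
  by_cases hz : z = 0
  · simp [radialEmb, hz]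
  · rw [radialEmb, radialFactor_of_le hz h, ofReal_one, one_mul]

lemma norm_radialEmb {z : ℂ} (hc : 0 < c) (hcb : c < b) :
    ‖radialEmb c b z‖ = squeeze c b ‖z‖ := by
  by_cases hz : z = 0
  · rw [hz, radialEmb_of_le (by simpa using hc.le), norm_zero, squeeze_of_le hc.le]
  · rw [radialEmb, norm_mul, norm_real, Real.norm_of_nonneg (radialFactor_pos hc hcb hz).le,
      radialFactor, div_mul_cancel₀ _ (norm_ne_zero_iff.2 hz)]

lemma radialEmb_injective (hc : 0 < c) (hcb : c < b) : Function.Injective (radialEmb c b) := by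
  intro z w h
  have h1 : ‖z‖ = ‖w‖ := squeeze_injective hcb (by
    rw [← norm_radialEmb hc hcb, ← norm_radialEmb hc hcb, h])
  by_cases hz : z = 0
  · rw [hz, norm_zero] at h1
    rw [hz, norm_eq_zero.1 h1.symm]
  · have h2 : radialFactor c b z = radialFactor c b w := by rw [radialFactor, radialFactor, h1]
    rw [radialEmb, radialEmb, ← h2] at h
    exact mul_left_cancel₀ (ofReal_ne_zero.2 (radialFactor_pos hc hcb hz).ne') h

lemma continuous_radialEmb (hc : 0 < c) : Continuous (radialEmb c b) := by
  rw [continuous_iff_continuousAt]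
  intro z
  by_cases hz : z = 0
  · refine continuousAt_id.congr ?_
    rw [hz]
    filter_upwards [ball_mem_nhds (0 : ℂ) hc] with w hw
    rw [radialEmb_of_le (by simpa using (mem_ball_zero_iff.1 hw).le)]
    rfl
  · unfold radialEmb radialFactor
    refine ContinuousAt.mul (continuous_ofReal.continuousAt.comp (ContinuousAt.div
      (continuous_squeeze.continuousAt.comp continuous_norm.continuousAt)
      continuous_norm.continuousAt (norm_ne_zero_iff.2 hz))) continuousAt_id

/-- The quotient of two radial factors is a positive real number, so it leaves the logarithm without
a multiple of 2 π i. -/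
lemma log_radialEmb_div (hc : 0 < c) (hcb : c < b) {z z₀ : ℂ} (hz : z ≠ 0) (hz₀ : z₀ ≠ 0) :
    Complex.log (radialEmb c b z / radialEmb c b z₀) + (Real.log (radialFactor c b z₀) : ℂ) =
      (Real.log (radialFactor c b z) : ℂ) + Complex.log (z / z₀) := by
  have h1 := radialFactor_pos hc hcb hz
  have h2 := radialFactor_pos hc hcb hz₀
  have h3 : radialEmb c b z / radialEmb c b z₀ =
      ((radialFactor c b z / radialFactor c b z₀ : ℝ) : ℂ) * (z / z₀) := by
    unfold radialEmb
    push_cast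
    rw [mul_div_mul_comm]
  rw [h3, Complex.log_ofReal_mul (div_pos h1 h2) (div_ne_zero hz hz₀), Real.log_div h1.ne' h2.ne']
  push_cast
  ring

end Radial

/-! ### Transfer of the spectral condition by radial compression. -/

section Squeeze

variable {n : ℕ} {B E : ℂ → CMat n} {L : CMat n} {σ c b : ℝ}

/-- The transport of solutions from `z` to its image under the radial embedding. -/
def radialTransport (c b : ℝ) (E : ℂ → CMat n) (L : CMat n) (z : ℂ) : CMat n :=
  if ‖z‖ ≤ c then 1 else
    E (radialEmb c b z) * expFlow L (Real.log (radialFactor c b z)) * (E z)⁻¹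

/-- The two cases of the definition agree on σ < |z| ≤ c, where the embedding is the identity, so
one formula serves on both sides of |z| = c. -/
lemma radialTransport_eq (hσ : 0 ≤ σ) (hE : ∀ z ∈ exterior σ, IsUnit (E z)) {z : ℂ}
    (hz : σ < ‖z‖) : radialTransport c b E L z =
      E (radialEmb c b z) * expFlow L (Real.log (radialFactor c b z)) * (E z)⁻¹ := by
  unfold radialTransport
  split_ifs with h
  · rw [radialEmb_of_le h, radialFactor_of_le (norm_pos_iff.1 (hσ.trans_lt hz)) h, Real.log_one,
      ofReal_zero, expFlow_zero, mul_one, CMat.mul_inv (hE z hz)]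
  · rfl

lemma radialEmb_mem_exterior (hσ : 0 ≤ σ) (hσc : σ < c) (hcb : c < b) {z : ℂ} (hz : σ < ‖z‖) :
    σ < ‖radialEmb c b z‖ := by
  rw [norm_radialEmb (hσ.trans_lt hσc) hcb]
  rcases le_total ‖z‖ c with h | h
  · rwa [squeeze_of_le h]
  · exact hσc.trans_le (le_squeeze hcb h)

lemma isUnit_radialTransport (hσ : 0 ≤ σ) (hσc : σ < c) (hcb : c < b)
    (hE : ∀ z ∈ exterior σ, IsUnit (E z)) (z : ℂ) : IsUnit (radialTransport c b E L z) := by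
  unfold radialTransport
  split_ifs with h
  · exact isUnit_one
  · have hz : σ < ‖z‖ := hσc.trans (not_le.1 h)
    exact ((hE _ (radialEmb_mem_exterior hσ hσc hcb hz)).mul (isUnit_expFlow _ _)).mul
      (CMat.isUnit_inv (hE z hz))

/-- Continuation along a path and along its image under the radial embedding. -/
lemma IsContinuationAlong.radialEmb (hσ : 0 ≤ σ) (hσc : σ < c) (hcb : c < b)
    (hE : ∀ z ∈ exterior σ, IsUnit (E z) ∧ HasDerivAt E (B z * E z - z⁻¹ • (E z * L)) z)
    {x y : ℂ} {γ : Path x y} {Y : unitInterval → CMat n} (hY : IsContinuationAlong B γ Y)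
    (C : CMat n) :
    IsContinuationAlong B (γ.map (continuous_radialEmb (b := b) (hσ.trans_lt hσc)))
      fun τ => radialTransport c b E L (γ τ) * Y τ * C := fun τ => by
  have hc : 0 < c := hσ.trans_lt hσc
  obtain ⟨X, hX, hYX⟩ := hY τ
  rcases lt_or_ge ‖γ τ‖ c with hτ | hτ
  · refine ⟨fun z => X z * C, ?_, ?_⟩
    · rw [Path.map_coe, Function.comp_apply, radialEmb_of_le hτ.le]
      filter_upwards [hX] with z hz
      have := hz.mul_const C
      rwa [mul_assoc] at this
    · have hev : ∀ᶠ s in nhds τ, ‖γ s‖ < c :=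
        (γ.continuous.norm).continuousAt.eventually (gt_mem_nhds hτ)
      filter_upwards [hYX, hev] with s hs hs'
      rw [Path.map_coe, Function.comp_apply, radialEmb_of_le hs'.le, radialTransport, if_pos hs'.le,
        one_mul, hs]
  -- The circle |z| = c belongs to this case, in which only the exterior formula is used.
  · obtain ⟨z₀, hz₀⟩ : ∃ z₀, z₀ = γ τ := ⟨_, rfl⟩
    have hzσ : σ < ‖z₀‖ := by rw [hz₀]; exact hσc.trans_le hτ
    have hz₀0 : z₀ ≠ 0 := norm_pos_iff.1 (hσ.trans_lt hzσ)
    have hEu : ∀ z ∈ exterior σ, IsUnit (E z) := fun z hz => (hE z hz).1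
    set w₀ := _root_.radialEmb c b z₀ with hw₀
    have hwσ : σ < ‖w₀‖ := radialEmb_mem_exterior hσ hσc hcb hzσ
    have hw₀0 : w₀ ≠ 0 := norm_pos_iff.1 (hσ.trans_lt hwσ)
    rw [← hz₀] at hX
    -- the solution near `z₀` in the logarithmic chart
    have hev : ∀ᶠ z in nhds z₀, HasDerivAt X (B z * X z) z ∧ σ < ‖z‖ :=
      hX.and (continuous_norm.continuousAt.eventually (lt_mem_nhds hzσ))
    have hcont : ContinuousAt (fun s => z₀ * Complex.exp s) 0 := by fun_prop
    have hev2 : ∀ᶠ s in nhds (0 : ℂ), HasDerivAt X (B (z₀ * Complex.exp s) * X (z₀ * Complex.exp s))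
        (z₀ * Complex.exp s) ∧ σ < ‖z₀ * Complex.exp s‖ := by
      have h0 : z₀ * Complex.exp 0 = z₀ := by rw [Complex.exp_zero, mul_one]
      rw [← h0] at hev
      exact hcont.eventually (p := fun z => HasDerivAt X (B z * X z) z ∧ σ < ‖z‖) hev
    obtain ⟨ε, hε, hball⟩ := Metric.eventually_nhds_iff_ball.1 hev2
    obtain ⟨C₁, hC₁⟩ := exists_const_of_solution (convex_ball (0 : ℂ) ε)
      (V := {z | HasDerivAt X (B z * X z) z ∧ σ < ‖z‖}) (w := z₀) hball hz₀0
      (fun z hz => hE z hz.2) (fun z hz => hz.1) (mem_ball_self hε)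
    -- Near z₀ the solution is E(z) (z / z₀)^L C₁. The germ at w₀ is its continuation along the ray,
    -- where z / z₀ takes the value of the radial factor at z₀; this gives the real summand in the
    -- exponent.
    refine ⟨fun w => E w * expFlow L (Complex.log (w / w₀) +
      (Real.log (radialFactor c b z₀) : ℂ)) * (C₁ * C), ?_, ?_⟩
    · have e1 : (γ.map (continuous_radialEmb (b := b) (hσ.trans_lt hσc))) τ = w₀ := by
        rw [Path.map_coe, Function.comp_apply, ← hz₀]
      rw [e1]
      have h1 : ∀ᶠ w in nhds w₀, σ < ‖w‖ :=
        continuous_norm.continuousAt.eventually (lt_mem_nhds hwσ)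
      have h2 : ∀ᶠ w in nhds w₀, w / w₀ ∈ Complex.slitPlane := by
        have : ContinuousAt (fun w => w / w₀) w₀ := by fun_prop (disch := assumption)
        refine this.eventually (Complex.isOpen_slitPlane.mem_nhds ?_)
        beta_reduce
        rw [div_self hw₀0]
        exact Complex.one_mem_slitPlane
      filter_upwards [h1, h2] with w hw hw'
      have hw0 : w ≠ 0 := norm_pos_iff.1 (hσ.trans_lt hw)
      have h3 : HasDerivAt (fun w => Complex.log (w / w₀) + (Real.log (radialFactor c b z₀) : ℂ))
          w⁻¹ w := by
        have h4 : HasDerivAt (fun w => w / w₀) w₀⁻¹ w := by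
          simpa [div_eq_mul_inv] using (hasDerivAt_id w).mul_const w₀⁻¹
        have h5 := (h4.clog hw').add_const (Real.log (radialFactor c b z₀) : ℂ)
        convert! h5 using 1
        field_simp
      have h6 := HasDerivAt.scomp (g₁ := expFlow L) w (hasDerivAt_expFlow L _) h3
      have h7 := ((hE w hw).2.fun_mul h6).mul_const (C₁ * C)
      convert! h7 using 1
      rw [Function.comp_apply, ← commute_expFlow, sub_mul, smul_mul_assoc, mul_smul_comm,
        mul_assoc (E w) L, sub_add_cancel]
      simp only [mul_assoc]
    · have hγ : Filter.Tendsto γ (nhds τ) (nhds z₀) := by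
        rw [hz₀]; exact γ.continuous.continuousAt
      have h1 : ∀ᶠ s in nhds τ, σ < ‖γ s‖ :=
        hγ.eventually (continuous_norm.continuousAt.eventually (lt_mem_nhds hzσ))
      have h2 : ∀ᶠ s in nhds τ, Complex.log (γ s / z₀) ∈ ball (0 : ℂ) ε := by
        have hcl : ContinuousAt (fun z => Complex.log (z / z₀)) z₀ := by
          refine ContinuousAt.clog (by fun_prop (disch := assumption)) ?_
          rw [div_self hz₀0]
          exact Complex.one_mem_slitPlane
        refine hγ.eventually (hcl.eventually (isOpen_ball.mem_nhds ?_))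
        beta_reduce
        rw [div_self hz₀0, Complex.log_one]
        exact mem_ball_self hε
      filter_upwards [hYX, h1, h2] with s hs hsσ hsε
      have hs0 : γ s ≠ 0 := norm_pos_iff.1 (hσ.trans_lt hsσ)
      have h3 := hC₁ _ hsε
      rw [Complex.exp_log (div_ne_zero hs0 hz₀0), mul_div_cancel₀ _ hz₀0] at h3
      rw [Path.map_coe, Function.comp_apply, hs, h3, radialTransport_eq hσ hEu hsσ,
        hw₀, log_radialEmb_div hc hcb hs0 hz₀0, expFlow_add]
      simp only [mul_assoc]
      rw [← mul_assoc (E (γ s))⁻¹, CMat.inv_mul (hEu _ hsσ), one_mul]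

lemma IsMonodromyFactor.radialEmb (hσ : 0 ≤ σ) (hσc : σ < c) (hcb : c < b)
    (hE : ∀ z ∈ exterior σ, IsUnit (E z) ∧ HasDerivAt E (B z * E z - z⁻¹ • (E z * L)) z)
    {x : ℂ} {γ : Path x x} {M : CMat n} (hM : IsMonodromyFactor B γ M) :
    IsMonodromyFactor B (γ.map (continuous_radialEmb (b := b) (hσ.trans_lt hσc)))
      (radialTransport c b E L x * M * (radialTransport c b E L x)⁻¹) := by
  obtain ⟨Y, hY, hY0, hY1⟩ := hM
  refine ⟨_, hY.radialEmb hσ hσc hcb hE (radialTransport c b E L x)⁻¹, ?_, ?_⟩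
  · simp [hY0, CMat.mul_inv (isUnit_radialTransport hσ hσc hcb (fun z hz => (hE z hz).1) x)]
  · simp [hY1]

lemma CMat.spectrum_conj {P M : CMat n} (hP : IsUnit P) :
    spectrum ℂ (P * M * P⁻¹) = spectrum ℂ M := by
  have h := spectrum.units_conjugate (R := ℂ) (a := M) (u := hP.unit)
  rwa [IsUnit.unit_spec, Matrix.coe_units_inv, IsUnit.unit_spec] at h

/-- Transfer of the spectral condition to a system obtained by a gauge transformation in a disk. -/
theorem SpectralCondition.of_gauge {A G : ℂ → CMat n} {SigA SigB : Set ℂ} (hσ : 0 ≤ σ)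
    (hσc : σ < c) (hcb : c < b)
    (hE : ∀ z ∈ exterior σ, IsUnit (E z) ∧ HasDerivAt E (B z * E z - z⁻¹ • (E z * L)) z)
    (hclosed : IsClosed SigA)
    (hG : ∀ z ∈ ball (0 : ℂ) b \ SigA, IsUnit (G z) ∧ HasDerivAt G (B z * G z - G z * A z) z)
    (hsub : SigA ∩ ball 0 b ⊆ SigB) (hBσ : ∀ z ∈ SigB, ‖z‖ ≤ σ)
    (hS : SpectralCondition A SigA) : SpectralCondition B SigB := by
  intro x γ hγ hγS M hM μ hμ
  have hc : 0 < c := hσ.trans_lt hσc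
  set γ' := γ.map (continuous_radialEmb (b := b) (hσ.trans_lt hσc)) with hγ'
  have hγ'τ : ∀ τ, γ' τ = _root_.radialEmb c b (γ τ) := fun τ => rfl
  have hball : ∀ τ, γ' τ ∈ ball (0 : ℂ) b := fun τ => by
    rw [hγ'τ, mem_ball_zero_iff, norm_radialEmb hc hcb]
    exact squeeze_lt hcb
  -- A point of `SigA` on the compressed loop would have modulus at most σ < c, where the embedding
  -- is the identity, so the loop γ itself would meet `SigB`.
  have havoid : ∀ τ, γ' τ ∉ SigA := fun τ hτ => by
    have h1 := hsub ⟨hτ, hball τ⟩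
    have h2 := hBσ _ h1
    rw [hγ'τ] at h1
    rw [hγ'τ, norm_radialEmb hc hcb] at h2
    have h3 : ‖γ τ‖ ≤ c := by
      by_contra hcon
      linarith [le_squeeze hcb (not_le.1 hcon).le]
    rw [radialEmb_of_le h3] at h1
    exact hγS τ h1
  -- The condition on A concerns simple loops only; injectivity of the embedding is needed for this.
  have hsimple : IsSimpleLoop γ' := fun s hs t ht hst =>
    hγ hs ht (radialEmb_injective hc hcb hst)
  have hM1 := hM.radialEmb (b := b) hσ hσc hcb hE
  have hxmem : _root_.radialEmb c b x ∈ ball (0 : ℂ) b \ SigA := by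
    have h1 := hball 0
    have h2 := havoid 0
    rw [hγ'τ, γ.source] at h1 h2
    exact ⟨h1, h2⟩
  have hGu := (hG _ hxmem).1
  have hM2 := (isMonodromyFactor_gauge_iff (A := A) (γ := γ')
    (M := (G (_root_.radialEmb c b x))⁻¹ * (radialTransport c b E L x * M *
      (radialTransport c b E L x)⁻¹) * G (_root_.radialEmb c b x))
    (isOpen_ball.sdiff hclosed) (fun τ => ⟨hball τ, havoid τ⟩) hG).2 (by
      convert! hM1 using 1
      simp only [← mul_assoc]
      rw [CMat.mul_inv hGu, one_mul]
      simp only [mul_assoc]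
      rw [CMat.mul_inv hGu, mul_one])
  refine hS _ γ' hsimple havoid _ hM2 μ ?_
  have h3 := CMat.spectrum_conj (M := radialTransport c b E L x * M *
      (radialTransport c b E L x)⁻¹) (CMat.isUnit_inv hGu)
  rw [Matrix.nonsing_inv_nonsing_inv _ ((Matrix.isUnit_iff_isUnit_det _).1 hGu)] at h3
  rw [h3, CMat.spectrum_conj (isUnit_radialTransport hσ hσc hcb (fun z hz => (hE z hz).1) x)]
  exact hμ

end Squeeze

end

noncomputable section

open Complex Metric

/-! ### The coefficient matrix of a special system. -/

section Coefficient

variable {n m r : ℕ} {pole : Fin m → ℝ} {res : Fin m → RMat n} {poly : Fin (r + 1) → RMat n}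

lemma differentiableAt_coeffMatrix {z : ℂ} (hz : ∀ j, res j ≠ 0 → z ≠ pole j) :
    DifferentiableAt ℂ (coeffMatrix pole res poly) z := by
  unfold coeffMatrix
  refine DifferentiableAt.add (DifferentiableAt.fun_sum fun j _ => ?_)
    (DifferentiableAt.fun_sum fun k _ => by fun_prop)
  by_cases hr : res j = 0
  · simp only [hr, complexify_zero, smul_zero]
    exact differentiableAt_const _
  · have h : DifferentiableAt ℂ (fun z : ℂ => z - (pole j : ℂ)) z := by fun_prop
    exact (h.fun_inv (sub_ne_zero.2 (hz j hr))).smul_const _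

lemma coeffMatrix_conj (z : ℂ) :
    coeffMatrix pole res poly ((starRingEnd ℂ) z) = cj (coeffMatrix pole res poly z) := by
  unfold coeffMatrix
  rw [cj_add, cj_sum, cj_sum]
  congr 1
  · exact Finset.sum_congr rfl fun j _ => by
      rw [cj_smul, cj_complexify, map_inv₀, map_sub, conj_ofReal]
  · exact Finset.sum_congr rfl fun k _ => by rw [cj_smul, cj_complexify, map_pow]

lemma norm_coeffMatrix_le {z : ℂ} (hz1 : ‖z‖ ≤ 1) {δ : Fin m → ℝ} (hδ : ∀ j, 0 < δ j)
    (hz : ∀ j, res j ≠ 0 → δ j ≤ ‖z - pole j‖) :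
    ‖coeffMatrix pole res poly z‖ ≤ ∑ j, (δ j)⁻¹ * ‖res j‖ + ∑ k, ‖poly k‖ := by
  unfold coeffMatrix
  refine (norm_add_le _ _).trans (add_le_add ?_ ?_)
  · refine norm_sum_le_of_le _ fun j _ => ?_
    rw [norm_smul, norm_complexify, norm_inv]
    by_cases hr : res j = 0
    · simp [hr]
    · exact mul_le_mul_of_nonneg_right (inv_anti₀ (hδ j) (hz j hr)) (norm_nonneg _)
  · refine norm_sum_le_of_le _ fun k _ => ?_
    rw [norm_smul, norm_complexify, norm_pow]
    exact mul_le_of_le_one_left (norm_nonneg _) (pow_le_one₀ (norm_nonneg _) hz1)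

lemma SpecialSystem.sum_norm_res_le (S : SpecialSystem n m r) : ∑ j, ‖S.res j‖ ≤ r := by
  have h1 : 0 ≤ ∑ k, ‖S.poly k‖ := Finset.sum_nonneg fun k _ => norm_nonneg _
  linarith [S.norm_le]

lemma SpecialSystem.norm_coeff_le (S : SpecialSystem n m r) {z : ℂ} (hz1 : ‖z‖ ≤ 1) {δ : ℝ}
    (hδ : 0 < δ) (hz : ∀ j, S.res j ≠ 0 → δ ≤ ‖z - S.pole j‖) :
    ‖S.coeff z‖ ≤ r * (δ⁻¹ + 1) := by
  refine (norm_coeffMatrix_le hz1 (fun _ => hδ) hz).trans ?_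
  rw [← Finset.mul_sum, mul_add, mul_one, mul_comm (r : ℝ)]
  have h1 : 0 ≤ ∑ j, ‖S.res j‖ := Finset.sum_nonneg fun k _ => norm_nonneg _
  refine add_le_add (mul_le_mul_of_nonneg_left S.sum_norm_res_le (by positivity)) ?_
  linarith [S.norm_le]

lemma SpecialSystem.finite_locus (S : SpecialSystem n m r) : S.locus.Finite :=
  (Set.finite_range fun j => (S.pole j : ℂ)).subset fun _ ⟨j, _, hj⟩ => ⟨j, hj.symm⟩

end Coefficient

/-! ### Extension of the gauge transformation to the larger disk. -/

section Extension

variable {n : ℕ} {A : ℂ → CMat n} {σ ρ b : ℝ} {L : CMat n} {G F E : ℂ → CMat n}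

/-- Extension of a gauge transformation from a disk by means of the solution on an annulus. -/
lemma exists_isGauge_extension (hσρ : σ < ρ) (hL : cj L = L)
    (hGd : DifferentiableOn ℂ G (ball 0 ρ)) (hGu : ∀ z ∈ ball (0 : ℂ) ρ, IsUnit (G z))
    (hGs : ConjSymm G (ball 0 ρ)) (hEd : DifferentiableOn ℂ E (exterior σ))
    (hEu : ∀ z ∈ exterior σ, IsUnit (E z)) (hEs : ConjSymm E (exterior σ))
    (hF : ∀ z ∈ annulus σ b, IsUnit (F z) ∧ HasDerivAt F (A z * F z - z⁻¹ • (F z * L)) z)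
    (hFs : ConjSymm F (annulus σ b))
    (hGF : ∀ z ∈ annulus σ ρ, G z * F z = E z) :
    ∃ G' : ℂ → CMat n, IsGauge A σ b L G' F E ∧ ∀ z ∈ ball (0 : ℂ) ρ, G' z = G z := by
  -- On the annulus G equals E F⁻¹, an expression available up to |z| = b, whereas G is given only
  -- up to ρ.
  obtain ⟨G', hG'⟩ : ∃ G' : ℂ → CMat n,
    G' = fun z => if ‖z‖ < ρ then G z else E z * (F z)⁻¹ := ⟨_, rfl⟩
  have h1 : ∀ z ∈ ball (0 : ℂ) ρ, G' z = G z := fun z hz => by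
    rw [hG']; exact if_pos (by simpa using hz)
  have h2 : ∀ z ∈ annulus σ b, G' z = E z * (F z)⁻¹ := fun z hz => by
    by_cases hb : ‖z‖ < ρ
    · rw [h1 z (by simpa using hb), ← hGF z ⟨hz.1, hb⟩, mul_assoc, CMat.mul_inv (hF z hz).1, mul_one]
    · rw [hG']; exact if_neg hb
  have hcase : ∀ z ∈ ball (0 : ℂ) b, z ∈ ball (0 : ℂ) ρ ∨ z ∈ annulus σ b := fun z hz => by
    rcases lt_or_ge ‖z‖ ρ with h | h
    · exact Or.inl (by simpa using h)
    · exact Or.inr ⟨hσρ.trans_le h, by simpa using hz⟩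
  have hFd : DifferentiableOn ℂ F (annulus σ b) := fun z hz =>
    (hF z hz).2.differentiableAt.differentiableWithinAt
  have hEFd : DifferentiableOn ℂ (fun z => E z * (F z)⁻¹) (annulus σ b) :=
    (hEd.mono fun z hz => hz.1).mul
      (CMat.differentiableOn_inv (isOpen_annulus σ b) hFd fun z hz => (hF z hz).1)
  refine ⟨G', ⟨hL, fun z hz => ?_, fun z hz => ?_, fun z hz => ?_, hEd, hEu, hEs,
    fun z hz => (hF z hz).1, fun z hz => (hF z hz).2, fun z hz => ?_⟩, h1⟩
  · rcases hcase z hz with h | h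
    · refine ((hGd.differentiableAt (isOpen_ball.mem_nhds h)).congr_of_eventuallyEq
        ?_).differentiableWithinAt
      filter_upwards [isOpen_ball.mem_nhds h] with w hw using h1 w hw
    · refine ((hEFd.differentiableAt ((isOpen_annulus σ b).mem_nhds h)).congr_of_eventuallyEq
        ?_).differentiableWithinAt
      filter_upwards [(isOpen_annulus σ b).mem_nhds h] with w hw using h2 w hw
  · rcases hcase z hz with h | h
    · rw [h1 z h]; exact hGu z h
    · rw [h2 z h]; exact (hEu z h.1).mul (CMat.isUnit_inv (hF z h).1)
  · rcases hcase z hz with h | h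
    · rw [h1 z h, h1 _ (conj_mem_ball h), hGs z h]
    · rw [h2 z h, h2 _ (conj_mem_annulus h), hEs z h.1, hFs z h, cj_mul, cj_inv]
  · rw [h2 z hz, mul_assoc, CMat.inv_mul (hF z hz).1, mul_one]

end Extension

end

noncomputable section

open Complex Metric

/-! ### The surgery. -/

section Surgery

variable {n m r : ℕ}

/-- Single-valued solutions of a special system on an annulus free of singular points. -/
lemma SpecialSystem.exists_floquet [NeZero n] (S : SpecialSystem n m r) {b g : ℝ} (hg : 0 < g)
    (hgb : g ≤ b) (hb1 : b ≤ 1)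
    (hloc : ∀ j, S.res j ≠ 0 → |S.pole j| ≤ b - g ∨ b < |S.pole j|) :
    ∃ (L : CMat n) (F : ℂ → CMat n), cj L = L ∧ ‖L‖ ≤ logBound n (r * (8 / g + 1)) (8 / g) ∧
      (∀ z ∈ annulus (b - 7 / 8 * g) b, IsUnit (F z) ∧
        HasDerivAt F (S.coeff z * F z - z⁻¹ • (F z * L)) z) ∧
      ConjSymm F (annulus (b - 7 / 8 * g) b) ∧
      ∀ z ∈ annulus (b - 7 / 8 * g) (b - g / 8),
        ‖F z‖ ≤ floquetBound n (r * (8 / g + 1)) (8 / g) ∧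
        ‖(F z)⁻¹‖ ≤ floquetBound n (r * (8 / g + 1)) (8 / g) := by
  have hdist : ∀ (z : ℂ) (j : Fin m), ‖z‖ - |S.pole j| ≤ ‖z - S.pole j‖ ∧
      |S.pole j| - ‖z‖ ≤ ‖z - S.pole j‖ := fun z j => by
    have h1 := norm_sub_norm_le z (S.pole j)
    have h2 := norm_sub_norm_le (S.pole j : ℂ) z
    rw [norm_sub_rev] at h2
    rw [norm_real, Real.norm_eq_abs] at h1 h2
    exact ⟨h1, h2⟩
  have hsmul : ∀ z : ℂ, ‖z‖ ≤ 1 → ‖z • S.coeff z‖ ≤ ‖S.coeff z‖ := fun z hz => by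
    rw [norm_smul]
    exact mul_le_of_le_one_left (norm_nonneg _) hz
  refine _root_.exists_floquet (by linarith) (by linarith) (by linarith) (fun z hz => ?_)
    (fun z _ => coeffMatrix_conj z) ?_ (fun z hz => ?_) (fun x hx1 hx2 => ?_)
  · refine (differentiableAt_coeffMatrix fun j hj hzj => ?_).differentiableWithinAt
    have h1 : ‖z‖ = |S.pole j| := by rw [hzj, norm_real, Real.norm_eq_abs]
    have h2 := hz.1
    have h3 := hz.2
    rcases hloc j hj with h | h <;> linarith
  -- A pole beyond |t| = b may be arbitrarily close to that circle, so up to b there is only this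
  -- bound, which depends on the system and enters no constant. The uniform bound stops at b - g /
  -- 8.
  · refine ⟨∑ j, (if b < |S.pole j| then |S.pole j| - b else g / 8)⁻¹ * ‖S.res j‖ +
      ∑ k, ‖S.poly k‖, fun z hz => ?_⟩
    have hz1 : ‖z‖ ≤ 1 := hz.2.le.trans hb1
    refine (hsmul z hz1).trans (norm_coeffMatrix_le hz1 (fun j => ?_) fun j hj => ?_)
    · split_ifs <;> linarith
    · have h2 := hz.1
      have h3 := hz.2
      have h4 := hdist z j
      split_ifs with h
      · linarith
      · rcases hloc j hj with h' | h'
        · linarith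
        · exact absurd h' h
  · have h2 := hz.1
    have h3 := hz.2
    have hz1 : ‖z‖ ≤ 1 := by linarith
    refine (hsmul z hz1).trans ?_
    have := S.norm_coeff_le hz1 (δ := g / 8) (by positivity) fun j hj => by
      have h4 := hdist z j
      rcases hloc j hj with h' | h' <;> linarith
    rwa [inv_div] at this
  · have hx0 : g / 8 < x := by linarith
    have hxp : 0 < x := by linarith [hg]
    have h1 : Real.log x ≤ 0 := Real.log_nonpos hxp.le (by linarith)
    rw [abs_of_nonpos h1, ← Real.log_inv]
    refine (Real.log_le_self (by positivity)).trans ?_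
    rw [inv_le_comm₀ hxp (by positivity), inv_div]
    exact hx0.le

/-- The surgery with explicit constants. -/
theorem SpecialSystem.exists_surgery [NeZero n] (S : SpecialSystem n m r) {b g d : ℝ} (hg : 0 < g)
    (hgb : g ≤ b) (hb1 : b ≤ 1) (hd : d = 3 / 16 * g)
    (hloc : ∀ j, S.res j ≠ 0 → |S.pole j| ≤ b - g ∨ b < |S.pole j|)
    {K κ κ₁ κ₂ h : ℝ} {N D l r' : ℕ} (hK : K = r * (8 / g + 1)) (hκ : κ = floquetBound n K (8 / g))
    (hN : (1 + 4 / d) * (4 * κ / d * (1 - d / 2) ^ N * κ) ≤ 1 / 4)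
    (hκ₁ : κ₁ = elimBound n N d * (3 / 2) * κ)
    (hκ₂ : κ₂ = κ * (2 * (elimInvBound n N d * 2 ^ (2 * (n * (2 * N)))) / d ^ N))
    (hl : logBound n K (8 / g) ≤ l) (hh : h = κ₁ * κ₂ * ((d / 8)⁻¹ + K + (d / 8)⁻¹ * r))
    (hD : D = N + 2 * (n * (2 * N))) (hr₁ : D + l ≤ r')
    (hr₂ : κ₁ * κ₂ * r + (D + 1) * (h / (2 * d) ^ D) ≤ r') :
    ∃ T : SpecialSystem n m r',
      IsomonodromicIn S.coeff S.locus T.coeff T.locus {t : ℂ | ‖t‖ < b} ∧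
      T.locus ⊆ {t : ℂ | ‖t‖ < b} ∧
      (SpectralCondition S.coeff S.locus → SpectralCondition T.coeff T.locus) := by
  have hd0 : 0 < d := by rw [hd]; positivity
  obtain ⟨L, F, hLr, hLn, hF, hFs, hFb⟩ := S.exists_floquet hg hgb hb1 hloc
  rw [← hK] at hLn hFb
  rw [← hκ] at hFb
  obtain ⟨α, hα⟩ : ∃ α, α = b - 7 / 8 * g := ⟨_, rfl⟩
  rw [← hα] at hF hFs hFb
  have hα0 : 0 < α := by linarith
  -- The middle annulus from b - 7/8 g to b - g / 8 has width 3/4 g, which is four steps d.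
  have hβ' : b - g / 8 = α + 4 * d := by rw [hα, hd]; ring
  rw [hβ'] at hFb
  have hsub : annulus α (α + 4 * d) ⊆ annulus α b := fun z hz => ⟨hz.1, by linarith [hz.2]⟩
  obtain ⟨G₀, E, hG₀d, hG₀u, hG₀s, hEd, hEu, hEs, hGF, hGb, hGib, hEg⟩ :=
    exists_gauge hα0.le hd0 rfl (by linarith) (F := F)
      (fun z hz => (hF z (hsub hz)).2.differentiableAt.differentiableWithinAt)
      (fun z hz => (hF z (hsub hz)).1) (fun z hz => hFs z (hsub hz)) (fun z hz => (hFb z hz).1)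
      (fun z hz => (hFb z hz).2) hN
  rw [← hκ₁] at hGb
  rw [← hκ₂] at hGib
  obtain ⟨σ, hσ⟩ : ∃ σ, σ = α + 3 / 2 * d := ⟨_, rfl⟩
  rw [← hσ] at hEd hEu hEs hGF
  have hσ0 : 0 < σ := by linarith
  have hσb : σ < b := by linarith
  have hσ1 : σ < 1 := by linarith
  have hsubσ : annulus σ b ⊆ annulus α b := fun z hz => ⟨by linarith [hz.1], hz.2⟩
  obtain ⟨G, hgauge, hGG⟩ := exists_isGauge_extension (A := S.coeff) (b := b) (by linarith) hLr
    hG₀d hG₀u hG₀s hEd hEu hEs (fun z hz => hF z (hsubσ hz)) (fun z hz => hFs z (hsubσ hz)) hGF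
  obtain ⟨H, hHd, hHs, hGder, hEder⟩ := exists_entire_remainder hgauge hσ0 hσb fun j hj => by
    rcases hloc j hj with h' | h'
    · exact Or.inl (by linarith)
    · exact Or.inr h'
  have hGball : ∀ w : ℂ, α + 2 * d - d / 8 ≤ ‖w‖ → ‖w‖ ≤ α + 2 * d + d / 8 →
      ‖G w‖ ≤ κ₁ ∧ ‖(G w)⁻¹‖ ≤ κ₂ := fun w h1 h2 => by
    have hw : w ∈ annulus (α + 7 / 4 * d) (α + 5 / 2 * d) := ⟨by linarith, by linarith⟩
    rw [hGG w (by simpa using hw.2)]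
    exact ⟨hGb w hw, hGib w hw⟩
  -- The circle |z| = α + 2 d, thickened by d / 8, lies in the annulus on which G and G⁻¹ are
  -- bounded, away from the poles of the system.
  obtain ⟨hresb, hHb⟩ := norm_remainder_le (ρ := α + 2 * d) (δ := d / 8) (K := K) (s := r)
    (by positivity) (by linarith) (by linarith) hgauge.G_diff hgauge.G_unit hGball
    (fun j hj => by
      rcases hloc j hj with h' | h'
      · exact Or.inl (by linarith)
      · exact Or.inr h') hGder
    (fun z hz => by
      rw [hK, ← inv_div]
      refine S.norm_coeff_le (by linarith) (by positivity) fun j hj => ?_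
      have h1 := norm_sub_norm_le z (S.pole j)
      have h2 := norm_sub_norm_le (S.pole j : ℂ) z
      rw [norm_sub_rev] at h2
      rw [norm_real, Real.norm_eq_abs] at h1 h2
      rcases hloc j hj with h' | h' <;> linarith) S.sum_norm_res_le
  rw [← hh] at hHb
  obtain ⟨c, hc⟩ := growth_of_remainder hσ1 hEd hEu S.abs_pole_le hEder hEg
  rw [← hD] at hc
  obtain ⟨p, hpr, hpb, hpH⟩ := exists_coeff_of_entire_of_growth hHd hHs hc (by linarith) hHb
  have hh0 : 0 ≤ h := (norm_nonneg _).trans (hHb ((α + 2 * d : ℝ) : ℂ) (by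
    rw [norm_real, Real.norm_of_nonneg (by linarith)]))
  -- The radius α + 2 d is replaced by its lower bound 2 d, which depends on g alone.
  have hpb' : ∀ k, ‖p k‖ ≤ h / (2 * d) ^ k := fun k => (hpb k).trans
    (div_le_div_of_nonneg_left hh0 (by positivity) (pow_le_pow_left₀ (by positivity)
      (by linarith) k))
  obtain ⟨B, hB⟩ : ∃ B : ℂ → CMat n, B = coeffMatrix S.pole
    (fun j => reMat (gaugeRes S.pole S.res b G j)) (paddedPoly p D r') := ⟨_, rfl⟩
  have hBz : ∀ z, B z = gaugePrincipal S.pole S.res b G z + H z := fun z => by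
    rw [hB, coeffMatrix_paddedPoly hgauge.G_symm hpr (by omega), hpH]
  have hE' : ∀ z ∈ exterior σ, IsUnit (E z) ∧ HasDerivAt E (B z * E z - z⁻¹ • (E z * L)) z :=
    fun z hz => ⟨hEu z hz, by rw [hBz]; exact hEder z hz⟩
  have hLl : ‖L‖ ≤ l := hLn.trans hl
  have hreg := regularAtInfinity_of_exterior hσ1 hE' hLl hEg
  have hgr : GrowthAtInfinityLE B r' := growthAtInfinityLE_of_exterior hσ1 hE' hLl hEg
    (by omega) (by omega)
  rw [hB] at hreg hgr
  have hresn : ∀ j, ‖reMat (gaugeRes S.pole S.res b G j)‖ = ‖gaugeRes S.pole S.res b G j‖ :=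
    fun j => by rw [← norm_complexify, complexify_reMat (cj_gaugeRes hgauge.G_symm j)]
  -- All points t_j are retained, those outside the disk with residue 0, so m does not change.
  let T : SpecialSystem n m r' :=
    { pole := S.pole
      res := fun j => reMat (gaugeRes S.pole S.res b G j)
      poly := paddedPoly p D r'
      pole_injective := S.pole_injective
      abs_pole_le := S.abs_pole_le
      norm_le := by
        refine le_trans (add_le_add ?_ (sum_norm_paddedPoly_le hpr (by omega) hh0
          (ρ := 2 * d) (by positivity) (by linarith) hpb')) hr₂
        simp only [hresn]
        exact hresb
      regular := hreg
      growth := hgr }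
  have hTB : T.coeff = B := hB.symm
  -- Conjugation by the invertible matrix G(t_j) cannot annihilate a residue, so no singular point
  -- in the disk is lost.
  have hresne : ∀ j, T.res j ≠ 0 ↔ S.res j ≠ 0 ∧ |S.pole j| < b := fun j => by
    have h1 : T.res j = 0 ↔ gaugeRes S.pole S.res b G j = 0 := by
      rw [← norm_eq_zero, ← norm_eq_zero (a := gaugeRes S.pole S.res b G j), ← hresn]
    rw [Ne, h1]
    constructor
    · intro h2
      exact ⟨fun h0 => h2 (gaugeRes_of_res_eq_zero h0), by
        by_contra hcon
        exact h2 (if_neg hcon)⟩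
    · rintro ⟨h2, h3⟩ h4
      have hGu := hgauge.G_unit (S.pole j) (by simpa using h3)
      rw [gaugeRes, if_pos h3] at h4
      apply h2
      rw [← complexify_eq_zero]
      calc complexify (S.res j) = (G (S.pole j))⁻¹ *
            (G (S.pole j) * complexify (S.res j) * (G (S.pole j))⁻¹) * G (S.pole j) := by
              rw [mul_assoc, mul_assoc, mul_assoc, CMat.inv_mul hGu, mul_one, ← mul_assoc,
                CMat.inv_mul hGu, one_mul]
        _ = 0 := by rw [h4, mul_zero, zero_mul]
  have hlocus : T.locus = S.locus ∩ {t : ℂ | ‖t‖ < b} := by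
    ext z
    constructor
    · rintro ⟨j, hj, rfl⟩
      obtain ⟨h1, h2⟩ := (hresne j).1 hj
      exact ⟨⟨j, h1, rfl⟩, by
        change ‖((S.pole j : ℝ) : ℂ)‖ < b
        rwa [norm_real, Real.norm_eq_abs]⟩
    · rintro ⟨⟨j, hj, rfl⟩, hz⟩
      refine ⟨j, (hresne j).2 ⟨hj, ?_⟩, rfl⟩
      change ‖((S.pole j : ℝ) : ℂ)‖ < b at hz
      rwa [norm_real, Real.norm_eq_abs] at hz
  have hball : {t : ℂ | ‖t‖ < b} = ball (0 : ℂ) b := by ext z; simp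
  have hclosed : IsClosed S.locus := S.finite_locus.isClosed
  have hGdef : ∀ z ∈ ball (0 : ℂ) b \ S.locus,
      IsUnit (G z) ∧ HasDerivAt G (B z * G z - G z * S.coeff z) z := fun z hz => by
    refine ⟨hgauge.G_unit z hz.1, ?_⟩
    rw [hBz]
    exact hGder z hz.1 fun j hj hzj => hz.2 ⟨j, hj, hzj⟩
  have hfr : frontier {t : ℂ | ‖t‖ < b} = sphere (0 : ℂ) b := by
    rw [hball, frontier_ball _ (by linarith)]
  refine ⟨T, ⟨?_, ?_, ?_, ?_⟩, ?_, ?_⟩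
  · rw [hlocus, Set.inter_assoc, Set.inter_self]
  · rw [hfr, Set.disjoint_left]
    rintro z ⟨j, hj, rfl⟩ hz
    rw [mem_sphere_zero_iff_norm, norm_real, Real.norm_eq_abs] at hz
    rcases hloc j hj with h' | h' <;> linarith
  · rw [hfr, hlocus, Set.disjoint_left]
    rintro z ⟨-, hz1⟩ hz
    rw [mem_sphere_zero_iff_norm] at hz
    exact absurd hz1 (by rw [Set.mem_ofPred_eq, hz]; exact lt_irrefl b)
  · intro x hx
    rw [hball] at hx
    obtain ⟨C, hC⟩ := (hGdef x hx).1
    refine ⟨C, fun γ hγ M => ?_⟩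
    rw [hball] at hγ
    rw [isMonodromyFactor_gauge_iff (isOpen_ball.sdiff hclosed) hγ hGdef, hTB, ← hC,
      Matrix.coe_units_inv]
  · rw [hlocus]; exact Set.inter_subset_right
  · rw [hTB]
    refine SpectralCondition.of_gauge (c := (σ + b) / 2) (b := b) hσ0.le (by linarith) (by linarith) hE' hclosed hGdef ?_ ?_
    · rw [hlocus, hball]
    · rw [hlocus]
      rintro z ⟨⟨j, hj, rfl⟩, hz⟩
      change ‖((S.pole j : ℝ) : ℂ)‖ < b at hz
      rw [norm_real, Real.norm_eq_abs] at hz ⊢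
      rcases hloc j hj with h' | h' <;> linarith

end Surgery

end

noncomputable section

open Complex Metric

/-! ### The explicit constants. -/

section Constants

/-- The guaranteed width of the annulus. -/
def gapWidth (q : ℕ) : ℝ := 1 / ((q : ℝ) * (q + 1))

/-- The step between consecutive radii. -/
def radiusStep (q : ℕ) : ℝ := 3 / 16 * gapWidth q

/-- Bound for the coefficient matrix on the middle annulus. -/
def coeffBound (r q : ℕ) : ℝ := r * (8 / gapWidth q + 1)

/-- Bound for the single-valued solution on the middle annulus. -/
def annulusBound (n r q : ℕ) : ℝ := floquetBound n (coeffBound r q) (8 / gapWidth q)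

/-- The degree of the Laurent approximation. -/
def approxDegree (n r q : ℕ) : ℕ :=
  ⌈8 / radiusStep q * ((1 + 4 / radiusStep q) *
    (4 * annulusBound n r q / radiusStep q * annulusBound n r q))⌉₊

/-- Bound for the gauge transformation. -/
def gaugeBound (n r q : ℕ) : ℝ :=
  elimBound n (approxDegree n r q) (radiusStep q) * (3 / 2) * annulusBound n r q

/-- Bound for the inverse of the gauge transformation. -/
def gaugeInvBound (n r q : ℕ) : ℝ :=
  annulusBound n r q * (2 * (elimInvBound n (approxDegree n r q) (radiusStep q) *
    2 ^ (2 * (n * (2 * approxDegree n r q)))) / radiusStep q ^ approxDegree n r q)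

/-- The degree of the polynomial part of the new system. -/
def surgeryDegree (n r q : ℕ) : ℕ := approxDegree n r q + 2 * (n * (2 * approxDegree n r q))

/-- Bound for the polynomial part of the new system on a circle. -/
def circleBound (n r q : ℕ) : ℝ := gaugeBound n r q * gaugeInvBound n r q *
  ((radiusStep q / 8)⁻¹ + coeffBound r q + (radiusStep q / 8)⁻¹ * r)

/-- Bound for the coefficients of the new system. -/
def surgeryNorm (n r q : ℕ) : ℝ := gaugeBound n r q * gaugeInvBound n r q * r +
  (surgeryDegree n r q + 1) * (circleBound n r q / (2 * radiusStep q) ^ surgeryDegree n r q)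

/-- Bound for the exponents of the new system at infinity. -/
def exponentBound (n r q : ℕ) : ℕ := ⌈logBound n (coeffBound r q) (8 / gapWidth q)⌉₊

/-- The complexity parameter of the new system. -/
def surgeryOrder (n r q : ℕ) : ℕ := ⌈surgeryNorm n r q⌉₊ + (surgeryDegree n r q + exponentBound n r q)

lemma gapWidth_nonneg (q : ℕ) : 0 ≤ gapWidth q := by unfold gapWidth; positivity

lemma radiusStep_nonneg (q : ℕ) : 0 ≤ radiusStep q := by
  have := gapWidth_nonneg q
  unfold radiusStep; positivity

lemma coeffBound_nonneg (r q : ℕ) : 0 ≤ coeffBound r q := by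
  have := gapWidth_nonneg q
  unfold coeffBound; positivity

lemma solBound_nonneg (K Λ : ℝ) : 0 ≤ solBound K Λ := (Real.exp_pos _).le

lemma resolventBound_nonneg (n : ℕ) {κ : ℝ} (h : 0 ≤ κ) : 0 ≤ resolventBound n κ := by
  unfold resolventBound; positivity

lemma annulusBound_nonneg (n r q : ℕ) : 0 ≤ annulusBound n r q :=
  mul_nonneg (solBound_nonneg _ _) (Real.exp_pos _).le

lemma gaugeBound_nonneg (n r q : ℕ) : 0 ≤ gaugeBound n r q := by
  have h1 := elimBound_nonneg n (approxDegree n r q) (radiusStep_nonneg q)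
  have h2 := annulusBound_nonneg n r q
  unfold gaugeBound; positivity

lemma gaugeInvBound_nonneg (n r q : ℕ) : 0 ≤ gaugeInvBound n r q := by
  have h1 := elimInvBound_nonneg n (approxDegree n r q) (radiusStep_nonneg q)
  have h2 := annulusBound_nonneg n r q
  have h3 := radiusStep_nonneg q
  unfold gaugeInvBound; positivity

lemma circleBound_nonneg (n r q : ℕ) : 0 ≤ circleBound n r q := by
  have h1 := gaugeBound_nonneg n r q
  have h2 := gaugeInvBound_nonneg n r q
  have h3 := radiusStep_nonneg q
  have h4 := coeffBound_nonneg r q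
  unfold circleBound; positivity

/-- By Bernoulli's inequality (1 - d / 2)^N ≤ (1 + d / 2)^(-N) ≤ 1 / (1 + N d / 2), so an N linear
in Q suffices and no logarithm is needed. -/
lemma mul_pow_le_of_ceil {d Q : ℝ} (hd : 0 < d) (hd2 : d ≤ 2) {N : ℕ}
    (hN : 8 / d * Q ≤ N) : Q * (1 - d / 2) ^ N ≤ 1 / 4 := by
  have h0 : 0 ≤ 1 - d / 2 := by linarith
  have h1 : 0 ≤ (1 - d / 2) ^ N := pow_nonneg h0 N
  have h2 : 1 + N * (d / 2) ≤ (1 + d / 2) ^ N := one_add_mul_le_pow (by linarith) N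
  have h3 : (1 - d / 2) ^ N * (1 + d / 2) ^ N ≤ 1 := by
    rw [← mul_pow]
    exact pow_le_one₀ (mul_nonneg h0 (by linarith)) (by nlinarith)
  have h4 : 4 * Q ≤ N * (d / 2) := by
    have := mul_le_mul_of_nonneg_right hN (by positivity : 0 ≤ d / 2)
    have e : 8 / d * Q * (d / 2) = 4 * Q := by field_simp; ring
    linarith
  have h5 : (1 - d / 2) ^ N * (4 * Q) ≤ (1 - d / 2) ^ N * (1 + d / 2) ^ N :=
    mul_le_mul_of_nonneg_left (by linarith) h1
  linarith

end Constants

/-! ### Primitive recursive bounds for the constants. -/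

section PrimitiveRecursive

variable {n r q N : ℕ → ℕ} {κ φ d : ℕ → ℝ}

lemma PrimrecBounded.resolventBound (hn : PrimrecBounded fun k => (n k : ℝ))
    (hκ : PrimrecBounded κ) (h0 : ∀ k, 0 ≤ κ k) :
    PrimrecBounded fun k => resolventBound (n k) (κ k) := by
  unfold _root_.resolventBound
  have h1 : PrimrecBounded fun k => (2 + κ k) ^ n k :=
    ((PrimrecBounded.const 2).add hκ).pow hn fun k => by have := h0 k; positivity
  have h2 : PrimrecBounded fun k => (8 * ((n k : ℝ) + 1) * κ k) ^ n k :=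
    ((((PrimrecBounded.const 8).mul (hn.add (.const 1)) fun k => by positivity).mul hκ h0)).pow hn
      fun k => by have := h0 k; positivity
  exact (hn.mul (hn.factorial.mul h1 fun k => by have := h0 k; positivity)
    fun k => by have := h0 k; positivity).mul h2 fun k => by have := h0 k; positivity

lemma primrecBounded_inv_radiusStep (hq : PrimrecBounded fun k => (q k : ℝ)) :
    PrimrecBounded fun k => 1 / radiusStep (q k) := by
  refine ((PrimrecBounded.const (16 / 3)).mul (hq.mul (hq.add (.const 1)) fun k => by positivity)
    fun k => by positivity).mono fun k => ?_
  unfold radiusStep gapWidth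
  rw [one_div, mul_inv, one_div, inv_inv, inv_div]

lemma primrecBounded_inv_gapWidth (hq : PrimrecBounded fun k => (q k : ℝ)) :
    PrimrecBounded fun k => 8 / gapWidth (q k) := by
  refine ((PrimrecBounded.const 8).mul (hq.mul (hq.add (.const 1)) fun k => by positivity)
    fun k => by positivity).mono fun k => ?_
  unfold gapWidth
  rw [div_div_eq_mul_div, div_one]

lemma PrimrecBounded.coeffBound (hr : PrimrecBounded fun k => (r k : ℝ))
    (hq : PrimrecBounded fun k => (q k : ℝ)) : PrimrecBounded fun k => coeffBound (r k) (q k) :=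
  hr.mul ((primrecBounded_inv_gapWidth hq).add (.const 1)) fun k => by
    have := gapWidth_nonneg (q k); positivity

lemma primrecBounded_solBound (hr : PrimrecBounded fun k => (r k : ℝ))
    (hq : PrimrecBounded fun k => (q k : ℝ)) :
    PrimrecBounded fun k => solBound (coeffBound (r k) (q k)) (8 / gapWidth (q k)) :=
  ((hr.coeffBound hq).mul (((PrimrecBounded.const 2).mul (primrecBounded_inv_gapWidth hq)
    fun k => by have := gapWidth_nonneg (q k); positivity).add (.const 8))
    fun k => by have := gapWidth_nonneg (q k); positivity).exp

lemma primrecBounded_logBound (hn : PrimrecBounded fun k => (n k : ℝ))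
    (hr : PrimrecBounded fun k => (r k : ℝ)) (hq : PrimrecBounded fun k => (q k : ℝ)) :
    PrimrecBounded fun k => logBound (n k) (coeffBound (r k) (q k)) (8 / gapWidth (q k)) :=
  (PrimrecBounded.const 1).add (((PrimrecBounded.const 1).add (primrecBounded_solBound hr hq)).mul
    (hn.resolventBound (primrecBounded_solBound hr hq) fun _ => solBound_nonneg _ _)
    fun _ => resolventBound_nonneg _ (solBound_nonneg _ _))

lemma PrimrecBounded.annulusBound (hn : PrimrecBounded fun k => (n k : ℝ))
    (hr : PrimrecBounded fun k => (r k : ℝ)) (hq : PrimrecBounded fun k => (q k : ℝ)) :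
    PrimrecBounded fun k => annulusBound (n k) (r k) (q k) :=
  (primrecBounded_solBound hr hq).mul ((primrecBounded_logBound hn hr hq).mul
    ((primrecBounded_inv_gapWidth hq).add (.const 4))
    fun k => by have := gapWidth_nonneg (q k); positivity).exp fun k => (Real.exp_pos _).le

/-- Only d ≥ 0 is required: for q = 0 the radii steps are 0 and division by 0 gives 0, so this value
needs no separate treatment. -/
lemma PrimrecBounded.div (hφ : PrimrecBounded φ) (hd : PrimrecBounded fun k => 1 / d k)
    (h0 : ∀ k, 0 ≤ d k) : PrimrecBounded fun k => φ k / d k :=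
  (hφ.mul hd fun k => by have := h0 k; positivity).mono fun k => by rw [mul_one_div]

lemma PrimrecBounded.approxDegree (hn : PrimrecBounded fun k => (n k : ℝ))
    (hr : PrimrecBounded fun k => (r k : ℝ)) (hq : PrimrecBounded fun k => (q k : ℝ)) :
    PrimrecBounded fun k => (approxDegree (n k) (r k) (q k) : ℝ) := by
  have hd := primrecBounded_inv_radiusStep hq
  have h0 := fun k => radiusStep_nonneg (q k)
  have hκ := hn.annulusBound hr hq
  have hκ0 := fun k => annulusBound_nonneg (n k) (r k) (q k)
  refine PrimrecBounded.natCeil ?_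
  refine ((PrimrecBounded.const 8).div hd h0).mul (((PrimrecBounded.const 1).add
    ((PrimrecBounded.const 4).div hd h0)).mul ((((PrimrecBounded.const 4).mul hκ hκ0).div hd h0).mul
      hκ hκ0) fun k => ?_) fun k => ?_
  all_goals
    have := h0 k
    have := hκ0 k
    positivity

lemma PrimrecBounded.elimBound (hn : PrimrecBounded fun k => (n k : ℝ))
    (hN : PrimrecBounded fun k => (N k : ℝ)) (hd : PrimrecBounded fun k => 1 / d k)
    (h0 : ∀ k, 0 ≤ d k) : PrimrecBounded fun k => elimBound (n k) (N k) (d k) := by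
  have h1 : PrimrecBounded fun k => 1 / (d k / 4) :=
    ((PrimrecBounded.const 4).mul hd fun k => by have := h0 k; positivity).mono fun k => by
      rw [mul_one_div, one_div_div]
  have h2 : PrimrecBounded fun k => 1 / (d k / 4) ^ 2 :=
    (h1.pow (e := fun _ => 2) (.const _) fun k => by have := h0 k; positivity).mono fun k => by
      rw [one_div_pow]
  have h3 : PrimrecBounded fun k => ((n k * (2 * N k) : ℕ) : ℝ) :=
    (hn.mul ((PrimrecBounded.const 2).mul hN fun k => by positivity) fun k => by positivity).mono
      fun k => by push_cast; rfl
  exact (hn.mul (((PrimrecBounded.const 1).add h1).add h2) fun k => by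
    have := h0 k; positivity).pow h3 fun k => by have := h0 k; positivity

lemma PrimrecBounded.elimInvBound (hn : PrimrecBounded fun k => (n k : ℝ))
    (hN : PrimrecBounded fun k => (N k : ℝ)) (hd : PrimrecBounded fun k => 1 / d k)
    (h0 : ∀ k, 0 ≤ d k) : PrimrecBounded fun k => elimInvBound (n k) (N k) (d k) := by
  have h1 := fun k => elimBound_nonneg (n k) (N k) (h0 k)
  refine hn.mul (hn.factorial.mul (((PrimrecBounded.const 1).add (hn.elimBound hN hd h0)).pow hn
    fun k => ?_) fun k => ?_) fun k => ?_
  all_goals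
    have := h1 k
    positivity

lemma PrimrecBounded.one_div_pow (hd : PrimrecBounded fun k => 1 / d k) (h0 : ∀ k, 0 ≤ d k)
    (hN : PrimrecBounded fun k => (N k : ℝ)) : PrimrecBounded fun k => 1 / d k ^ N k :=
  (hd.pow hN fun k => by have := h0 k; positivity).mono fun k => by rw [_root_.one_div_pow]

theorem PrimrecBounded.surgeryOrder (hn : PrimrecBounded fun k => (n k : ℝ))
    (hr : PrimrecBounded fun k => (r k : ℝ)) (hq : PrimrecBounded fun k => (q k : ℝ)) :
    PrimrecBounded fun k => (surgeryOrder (n k) (r k) (q k) : ℝ) := by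
  have hd := primrecBounded_inv_radiusStep hq
  have h0 := fun k => radiusStep_nonneg (q k)
  have hκ := hn.annulusBound hr hq
  have hκ0 := fun k => annulusBound_nonneg (n k) (r k) (q k)
  have hN := hn.approxDegree hr hq
  have hG0 := fun k => gaugeBound_nonneg (n k) (r k) (q k)
  have hGi0 := fun k => gaugeInvBound_nonneg (n k) (r k) (q k)
  have hC0 := fun k => circleBound_nonneg (n k) (r k) (q k)
  have hK0 := fun k => coeffBound_nonneg (r k) (q k)
  have hG : PrimrecBounded fun k => gaugeBound (n k) (r k) (q k) :=
    ((hn.elimBound hN hd h0).mul (.const (3 / 2)) fun k => by norm_num).mul hκ hκ0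
  have hnN : PrimrecBounded fun k =>
      ((2 * (n k * (2 * _root_.approxDegree (n k) (r k) (q k))) : ℕ) : ℝ) :=
    ((PrimrecBounded.const 2).mul (hn.mul ((PrimrecBounded.const 2).mul hN fun k => by positivity)
      fun k => by positivity) fun k => by positivity).mono fun k => by push_cast; rfl
  have hGi : PrimrecBounded fun k => gaugeInvBound (n k) (r k) (q k) := by
    have hI0 := fun k => elimInvBound_nonneg (n k) (_root_.approxDegree (n k) (r k) (q k)) (h0 k)
    refine hκ.mul (((PrimrecBounded.const 2).mul ((hn.elimInvBound hN hd h0).mul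
      ((PrimrecBounded.const 2).pow hnN fun _ => by norm_num) fun k => by positivity)
      fun k => ?_).div (hd.one_div_pow h0 hN) fun k => ?_) fun k => ?_
    all_goals
      have := hI0 k
      have := h0 k
      positivity
  have hD : PrimrecBounded fun k => (surgeryDegree (n k) (r k) (q k) : ℝ) :=
    (hN.add hnN).mono fun k => by unfold surgeryDegree; push_cast; rfl
  have hd8 : PrimrecBounded fun k => (radiusStep (q k) / 8)⁻¹ :=
    ((PrimrecBounded.const 8).div hd h0).mono fun k => by rw [inv_div]
  have hC : PrimrecBounded fun k => circleBound (n k) (r k) (q k) :=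
    (hG.mul hGi hGi0).mul ((hd8.add (hr.coeffBound hq)).add (hd8.mul hr fun k => by positivity))
      fun k => by
        have := h0 k
        have := hK0 k
        positivity
  have h2d : PrimrecBounded fun k => 1 / (2 * radiusStep (q k)) :=
    hd.mono fun k => by
      have := h0 k
      rw [one_div, one_div, mul_inv]
      exact mul_le_of_le_one_left (by positivity) (by norm_num)
  have hS : PrimrecBounded fun k => surgeryNorm (n k) (r k) (q k) :=
    ((hG.mul hGi hGi0).mul hr fun k => by positivity).add ((hD.add (.const 1)).mul
      (hC.div (h2d.one_div_pow (fun k => by have := h0 k; positivity) hD)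
        fun k => by have := h0 k; positivity) fun k => by
          have := h0 k
          have := hC0 k
          positivity)
  exact (hS.natCeil.add (hD.add (primrecBounded_logBound hn hr hq).natCeil)).mono fun k => by
    unfold _root_.surgeryOrder exponentBound; push_cast; rfl

end PrimitiveRecursive

/-! ### Assembly of the theorem. -/

section Main

variable {n m r : ℕ}

lemma IsomonodromicIn.refl {A : ℂ → CMat n} {Sig U : Set ℂ} (h : Disjoint Sig (frontier U)) :
    IsomonodromicIn A Sig A Sig U :=
  ⟨rfl, h, h, fun x _ => ⟨1, fun γ _ M => by simp⟩⟩

lemma SpecialSystem.exists_surgery_of_gap [NeZero n] (S : SpecialSystem n m r) {b : ℝ} {q : ℕ}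
    (hq : 0 < q) (hgb : gapWidth q ≤ b) (hb1 : b ≤ 1)
    (hloc : ∀ j, S.res j ≠ 0 → |S.pole j| ≤ b - gapWidth q ∨ b < |S.pole j|) :
    ∃ T : SpecialSystem n m (surgeryOrder n r q),
      IsomonodromicIn S.coeff S.locus T.coeff T.locus {t : ℂ | ‖t‖ < b} ∧
      T.locus ⊆ {t : ℂ | ‖t‖ < b} ∧
      (SpectralCondition S.coeff S.locus → SpectralCondition T.coeff T.locus) := by
  have hg : 0 < gapWidth q := by unfold gapWidth; positivity
  have hd : 0 < radiusStep q := by unfold radiusStep; positivity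
  have hκ := annulusBound_nonneg n r q
  refine S.exists_surgery (N := approxDegree n r q) (l := exponentBound n r q) hg hgb hb1 rfl hloc
    rfl rfl ?_ rfl rfl (Nat.le_ceil _) rfl rfl (Nat.le_add_left _ _) ?_
  · have := mul_pow_le_of_ceil hd (by unfold radiusStep; linarith) (Q := (1 + 4 / radiusStep q) *
      (4 * annulusBound n r q / radiusStep q * annulusBound n r q))
      (N := approxDegree n r q) (Nat.le_ceil _)
    change (1 + 4 / radiusStep q) * (4 * annulusBound n r q / radiusStep q *
      (1 - radiusStep q / 2) ^ approxDegree n r q * annulusBound n r q) ≤ 1 / 4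
    refine le_trans (le_of_eq ?_) this
    ring
  · refine (Nat.le_ceil (surgeryNorm n r q)).trans ?_
    unfold surgeryOrder
    exact_mod_cast Nat.le_add_right _ _

end Main

end

theorem mainTheorem7 :
    ∃ bound : ℕ × ℕ × ℕ × ℕ → ℕ, Primrec bound ∧
      ∀ (n m r q : ℕ) (S : SpecialSystem n m r) (a b : ℝ),
        0 ≤ a → a * (1 + 1 / (q : ℝ)) < b → b < (q : ℝ) → 1 / (q : ℝ) < b →
        Disjoint S.locus {t : ℂ | a < ‖t‖ ∧ ‖t‖ < b} →
        Disjoint S.locus {t : ℂ | ‖t‖ = b} →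
        ∃ (m' r' : ℕ) (T : SpecialSystem n m' r'),
          IsomonodromicIn S.coeff S.locus T.coeff T.locus {t : ℂ | ‖t‖ < b} ∧
          T.locus ⊆ {t : ℂ | ‖t‖ < b} ∧
          m' ≤ bound (n, m, r, q) ∧ r' ≤ bound (n, m, r, q) ∧
          (SpectralCondition S.coeff S.locus → SpectralCondition T.coeff T.locus) := by
  have hfst : Primrec fun k : ℕ => k.unpair.1 := Primrec.fst.comp Primrec.unpair
  have hsnd : Primrec fun k : ℕ => k.unpair.2 := Primrec.snd.comp Primrec.unpair
  -- The triple (n, r, q) is coded by one natural number, so that functions of one variable suffice.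
  obtain ⟨f, hf, hfb⟩ := PrimrecBounded.surgeryOrder (n := fun k => k.unpair.1)
    (r := fun k => k.unpair.2.unpair.1) (q := fun k => k.unpair.2.unpair.2) (.of_primrec hfst)
    (.of_primrec (hfst.comp hsnd)) (.of_primrec (hsnd.comp hsnd))
  -- The summand m + r serves the case in which the given system is kept, and m is the number of
  -- points t_j in the surgery as well; the order of the surgery does not depend on m.
  refine ⟨fun p => f (Nat.pair p.1 (Nat.pair p.2.2.1 p.2.2.2)) + (p.2.1 + p.2.2.1), ?_, ?_⟩
  · have h2 : Primrec fun p : ℕ × ℕ × ℕ × ℕ => p.2.1 := Primrec.fst.comp Primrec.snd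
    have h3 : Primrec fun p : ℕ × ℕ × ℕ × ℕ => p.2.2.1 :=
      Primrec.fst.comp (Primrec.snd.comp Primrec.snd)
    have h4 : Primrec fun p : ℕ × ℕ × ℕ × ℕ => p.2.2.2 :=
      Primrec.snd.comp (Primrec.snd.comp Primrec.snd)
    exact Primrec.nat_add.comp (hf.comp (Primrec₂.natPair.comp Primrec.fst
      (Primrec₂.natPair.comp h3 h4))) (Primrec.nat_add.comp h2 h3)
  intro n m r q S a b ha hab hbq hqb hdisj hdisj'
  have hb0 : 0 < b := lt_of_le_of_lt (by positivity) hqb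
  have hq : 0 < q := by exact_mod_cast hb0.trans hbq
  have hq' : (0 : ℝ) < q := by exact_mod_cast hq
  -- If no pole lies outside the disk nothing has to be done, however large b is. A pole outside
  -- forces b ≤ 1 and n ≠ 0, the setting of the surgery.
  by_cases hsub : S.locus ⊆ {t : ℂ | ‖t‖ < b}
  · refine ⟨m, r, S, IsomonodromicIn.refl (hdisj'.mono_right fun z hz => ?_), hsub, ?_, ?_,
      fun h => h⟩
    · have h1 := frontier_lt_subset_eq continuous_norm continuous_const hz
      exact h1
    · dsimp only; omega
    · dsimp only; omega
  · obtain ⟨z, ⟨j, hj, hzj⟩, hzb⟩ := Set.not_subset.1 hsub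
    have hb1 : b ≤ 1 := by
      have h1 : b ≤ ‖z‖ := not_lt.1 hzb
      rw [hzj, Complex.norm_real, Real.norm_eq_abs] at h1
      exact h1.trans (S.abs_pole_le j)
    have hn : NeZero n := ⟨by
      rintro rfl
      exact hj (Subsingleton.elim _ _)⟩
    -- From a (q + 1) < b q and b > 1 / q one gets b - a > b / (q + 1) > 1 / (q (q + 1)).
    have hgap : gapWidth q ≤ b - a := by
      unfold gapWidth
      have h1 : a * (q + 1) < b * q := by
        have := mul_lt_mul_of_pos_right hab hq'
        rwa [mul_assoc, add_mul, one_mul, one_div, inv_mul_cancel₀ hq'.ne'] at this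
      have h2 : 1 < b * q := by rwa [div_lt_iff₀ hq'] at hqb
      rw [div_le_iff₀ (by positivity)]
      nlinarith
    obtain ⟨T, hT1, hT2, hT3⟩ := S.exists_surgery_of_gap hq (by linarith) hb1 fun i hi => by
      have hmem : ((S.pole i : ℝ) : ℂ) ∈ S.locus := ⟨i, hi, rfl⟩
      have h1 := Set.disjoint_left.1 hdisj hmem
      have h2 := Set.disjoint_left.1 hdisj' hmem
      simp only [Set.mem_ofPred_eq, Complex.norm_real, Real.norm_eq_abs, not_and, not_lt] at h1 h2
      rcases lt_or_ge a |S.pole i| with h3 | h3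
      · exact Or.inr (lt_of_le_of_ne (h1 h3) (Ne.symm h2))
      · exact Or.inl (by linarith)
    refine ⟨m, surgeryOrder n r q, T, hT1, hT2, ?_, ?_, hT3⟩
    · dsimp only; omega
    · have h1 := hfb (Nat.pair n (Nat.pair r q))
      simp only [Nat.unpair_pair] at h1
      have h2 : surgeryOrder n r q ≤ f (Nat.pair n (Nat.pair r q)) := by exact_mod_cast h1
      dsimp only
      omega
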